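/- Let $\mathbb K$ be a field of characteristic zero. A DGCA is a unital graded commutative differential algebra $A=\bigoplus_{k\ge 0}A^k$ over $\mathbb K$ with differential $d$ of degree $1$. A \emph{Poincaré DGCA of degree $n$} is a DGCA $A=\bigoplus_{k=0}^n A^k$ with finite-dimensional cohomology $H(A)$ together with $\int\in (H^n(A))^\vee$ such that the pairing on $H(A)$ given by $\langle x,y\rangle=\int xy$ if $|x|+|y|=n$, and $0$ otherwise, is non-degenerate; on $A$ put $\langle a,b\rangle=\int[ab]$ if $|a|+|b|=n$, and $0$ otherwise. A \emph{Hodge homotopy} on $A$ is a linear map $d^-\colon A^*\to A^{*-1}$ with $d^-d^-=0$, $d^-dd^-=d^-$, $dd^-d=d$, $\langle \mathrm{Im}\,d^-,\mathrm{Im}\,d^-\rangle=0$ and $\langle\mathrm{Im}\,\pi,\mathrm{Im}\,d^-\rangle=0$, where $\pi=\mathrm{id}-dd^--d^-d$. The map $\mathrm{Im}\,\pi\to H(A)$, $\alpha\mapsto[\alpha]$, is then an isomorphism; let $\iota\colon H(A)\to \mathrm{Im}\,\pi$ be its inverse and define $$\mu_3(a,b,c)=\bigl[\pi\bigl(d^-(\alpha\beta)\gamma-(-1)^{|\alpha|}\alpha\,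 d^-(\beta\gamma)\bigr)\bigr],\qquad \alpha=\iota(a),\ \beta=\iota(b),\ \gamma=\iota(c).$$ This is a Harrison cocycle of bidegree $(3,-1)$ of the graded commutative algebra $H(A)$, and $[\mu_3]\in \mathrm{HHarr}^{3,-1}(H(A),H(A))$ denotes its class. Here, for a graded commutative algebra $B$, $\mathrm{HHarr}^{3,-1}(B,B)$ is the cohomology in bidegree $(3,-1)$ of the subcomplex of the Hochschild complex of $B$ (with Koszul signs) consisting of the cochains that vanish on shuffles; an isomorphism of graded commutative algebras induces an isomorphism of these groups by transport of structure. Two DGCAs are in the same homotopy class if they are connected by a finite zig-zag of quasi-isomorphisms of DGCAs, and $A$ is formal if it is in the homotopy class of $(H(A),0)$. $A$ is $(r-1)$-connected if $H^0(A)=\mathbb K$ and $H^k(A)=0$ for $1\le k\le r-1$. \textbf{Theorem.} Let $r\ge 2$ and let $A$, $A'$ be $(r-1)$-connected Poincaré DGCAs over $\mathbb K$ of degrees $n,n'\le 4r-1$, each admitting a Hodge homotopy. Then: (1) the class $[\mu_3]\in\mathrm{HHarr}^{3,-1}(H(A),H(A))$ does not depend on the choice of the Hodge homotopy on $A$; (2)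 $A$ and $A'$ are in the same homotopy class if and only if there exists an isomorphism of graded commutative algebras $\phi\colon H(A)\to H(A')$ whose induced isomorphism of Harrison cohomology groups $\mathrm{HHarr}^{3,-1}(H(A),H(A))\to\mathrm{HHarr}^{3,-1}(H(A'),H(A'))$ maps $[\mu_3]$ to $[\mu_3']$; (3) $A$ is formal if and only if $[\mu_3]=0$. -/

import Mathlib

universe u

noncomputable section

namespace HarrisonDGCA

/-! ### Graded commutative algebras -/

/-- A (unital, associative) graded commutative algebra `⨁_{k ≥ 0} B^k` over a field `K`. -/
structure GCA (K : Type u) [Field K] where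
  carrier : Type u
  [ring : Ring carrier]
  [algebra : Algebra K carrier]
  /-- the homogeneous component of degree `k` -/
  gr : ℕ → Submodule K carrier
  [graded : GradedAlgebra gr]
  mul_comm' : ∀ {i j : ℕ} {a b : carrier}, a ∈ gr i → b ∈ gr j →
    a * b = (-1 : K) ^ (i * j) • (b * a)

attribute [instance] GCA.ring GCA.algebra GCA.graded

/-- For a grading `(V^k)_{k ≥ 0}`, the component `V^{k-1}`, which is zero for `k = 0`. -/
def pred {K V : Type u} [Field K] [AddCommGroup V] [Module K V] (gr : ℕ → Submodule K V) :
    ℕ → Submodule K V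
  | 0 => ⊥
  | k + 1 => gr k

section Sign

variable {K V : Type u} [Field K] [Ring V] [Algebra K V]

/-- The grading involution `ε`, equal to `(-1)^k` in degree `k`. -/
def sgn (gr : ℕ → Submodule K V) [GradedAlgebra gr] : V →ₗ[K] V :=
  (DirectSum.toModule K ℕ V (fun k => ((-1 : K) ^ k) • (gr k).subtype)) ∘ₗ
    (DirectSum.decomposeLinearEquiv gr).toLinearMap

variable (gr : ℕ → Submodule K V)

theorem mem_of_pred {k : ℕ} {x : V} (hx : x ∈ pred gr k) : x = 0 ∨ ∃ j, k = j + 1 ∧ x ∈ gr j := by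
  cases k with
  | zero => left; simpa [pred] using hx
  | succ j => right; exact ⟨j, rfl, hx⟩

variable [GradedAlgebra gr]

theorem sgn_of_mem {k : ℕ} {x : V} (hx : x ∈ gr k) : sgn gr x = (-1 : K) ^ k • x := by
  lift x to gr k using hx
  simp [sgn]

theorem hom_induction {P : V → Prop} (h0 : P 0) (h1 : ∀ k, ∀ x ∈ gr k, P x)
    (h2 : ∀ x y, P x → P y → P (x + y)) (x : V) : P x :=
  DirectSum.Decomposition.inductionOn gr h0 (fun {i} m => h1 i m m.2) (fun x y => h2 x y) x

theorem sgn_mul (a b : V) : sgn gr (a * b) = sgn gr a * sgn gr b := by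
  induction a using hom_induction gr with
  | h0 => simp
  | h2 x y hx hy => simp [add_mul, hx, hy]
  | h1 i a ha =>
    induction b using hom_induction gr with
    | h0 => simp
    | h2 x y hx hy => simp [mul_add, hx, hy]
    | h1 j b hb =>
      rw [sgn_of_mem gr ha, sgn_of_mem gr hb, sgn_of_mem gr (SetLike.mul_mem_graded ha hb)]
      simp [pow_add, smul_smul, mul_comm]

theorem sgn_sgn (a : V) : sgn gr (sgn gr a) = a := by
  induction a using hom_induction gr with
  | h0 => simp
  | h2 x y hx hy => simp [hx, hy]
  | h1 i a ha =>
    rw [sgn_of_mem gr ha, map_smul, sgn_of_mem gr ha, smul_smul, ← mul_pow]; simp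

theorem sgn_of_pred {k : ℕ} {x : V} (hx : x ∈ pred gr k) :
    sgn gr x = -((-1 : K) ^ k • x) := by
  rcases mem_of_pred gr hx with rfl | ⟨j, rfl, h⟩
  · simp
  · rw [sgn_of_mem gr h, pow_succ]; simp

theorem mul_mem_pred {i j : ℕ} {x y : V} (hx : x ∈ gr i) (hy : y ∈ pred gr j) :
    x * y ∈ pred gr (i + j) := by
  rcases mem_of_pred gr hy with rfl | ⟨j, rfl, h⟩
  · simp
  · exact SetLike.mul_mem_graded (A := gr) hx h

theorem mem_pred_mul {i j : ℕ} {x y : V} (hx : x ∈ pred gr i) (hy : y ∈ gr j) :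
    x * y ∈ pred gr (i + j) := by
  rcases mem_of_pred gr hx with rfl | ⟨i, rfl, h⟩
  · simp
  · have := SetLike.mul_mem_graded h hy
    rwa [show i + 1 + j = (i + j) + 1 by omega]

end Sign

/-! ### The Harrison complex in internal degree `-1`

The part `CHarr^{2,-1} → CHarr^{3,-1} → (4-cochains)` of the Harrison complex of `B` with
coefficients in `B`, which computes `HHarr^{3,-1}(B,B)`. It is the subcomplex of the Hochschild
complex given by the cochains which vanish on shuffles (with Koszul signs). -/

namespace GCA

variable {K : Type u} [Field K] (B : GCA K)

/-- Bilinear Hochschild cochains `B ⊗ B → B` (of any internal degree). -/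
abbrev Coch2 : Type u := B.carrier →ₗ[K] B.carrier →ₗ[K] B.carrier

/-- Trilinear Hochschild cochains `B ⊗ B ⊗ B → B`. -/
abbrev Coch3 : Type u := B.carrier →ₗ[K] B.carrier →ₗ[K] B.carrier →ₗ[K] B.carrier

set_option maxSynthPendingDepth 6 in
instance : AddCommGroup B.Coch3 := inferInstance

/-- Functions of four variables, the target of the differential on trilinear cochains. -/
abbrev Coch4 : Type u := B.carrier → B.carrier → B.carrier → B.carrier → B.carrier

/-- The Hochschild differential of a bilinear cochain of internal degree `-1`, with Koszul signs:
`(dφ)(a,b,c) = (-1)^{|a|} a φ(b,c) - φ(ab,c) + φ(a,bc) - φ(a,b) c`. -/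
def d2 : B.Coch2 →ₗ[K] B.Coch3 where
  toFun φ :=
    LinearMap.mk₂ K
      (fun a b =>
        (LinearMap.mulLeft K (sgn B.gr a)) ∘ₗ (φ b) - φ (a * b)
          + (φ a) ∘ₗ (LinearMap.mulLeft K b) - LinearMap.mulLeft K (φ a b))
      (by intros; ext; simp [add_mul]; abel)
      (by intros; ext; simp [smul_sub, smul_add])
      (by intros; ext; simp [add_mul, mul_add]; abel)
      (by intros; ext; simp [smul_sub, smul_add])
  map_add' φ ψ := by ext; simp [add_mul, mul_add]; abel
  map_smul' t φ := by ext; simp [smul_sub, smul_add]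

@[simp] theorem d2_apply (φ : B.Coch2) (a b c : B.carrier) :
    B.d2 φ a b c = sgn B.gr a * φ b c - φ (a * b) c + φ a (b * c) - φ a b * c := rfl

/-- The Hochschild differential of a trilinear cochain of internal degree `-1`:
`(dμ)(a,b,c,e) = (-1)^{|a|} a μ(b,c,e) - μ(ab,c,e) + μ(a,bc,e) - μ(a,b,ce) + μ(a,b,c) e`. -/
def d3 : B.Coch3 →ₗ[K] B.Coch4 where
  toFun μ a b c e :=
    sgn B.gr a * μ b c e - μ (a * b) c e + μ a (b * c) e - μ a b (c * e) + μ a b c * e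
  map_add' μ ν := by
    funext a b c e; simp [add_mul, mul_add]; abel
  map_smul' t μ := by
    funext a b c e; simp [smul_sub, smul_add]

/-- `CHarr^{2,-1}(B,B)`: bilinear cochains of internal degree `-1` which vanish on the shuffles
`a ⧢ b = a ⊗ b - (-1)^{|a||b|} b ⊗ a`. -/
def CHarr2 : Submodule K B.Coch2 where
  carrier := {φ | (∀ i j, ∀ a ∈ B.gr i, ∀ b ∈ B.gr j, φ a b ∈ pred B.gr (i + j)) ∧
    ∀ i j, ∀ a ∈ B.gr i, ∀ b ∈ B.gr j, φ a b - (-1 : K) ^ (i * j) • φ b a = 0}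
  zero_mem' := by simp
  add_mem' := by
    rintro φ ψ ⟨h1, h2⟩ ⟨h3, h4⟩
    refine ⟨fun i j a ha b hb => add_mem (h1 i j a ha b hb) (h3 i j a ha b hb),
      fun i j a ha b hb => ?_⟩
    have := h2 i j a ha b hb
    have := h4 i j a ha b hb
    simp only [LinearMap.add_apply, smul_add]
    rw [add_sub_add_comm, h2 i j a ha b hb, h4 i j a ha b hb, add_zero]
  smul_mem' := by
    rintro t φ ⟨h1, h2⟩
    refine ⟨fun i j a ha b hb => Submodule.smul_mem _ _ (h1 i j a ha b hb),
      fun i j a ha b hb => ?_⟩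
    simp only [LinearMap.smul_apply]
    rw [smul_comm, ← smul_sub, h2 i j a ha b hb, smul_zero]

/-- `CHarr^{3,-1}(B,B)`: trilinear cochains of internal degree `-1` which vanish on the shuffles
`a ⧢ (b ⊗ c) = a ⊗ b ⊗ c - (-1)^{|a||b|} b ⊗ a ⊗ c + (-1)^{|a|(|b|+|c|)} b ⊗ c ⊗ a`.
(The shuffles `(b ⊗ c) ⧢ a` are the same up to sign.) -/
def CHarr3 : Submodule K B.Coch3 where
  carrier := {μ | (∀ i j k, ∀ a ∈ B.gr i, ∀ b ∈ B.gr j, ∀ c ∈ B.gr k,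
      μ a b c ∈ pred B.gr (i + j + k)) ∧
    ∀ i j k, ∀ a ∈ B.gr i, ∀ b ∈ B.gr j, ∀ c ∈ B.gr k,
      μ a b c - (-1 : K) ^ (i * j) • μ b a c + (-1 : K) ^ (i * (j + k)) • μ b c a = 0}
  zero_mem' := by simp
  add_mem' := by
    rintro φ ψ ⟨h1, h2⟩ ⟨h3, h4⟩
    refine ⟨fun i j k a ha b hb c hc => add_mem (h1 i j k a ha b hb c hc)
      (h3 i j k a ha b hb c hc), fun i j k a ha b hb c hc => ?_⟩
    have e1 := h2 i j k a ha b hb c hc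
    have e2 := h4 i j k a ha b hb c hc
    simp only [LinearMap.add_apply, smul_add]
    rw [add_sub_add_comm, add_add_add_comm, e1, e2, add_zero]
  smul_mem' := by
    rintro t φ ⟨h1, h2⟩
    refine ⟨fun i j k a ha b hb c hc => Submodule.smul_mem _ _ (h1 i j k a ha b hb c hc),
      fun i j k a ha b hb c hc => ?_⟩
    simp only [LinearMap.smul_apply]
    rw [smul_comm, smul_comm _ t, ← smul_sub, ← smul_add, h2 i j k a ha b hb c hc, smul_zero]

/-- Harrison cocycles of bidegree `(3,-1)`. -/
def ZHarr3 : Submodule K B.Coch3 := B.CHarr3 ⊓ LinearMap.ker B.d3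

variable {B}

theorem d3_d2 (φ : B.Coch2) : B.d3 (B.d2 φ) = 0 := by
  funext a b c e
  simp only [d3, LinearMap.coe_mk, AddHom.coe_mk, d2_apply, sgn_mul, mul_sub, mul_add, sub_mul,
    add_mul, mul_assoc, Pi.zero_apply]
  abel

theorem neg_one_pow_cases (n : ℕ) :
    ((-1 : K) ^ n = 1 ∧ Even n) ∨ ((-1 : K) ^ n = -1 ∧ Odd n) := by
  rcases Nat.even_or_odd n with h | h
  · exact Or.inl ⟨h.neg_one_pow, h⟩
  · exact Or.inr ⟨h.neg_one_pow, h⟩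

theorem comm_pred {i j : ℕ} {x y : B.carrier} (hx : x ∈ B.gr i) (hy : y ∈ pred B.gr j) :
    y * x = (-1 : K) ^ (i * j + i) • (x * y) := by
  rcases mem_of_pred B.gr hy with rfl | ⟨j, rfl, h⟩
  · simp
  · rw [B.mul_comm' h hx]
    congr 1
    rw [show i * (j + 1) + i = j * i + 2 * i by ring, pow_add]; simp

theorem d2_mem {φ : B.Coch2} (hφ : φ ∈ B.CHarr2) : B.d2 φ ∈ B.ZHarr3 := by
  refine ⟨⟨fun i j k a ha b hb c hc => ?_, fun i j k a ha b hb c hc => ?_⟩, d3_d2 φ⟩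
  · rw [d2_apply, sgn_of_mem B.gr ha]
    refine sub_mem (add_mem (sub_mem ?_ ?_) ?_) ?_
    · rw [smul_mul_assoc, add_assoc]
      exact Submodule.smul_mem _ _ (mul_mem_pred B.gr ha (hφ.1 _ _ _ hb _ hc))
    · exact hφ.1 _ _ _ (SetLike.mul_mem_graded ha hb) _ hc
    · rw [add_assoc]
      exact hφ.1 _ _ _ ha _ (SetLike.mul_mem_graded hb hc)
    · exact mem_pred_mul B.gr (hφ.1 _ _ _ ha _ hb) hc
  · have s : ∀ {i j : ℕ} {a b : B.carrier}, a ∈ B.gr i → b ∈ B.gr j →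
        φ a b = (-1 : K) ^ (i * j) • φ b a := fun ha hb => sub_eq_zero.1 (hφ.2 _ _ _ ha _ hb)
    simp only [d2_apply, sgn_of_mem B.gr ha, sgn_of_mem B.gr hb]
    rw [s (SetLike.mul_mem_graded hb hc) ha, s ha hc, s ha hb,
      comm_pred ha (hφ.1 _ _ _ hb _ hc), B.mul_comm' ha hb, B.mul_comm' ha hc]
    simp only [map_smul, LinearMap.smul_apply, smul_mul_assoc, mul_smul_comm]
    rcases neg_one_pow_cases (K := K) i with ⟨hi, hi'⟩ | ⟨hi, hi'⟩ <;>
    rcases neg_one_pow_cases (K := K) j with ⟨hj, hj'⟩ | ⟨hj, hj'⟩ <;>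
    rcases neg_one_pow_cases (K := K) k with ⟨hk, hk'⟩ | ⟨hk, hk'⟩ <;>
    simp [hi, hj, hk, pow_add, pow_mul, mul_add] <;> abel

variable (B)

/-- The Harrison differential `CHarr^{2,-1}(B,B) → ZHarr^{3,-1}(B,B)`. -/
def dHarr2 : B.CHarr2 →ₗ[K] B.ZHarr3 :=
  (B.d2 ∘ₗ B.CHarr2.subtype).codRestrict B.ZHarr3 (fun φ => d2_mem φ.2)

/-- The Harrison cohomology group `HHarr^{3,-1}(B,B)`. -/
abbrev HHarr3 : Type u := B.ZHarr3 ⧸ LinearMap.range B.dHarr2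

/-- An isomorphism of graded commutative algebras. -/
structure Iso (B B' : GCA K) where
  toAlgEquiv : B.carrier ≃ₐ[K] B'.carrier
  map_gr : ∀ k, (B.gr k).map toAlgEquiv.toLinearMap = B'.gr k


namespace Iso

variable {B B' : GCA K} (f : Iso B B')

theorem map_mem {k : ℕ} {x : B.carrier} (hx : x ∈ B.gr k) : f.toAlgEquiv x ∈ B'.gr k := by
  rw [← f.map_gr k]; exact ⟨x, hx, rfl⟩

theorem symm_mem {k : ℕ} {x : B'.carrier} (hx : x ∈ B'.gr k) :
    f.toAlgEquiv.symm x ∈ B.gr k := by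
  rw [← f.map_gr k] at hx
  obtain ⟨y, hy, rfl⟩ := hx
  simpa using hy

theorem map_pred {k : ℕ} {x : B.carrier} (hx : x ∈ pred B.gr k) :
    f.toAlgEquiv x ∈ pred B'.gr k := by
  rcases mem_of_pred B.gr hx with rfl | ⟨j, rfl, h⟩
  · simp
  · exact f.map_mem h

theorem symm_sgn (x : B'.carrier) :
    f.toAlgEquiv.symm (sgn B'.gr x) = sgn B.gr (f.toAlgEquiv.symm x) := by
  induction x using hom_induction B'.gr with
  | h0 => simp
  | h2 x y hx hy => simp [hx, hy]
  | h1 i a ha => rw [sgn_of_mem _ ha, sgn_of_mem _ (f.symm_mem ha), map_smul]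

/-- Transport of bilinear cochains, `φ ↦ f ∘ φ ∘ (f⁻¹ ⊗ f⁻¹)`. -/
def map2 (φ : B.Coch2) : B'.Coch2 :=
  LinearMap.mk₂ K (fun a b => f.toAlgEquiv (φ (f.toAlgEquiv.symm a) (f.toAlgEquiv.symm b)))
    (by intros; simp) (by intros; simp) (by intros; simp) (by intros; simp)

/-- Transport of trilinear cochains, `μ ↦ f ∘ μ ∘ (f⁻¹ ⊗ f⁻¹ ⊗ f⁻¹)`. -/
def map3 : B.Coch3 →ₗ[K] B'.Coch3 where
  toFun μ := LinearMap.mk₂ K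
    (fun a b => f.toAlgEquiv.toLinearMap ∘ₗ
      (μ (f.toAlgEquiv.symm a) (f.toAlgEquiv.symm b)) ∘ₗ f.toAlgEquiv.symm.toLinearMap)
    (by intros; ext; simp) (by intros; ext; simp) (by intros; ext; simp) (by intros; ext; simp)
  map_add' μ ν := by ext; simp
  map_smul' t μ := by ext; simp

@[simp] theorem map2_apply (φ : B.Coch2) (a b : B'.carrier) :
    f.map2 φ a b = f.toAlgEquiv (φ (f.toAlgEquiv.symm a) (f.toAlgEquiv.symm b)) := rfl

@[simp] theorem map3_apply (μ : B.Coch3) (a b c : B'.carrier) :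
    f.map3 μ a b c = f.toAlgEquiv (μ (f.toAlgEquiv.symm a) (f.toAlgEquiv.symm b)
      (f.toAlgEquiv.symm c)) := rfl

theorem map2_mem {φ : B.Coch2} (h : φ ∈ B.CHarr2) : f.map2 φ ∈ B'.CHarr2 := by
  refine ⟨fun i j a ha b hb => f.map_pred (h.1 _ _ _ (f.symm_mem ha) _ (f.symm_mem hb)),
    fun i j a ha b hb => ?_⟩
  have := congrArg f.toAlgEquiv (h.2 _ _ _ (f.symm_mem ha) _ (f.symm_mem hb))
  rwa [map_sub, map_smul, map_zero] at this

theorem map3_mem {μ : B.Coch3} (h : μ ∈ B.ZHarr3) : f.map3 μ ∈ B'.ZHarr3 := by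
  refine ⟨⟨fun i j k a ha b hb c hc =>
    f.map_pred (h.1.1 _ _ _ _ (f.symm_mem ha) _ (f.symm_mem hb) _ (f.symm_mem hc)),
    fun i j k a ha b hb c hc => ?_⟩, ?_⟩
  · have := congrArg f.toAlgEquiv
      (h.1.2 _ _ _ _ (f.symm_mem ha) _ (f.symm_mem hb) _ (f.symm_mem hc))
    rwa [map_add, map_sub, map_smul, map_smul, map_zero] at this
  · have h2 : B.d3 μ = 0 := h.2
    refine LinearMap.mem_ker.2 ?_
    funext a b c e
    have := congrArg f.toAlgEquiv (congrFun (congrFun (congrFun (congrFun h2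
      (f.toAlgEquiv.symm a)) (f.toAlgEquiv.symm b)) (f.toAlgEquiv.symm c)) (f.toAlgEquiv.symm e))
    simpa [d3, ← symm_sgn] using this

theorem map3_d2 (φ : B.Coch2) : f.map3 (B.d2 φ) = B'.d2 (f.map2 φ) := by
  ext a b c
  simp [← symm_sgn]

/-- The isomorphism `HHarr^{3,-1}(B,B) → HHarr^{3,-1}(B',B')` induced by an isomorphism of graded
commutative algebras `B ≃ B'`. -/
def mapHHarr3 : B.HHarr3 →ₗ[K] B'.HHarr3 :=
  Submodule.mapQ _ _
    ((f.map3 ∘ₗ B.ZHarr3.subtype).codRestrict B'.ZHarr3 (fun μ => f.map3_mem μ.2))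
    (by
      rintro _ ⟨φ, rfl⟩
      exact ⟨⟨f.map2 φ, f.map2_mem φ.2⟩, Subtype.ext (f.map3_d2 φ.1).symm⟩)

end Iso

end GCA

/-! ### Differential graded commutative algebras and their cohomology -/

/-- A differential graded commutative algebra `(⨁_{k ≥ 0} A^k, d)` over a field `K`, with `d` of
degree `1`. -/
structure DGCA (K : Type u) [Field K] extends GCA K where
  d : carrier →ₗ[K] carrier
  d_mem : ∀ {k : ℕ} {a : carrier}, a ∈ gr k → d a ∈ gr (k + 1)
  d_d : ∀ a, d (d a) = 0
  leibniz : ∀ {k : ℕ} {a : carrier}, a ∈ gr k → ∀ b : carrier,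
    d (a * b) = d a * b + (-1 : K) ^ k • (a * d b)

/-- A graded commutative algebra as a DGCA with zero differential. -/
def GCA.toDGCA {K : Type u} [Field K] (B : GCA K) : DGCA K where
  toGCA := B
  d := 0
  d_mem _ := by simp
  d_d _ := by simp
  leibniz _ _ := by simp

namespace DGCA

variable {K : Type u} [Field K] (A : DGCA K)

theorem leibniz_sgn (a b : A.carrier) : A.d (a * b) = A.d a * b + sgn A.gr a * A.d b := by
  induction a using hom_induction A.gr with
  | h0 => simp
  | h2 x y hx hy => simp [add_mul, hx, hy]; abel
  | h1 i a ha => rw [A.leibniz ha, sgn_of_mem _ ha, smul_mul_assoc]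

theorem d_sgn (a : A.carrier) : A.d (sgn A.gr a) = -sgn A.gr (A.d a) := by
  induction a using hom_induction A.gr with
  | h0 => simp
  | h2 x y hx hy => simp [hx, hy]; abel
  | h1 i a ha => rw [sgn_of_mem _ ha, sgn_of_mem _ (A.d_mem ha), pow_succ]; simp

theorem d_one : A.d 1 = 0 := by
  have := A.leibniz (SetLike.one_mem_graded A.gr) 1
  simpa using this

/-- The algebra of cocycles `ker d`. -/
def cocycles : Subalgebra K A.carrier where
  carrier := {a | A.d a = 0}
  mul_mem' {a b} (ha : A.d a = 0) (hb : A.d b = 0) := by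
    simp [leibniz_sgn, ha, hb]
  add_mem' {a b} (ha : A.d a = 0) (hb : A.d b = 0) := by
    simp [ha, hb]
  algebraMap_mem' t := by
    simp [Algebra.algebraMap_eq_smul_one, d_one]

/-- The ideal of coboundaries `im d` in `ker d`. -/
def coboundaries : Ideal A.cocycles where
  carrier := {z | ∃ a, A.d a = z}
  zero_mem' := ⟨0, by simp⟩
  add_mem' := by
    rintro _ _ ⟨a, ha⟩ ⟨b, hb⟩
    exact ⟨a + b, by simp [ha, hb]⟩
  smul_mem' := by
    rintro z w ⟨a, ha⟩
    refine ⟨sgn A.gr z * a, ?_⟩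
    have hz : A.d z = 0 := z.2
    simp [leibniz_sgn, d_sgn, hz, sgn_sgn, ha]

instance : A.coboundaries.IsTwoSided where
  mul_mem_of_left := by
    rintro w z ⟨a, ha⟩
    refine ⟨a * z, ?_⟩
    have hz : A.d z = 0 := z.2
    simp [leibniz_sgn, hz, ha]

/-- The total cohomology `H(A) = ker d / im d`. -/
abbrev Coh : Type u := A.cocycles ⧸ A.coboundaries

/-- The cohomology class of a cocycle. -/
def qcls : A.cocycles →ₐ[K] A.Coh := Ideal.Quotient.mkₐ K A.coboundaries

theorem qcls_surjective : Function.Surjective A.qcls := Ideal.Quotient.mkₐ_surjective K _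

theorem qcls_eq_zero {z : A.cocycles} : A.qcls z = 0 ↔ ∃ a, A.d a = z :=
  Ideal.Quotient.eq_zero_iff_mem

theorem qcls_eq {z w : A.cocycles} : A.qcls z = A.qcls w ↔ ∃ a, A.d a = z - w := by
  rw [← sub_eq_zero, ← map_sub, qcls_eq_zero]; rfl

/-- `H^k(A)`, as a subspace of `H(A)`. -/
def cohGr (k : ℕ) : Submodule K A.Coh :=
  ((A.gr k).comap A.cocycles.val.toLinearMap).map A.qcls.toLinearMap

theorem mem_cohGr {k : ℕ} {x : A.Coh} :
    x ∈ A.cohGr k ↔ ∃ z : A.cocycles, (z : A.carrier) ∈ A.gr k ∧ A.qcls z = x := Iff.rfl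

/-- The component of degree `k` of an element. -/
def proj (k : ℕ) : A.carrier →ₗ[K] A.carrier := GradedAlgebra.proj A.gr k

theorem proj_mem (k : ℕ) (a : A.carrier) : A.proj k a ∈ A.gr k :=
  (DirectSum.decompose A.gr a k).2

theorem proj_of_mem {k : ℕ} {a : A.carrier} (ha : a ∈ A.gr k) : A.proj k a = a :=
  DirectSum.decompose_of_mem_same A.gr ha

theorem proj_of_mem_ne {j k : ℕ} {a : A.carrier} (ha : a ∈ A.gr j) (h : j ≠ k) :
    A.proj k a = 0 :=
  DirectSum.decompose_of_mem_ne A.gr ha h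

theorem d_proj (k : ℕ) (a : A.carrier) : A.d (A.proj k a) = A.proj (k + 1) (A.d a) := by
  induction a using hom_induction A.gr with
  | h0 => simp
  | h2 x y hx hy => simp [hx, hy]
  | h1 i a ha =>
    by_cases h : i = k
    · subst h
      rw [proj_of_mem _ ha, proj_of_mem _ (A.d_mem ha)]
    · rw [proj_of_mem_ne _ ha h, proj_of_mem_ne _ (A.d_mem ha) (by omega), map_zero]

theorem proj_zero_d (a : A.carrier) : A.proj 0 (A.d a) = 0 := by
  induction a using hom_induction A.gr with
  | h0 => simp
  | h2 x y hx hy => simp [hx, hy]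
  | h1 i a ha => rw [proj_of_mem_ne _ (A.d_mem ha) (by omega)]

theorem sum_proj (a : A.carrier) : ∃ s : Finset ℕ, a = ∑ k ∈ s, A.proj k a := by
  classical
  exact ⟨_, (DirectSum.sum_support_decompose A.gr a).symm⟩

/-- The component of degree `k` of a cocycle. -/
def projZ (k : ℕ) : A.cocycles →ₗ[K] A.cocycles :=
  LinearMap.codRestrict (Subalgebra.toSubmodule A.cocycles)
    (A.proj k ∘ₗ A.cocycles.val.toLinearMap)
    (fun z => by
      have hz : A.d z = 0 := z.2
      change A.d (A.proj k z) = 0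
      rw [d_proj, hz, map_zero])

theorem qcls_projZ {k : ℕ} {z w : A.cocycles} (h : A.qcls z = A.qcls w) :
    A.qcls (A.projZ k z) = A.qcls (A.projZ k w) := by
  rw [qcls_eq] at h ⊢
  obtain ⟨a, ha⟩ := h
  have e : ((A.projZ k z : A.cocycles) : A.carrier) - A.projZ k w = A.proj k (A.d a) := by
    rw [ha, map_sub]; rfl
  rw [e]
  cases k with
  | zero => exact ⟨0, by rw [proj_zero_d, map_zero]⟩
  | succ k => exact ⟨A.proj k a, A.d_proj k a⟩

instance : SetLike.GradedMonoid A.cohGr where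
  one_mem := ⟨1, SetLike.one_mem_graded A.gr, map_one A.qcls⟩
  mul_mem := by
    rintro i j _ _ ⟨z, hz, rfl⟩ ⟨w, hw, rfl⟩
    exact ⟨z * w, SetLike.mul_mem_graded (A := A.gr) hz hw, map_mul A.qcls z w⟩

theorem cohGr_isInternal : DirectSum.IsInternal A.cohGr := by
  classical
  refine (DirectSum.isInternal_submodule_iff_iSupIndep_and_iSup_eq_top _).2 ⟨?_, ?_⟩
  · rw [iSupIndep_def]
    intro k
    rw [Submodule.disjoint_def]
    rintro _ ⟨z, hz, rfl⟩ hx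
    have key : ∀ x ∈ ⨆ j, ⨆ (_ : j ≠ k), A.cohGr j, ∀ w, A.qcls w = x →
        A.qcls (A.projZ k w) = 0 := by
      intro x hx
      induction hx using Submodule.iSup_induction' with
      | mem j x hx =>
        by_cases h : j = k
        · simp [h] at hx
          subst hx
          intro w hw
          rw [A.qcls_projZ (w := 0) (by rw [hw, map_zero]), map_zero, map_zero]
        · simp [h] at hx
          obtain ⟨y, hy, rfl⟩ := hx
          intro w hw
          rw [A.qcls_projZ hw]
          have : A.projZ k y = 0 := Subtype.ext (A.proj_of_mem_ne hy h)
          rw [this, map_zero]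
      | zero =>
        intro w hw
        rw [A.qcls_projZ (w := 0) (by rw [hw, map_zero]), map_zero, map_zero]
      | add x y _ _ hx hy =>
        intro w hw
        obtain ⟨u, rfl⟩ := A.qcls_surjective x
        obtain ⟨v, rfl⟩ := A.qcls_surjective y
        rw [← map_add] at hw
        rw [A.qcls_projZ hw, map_add, map_add, hx u rfl, hy v rfl, add_zero]
    have := key _ hx z rfl
    rwa [show A.projZ k z = z from Subtype.ext (A.proj_of_mem hz)] at this
  · rw [eq_top_iff]
    rintro x -
    obtain ⟨z, rfl⟩ := A.qcls_surjective x
    obtain ⟨s, hs⟩ := A.sum_proj z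
    have : z = ∑ k ∈ s, A.projZ k z := Subtype.ext (hs.trans (map_sum A.cocycles.val (fun k => A.projZ k z) s).symm)
    rw [this, map_sum]
    exact Submodule.sum_mem _ fun k _ => Submodule.mem_iSup_of_mem k ⟨_, A.proj_mem k _, rfl⟩

instance : GradedAlgebra A.cohGr :=
  { (inferInstance : SetLike.GradedMonoid A.cohGr), A.cohGr_isInternal.chooseDecomposition with }

/-- The cohomology algebra `(H(A), ·)`, graded by `H^k(A)`. -/
def H : GCA K where
  carrier := A.Coh
  gr := A.cohGr
  mul_comm' := by
    rintro i j _ _ ⟨z, hz, rfl⟩ ⟨w, hw, rfl⟩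
    change A.qcls z * A.qcls w = (-1 : K) ^ (i * j) • (A.qcls w * A.qcls z)
    rw [← map_mul, ← map_mul, ← map_smul]
    exact congrArg A.qcls (Subtype.ext (A.mul_comm' hz hw))

/-- The cohomology class of a cocycle. -/
def cls : A.cocycles →ₐ[K] A.H.carrier := A.qcls

theorem cls_surjective : Function.Surjective A.cls := A.qcls_surjective

theorem cls_eq_zero {z : A.cocycles} : A.cls z = 0 ↔ ∃ a, A.d a = z := A.qcls_eq_zero

theorem cls_eq {z w : A.cocycles} : A.cls z = A.cls w ↔ ∃ a, A.d a = z - w := A.qcls_eq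

theorem mem_H_gr {k : ℕ} {x : A.H.carrier} :
    x ∈ A.H.gr k ↔ ∃ z : A.cocycles, (z : A.carrier) ∈ A.gr k ∧ A.cls z = x := Iff.rfl

/-- The linear map on cohomology induced by a linear map on cocycles which kills coboundaries. -/
def liftH {V : Type u} [AddCommGroup V] [Module K V] (f : A.cocycles →ₗ[K] V)
    (hf : ∀ z : A.cocycles, (∃ a, A.d a = z) → f z = 0) : A.H.carrier →ₗ[K] V :=
  (A.coboundaries.restrictScalars K).liftQ f hf ∘ₗ
    (Submodule.Quotient.restrictScalarsEquiv K A.coboundaries).symm.toLinearMap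

theorem liftH_cls {V : Type u} [AddCommGroup V] [Module K V] (f : A.cocycles →ₗ[K] V)
    (hf : ∀ z : A.cocycles, (∃ a, A.d a = z) → f z = 0) (z : A.cocycles) :
    A.liftH f hf (A.cls z) = f z := rfl

/-- A morphism of DGCAs. -/
structure Hom (A B : DGCA K) where
  toAlgHom : A.carrier →ₐ[K] B.carrier
  map_gr : ∀ {k : ℕ} {a : A.carrier}, a ∈ A.gr k → toAlgHom a ∈ B.gr k
  map_d : ∀ a, toAlgHom (A.d a) = B.d (toAlgHom a)

/-- The map induced on cocycles. -/
def Hom.mapZ {A B : DGCA K} (f : Hom A B) : A.cocycles →ₐ[K] B.cocycles :=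
  (f.toAlgHom.comp A.cocycles.val).codRestrict B.cocycles (fun z => by
    have hz : A.d z = 0 := z.2
    change B.d (f.toAlgHom z) = 0
    rw [← f.map_d, hz, map_zero])

/-- The map induced on cohomology. -/
def Hom.mapH {A B : DGCA K} (f : Hom A B) : A.H.carrier →ₗ[K] B.H.carrier :=
  A.liftH (B.cls.toLinearMap ∘ₗ f.mapZ.toLinearMap) (by
    rintro z ⟨a, ha⟩
    refine B.cls_eq_zero.2 ⟨f.toAlgHom a, ?_⟩
    rw [← f.map_d, ha]; rfl)

/-- A morphism of DGCAs is a quasi-isomorphism if it induces an isomorphism on cohomology. -/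
def Hom.IsQuasiIso {A B : DGCA K} (f : Hom A B) : Prop := Function.Bijective f.mapH

/-- Two DGCAs are in the same homotopy class if they are connected by a finite zig-zag of
quasi-isomorphisms of DGCAs. -/
def SameHomotopyClass (A B : DGCA K) : Prop :=
  Relation.EqvGen (fun X Y : DGCA K => ∃ f : Hom X Y, f.IsQuasiIso) A B

/-- A DGCA is formal if it is in the homotopy class of its cohomology algebra, regarded as a DGCA
with zero differential. -/
def IsFormal : Prop := A.SameHomotopyClass A.H.toDGCA

/-- `A` is `(r-1)`-connected: `H^0(A) = K` and `H^k(A) = 0` for `1 ≤ k ≤ r - 1`. -/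
def IsConnected (r : ℕ) : Prop :=
  Module.finrank K (A.H.gr 0) = 1 ∧ ∀ k, 1 ≤ k → k ≤ r - 1 → A.H.gr k = ⊥

end DGCA


/-! ### Poincaré DGCAs and Hodge homotopies -/

/-- A Poincaré DGCA of degree `n`: a DGCA `⨁_{k=0}^n A^k` with finite dimensional cohomology and a
fundamental class `∫ ∈ (H^n(A))^∨` (regarded as a functional on `H(A)` vanishing on `H^k(A)` for
`k ≠ n`) such that the pairing `⟨x, y⟩ = ∫ x y` on `H(A)` is non-degenerate. -/
structure PoincareDGCA (K : Type u) [Field K] (n : ℕ) extends DGCA K where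
  bounded : ∀ k, n < k → gr k = ⊥
  finite_coh : Module.Finite K toDGCA.H.carrier
  integral : toDGCA.H.carrier →ₗ[K] K
  integral_of_ne : ∀ k, k ≠ n → ∀ x ∈ toDGCA.H.gr k, integral x = 0
  nondegenerate : ∀ x : toDGCA.H.carrier,
    (∀ y : toDGCA.H.carrier, integral (x * y) = 0) → x = 0

namespace PoincareDGCA

variable {K : Type u} [Field K] {n : ℕ} (A : PoincareDGCA K n)

/-- The projection `A → A^n = A^n ∩ ker d`. -/
def topZ : A.carrier →ₗ[K] A.cocycles :=
  LinearMap.codRestrict (Subalgebra.toSubmodule A.cocycles) (A.proj n) (fun a => by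
    have h := A.d_mem (A.proj_mem n a)
    rw [A.bounded (n + 1) (by omega)] at h
    exact h)

/-- The pairing on `A`: `⟨a, b⟩ = ∫ [a b]` if `|a| + |b| = n`, and zero otherwise. That is,
`⟨a, b⟩ = ∫ [(a b)_n]` with `(a b)_n` the component of degree `n`. -/
def pairing (a b : A.carrier) : K := A.integral (A.cls (A.topZ (a * b)))

/-- A Hodge homotopy `d⁻` of a Poincaré DGCA. -/
structure HodgeHomotopy where
  dm : A.carrier →ₗ[K] A.carrier
  dm_mem : ∀ {k : ℕ} {a : A.carrier}, a ∈ A.gr k → dm a ∈ pred A.gr k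
  dm_dm : ∀ a, dm (dm a) = 0
  dm_d_dm : ∀ a, dm (A.d (dm a)) = dm a
  d_dm_d : ∀ a, A.d (dm (A.d a)) = A.d a
  pairing_dm_dm : ∀ a b, A.pairing (dm a) (dm b) = 0
  pairing_harm_dm : ∀ a b, A.pairing (a - A.d (dm a) - dm (A.d a)) (dm b) = 0

namespace HodgeHomotopy

variable {A} (h : HodgeHomotopy A)

/-- The harmonic projection `π_ℋ = id - d d⁻ - d⁻ d`. -/
def harm : A.carrier →ₗ[K] A.carrier := LinearMap.id - A.d ∘ₗ h.dm - h.dm ∘ₗ A.d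

theorem harm_apply (a : A.carrier) : h.harm a = a - A.d (h.dm a) - h.dm (A.d a) := rfl

theorem d_harm (a : A.carrier) : A.d (h.harm a) = 0 := by
  simp [harm_apply, A.d_d, h.d_dm_d]

theorem harm_d (a : A.carrier) : h.harm (A.d a) = 0 := by
  simp [harm_apply, A.d_d, h.d_dm_d]

theorem harm_dm (a : A.carrier) : h.harm (h.dm a) = 0 := by
  simp [harm_apply, h.dm_dm, h.dm_d_dm]

theorem harm_mem {k : ℕ} {a : A.carrier} (ha : a ∈ A.gr k) : h.harm a ∈ A.gr k := by
  rw [harm_apply]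
  refine sub_mem (sub_mem ha ?_) (h.dm_mem (A.d_mem ha))
  rcases mem_of_pred A.gr (h.dm_mem ha) with h0 | ⟨j, rfl, h1⟩
  · simp [h0]
  · exact A.d_mem h1

/-- The linear map `A → H(A)`, `a ↦ [π_ℋ a]`. -/
def harmCls : A.carrier →ₗ[K] A.H.carrier :=
  A.cls.toLinearMap ∘ₗ
    LinearMap.codRestrict (Subalgebra.toSubmodule A.cocycles) h.harm h.d_harm

theorem harmCls_cocycle (z : A.cocycles) : h.harmCls z = A.cls z := by
  have hz : A.d z = 0 := z.2
  refine A.cls_eq.2 ⟨-h.dm z, ?_⟩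
  change _ = h.harm z - z
  simp [harm_apply, hz]

/-- The harmonic representative `ι : H(A) → ℋ ⊆ A`, the inverse of `ℋ → H(A)`; on the class of a
cocycle `z` it takes the value `π_ℋ z`. -/
def rep : A.H.carrier →ₗ[K] A.carrier :=
  A.liftH (h.harm ∘ₗ A.cocycles.val.toLinearMap) (by
    rintro z ⟨a, ha⟩
    change h.harm z = 0
    rw [← ha, harm_d])

theorem rep_cls (z : A.cocycles) : h.rep (A.cls z) = h.harm z := rfl

/-- `m̂₃(α,β,γ) = d⁻(αβ)γ - (-1)^{|α|} α d⁻(βγ)`. -/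
def m3hat : A.Coch3 :=
  LinearMap.mk₂ K
    (fun α β => LinearMap.mulLeft K (h.dm (α * β))
      - LinearMap.mulLeft K (sgn A.gr α) ∘ₗ h.dm ∘ₗ LinearMap.mulLeft K β)
    (by intros; ext; simp [add_mul]; abel)
    (by intros; ext; simp [smul_sub])
    (by intros; ext; simp [add_mul, mul_add]; abel)
    (by intros; ext; simp [smul_sub])

theorem m3hat_apply (α β γ : A.carrier) :
    h.m3hat α β γ = h.dm (α * β) * γ - sgn A.gr α * h.dm (β * γ) := rfl

/-- The ternary operation `μ₃` on `H(A)`: the operation `m₃ = π_ℋ ∘ m̂₃` on `ℋ` transported along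
`ℋ ≃ H(A)`, so `μ₃(a,b,c) = [π_ℋ (d⁻(αβ)γ - (-1)^{|α|} α d⁻(βγ))]` with `α`, `β`, `γ` the harmonic
representatives of `a`, `b`, `c`. -/
def mu3 : A.H.Coch3 :=
  LinearMap.mk₂ K
    (fun a b => h.harmCls ∘ₗ h.m3hat (h.rep a) (h.rep b) ∘ₗ h.rep)
    (by intros; ext; simp)
    (by intros; ext; simp)
    (by intros; ext; simp)
    (by intros; ext; simp)

theorem mu3_apply (a b c : A.H.carrier) :
    h.mu3 a b c = h.harmCls (h.m3hat (h.rep a) (h.rep b) (h.rep c)) := rfl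

theorem harmCls_d (a : A.carrier) : h.harmCls (A.d a) = 0 :=
  A.cls_eq_zero.2 ⟨0, by rw [map_zero]; exact (h.harm_d a).symm⟩

theorem harmCls_dm (a : A.carrier) : h.harmCls (h.dm a) = 0 :=
  A.cls_eq_zero.2 ⟨0, by rw [map_zero]; exact (h.harm_dm a).symm⟩

theorem d_rep (a : A.H.carrier) : A.d (h.rep a) = 0 := by
  obtain ⟨z, rfl⟩ := A.cls_surjective a
  rw [rep_cls, d_harm]

theorem harmCls_rep (a : A.H.carrier) : h.harmCls (h.rep a) = a := by
  obtain ⟨z, rfl⟩ := A.cls_surjective a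
  have hz : A.d z = 0 := z.2
  rw [rep_cls, ← h.harmCls_cocycle z, harm_apply, hz]
  simp [harmCls_d]

theorem rep_harmCls (x : A.carrier) : h.rep (h.harmCls x) = h.harm x := by
  change h.harm (h.harm x) = h.harm x
  rw [harm_apply h (h.harm x), d_harm, map_zero, sub_zero]
  simp [harm_apply, h.dm_dm, h.dm_d_dm]

theorem harmCls_mul_cocycle {x y : A.carrier} (hx : A.d x = 0) (hy : A.d y = 0) :
    h.harmCls (x * y) = h.harmCls x * h.harmCls y := by
  have e1 := h.harmCls_cocycle ⟨x, hx⟩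
  have e2 := h.harmCls_cocycle ⟨y, hy⟩
  have e3 := h.harmCls_cocycle (⟨x, hx⟩ * ⟨y, hy⟩)
  rw [map_mul] at e3
  exact e3.trans (congrArg₂ _ e1.symm e2.symm)

theorem harmCls_harm (x : A.carrier) : h.harmCls (h.harm x) = h.harmCls x := by
  rw [harm_apply]; simp [harmCls_d, harmCls_dm]

theorem rep_mul (a b : A.H.carrier) : h.rep (a * b) = h.harm (h.rep a * h.rep b) := by
  rw [← rep_harmCls, harmCls_mul_cocycle h (h.d_rep a) (h.d_rep b), harmCls_rep, harmCls_rep]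

theorem mul_harmCls (a : A.H.carrier) (x : A.carrier) :
    a * h.harmCls x = h.harmCls (h.rep a * x) - h.harmCls (h.rep a * h.dm (A.d x)) := by
  have e : h.rep a * A.d (h.dm x) = A.d (sgn A.gr (h.rep a) * h.dm x) := by
    rw [A.leibniz_sgn, A.d_sgn, d_rep, sgn_sgn]; simp
  conv_lhs => rw [← h.harmCls_rep a, ← h.harmCls_harm x,
    ← harmCls_mul_cocycle h (h.d_rep a) (h.d_harm x), harm_apply, mul_sub, mul_sub, e]
  simp [harmCls_d]

theorem harmCls_mul (a : A.H.carrier) (x : A.carrier) :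
    h.harmCls x * a = h.harmCls (x * h.rep a) - h.harmCls (h.dm (A.d x) * h.rep a) := by
  have e : A.d (h.dm x) * h.rep a = A.d (h.dm x * h.rep a) := by
    rw [A.leibniz_sgn, d_rep]; simp
  conv_lhs => rw [← h.harmCls_rep a, ← h.harmCls_harm x,
    ← harmCls_mul_cocycle h (h.d_harm x) (h.d_rep a), harm_apply, sub_mul, sub_mul, e]
  simp [harmCls_d]

theorem sgn_dm (x : A.carrier) : sgn A.gr (h.dm x) = -h.dm (sgn A.gr x) := by
  induction x using hom_induction A.gr with
  | h0 => simp
  | h2 x y hx hy => simp [hx, hy]; abel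
  | h1 i a ha => rw [sgn_of_pred _ (h.dm_mem ha), sgn_of_mem _ ha, map_smul]

theorem sgn_harm (x : A.carrier) : sgn A.gr (h.harm x) = h.harm (sgn A.gr x) := by
  induction x using hom_induction A.gr with
  | h0 => simp
  | h2 x y hx hy => simp [hx, hy]
  | h1 i a ha => rw [sgn_of_mem _ (h.harm_mem ha), sgn_of_mem _ ha, map_smul]

theorem rep_mem {k : ℕ} {a : A.H.carrier} (ha : a ∈ A.H.gr k) : h.rep a ∈ A.gr k := by
  obtain ⟨z, hz, rfl⟩ := ha
  exact h.harm_mem hz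

theorem harmCls_mem {k : ℕ} {x : A.carrier} (hx : x ∈ A.gr k) : h.harmCls x ∈ A.H.gr k :=
  ⟨⟨h.harm x, h.d_harm x⟩, h.harm_mem hx, rfl⟩

theorem harmCls_pred {k : ℕ} {x : A.carrier} (hx : x ∈ pred A.gr k) :
    h.harmCls x ∈ pred A.H.gr k := by
  rcases mem_of_pred A.gr hx with rfl | ⟨j, rfl, h1⟩
  · simp
  · exact h.harmCls_mem h1

theorem rep_sgn (a : A.H.carrier) : h.rep (sgn A.H.gr a) = sgn A.gr (h.rep a) := by
  induction a using hom_induction A.H.gr with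
  | h0 => simp
  | h2 x y hx hy => simp [hx, hy]
  | h1 i a ha => rw [sgn_of_mem _ ha, sgn_of_mem _ (h.rep_mem ha), map_smul]

theorem d_m3hat {α β γ : A.carrier} (hα : A.d α = 0) (hβ : A.d β = 0) (hγ : A.d γ = 0) :
    A.d (h.m3hat α β γ) = α * h.harm (β * γ) - h.harm (α * β) * γ := by
  simp [m3hat_apply, harm_apply, A.leibniz_sgn, A.d_sgn, hα, hβ, hγ, sgn_sgn, mul_sub, sub_mul,
    mul_assoc]

theorem d3_mu3 : A.H.d3 h.mu3 = 0 := by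
  funext a b c e
  change sgn A.H.gr a * h.mu3 b c e - h.mu3 (a * b) c e + h.mu3 a (b * c) e - h.mu3 a b (c * e)
    + h.mu3 a b c * e = 0
  simp only [mu3_apply, mul_harmCls, harmCls_mul, rep_mul, rep_sgn, d_m3hat h (h.d_rep _)
    (h.d_rep _) (h.d_rep _)]
  generalize ha : h.rep a = α
  generalize hb : h.rep b = β
  generalize hc : h.rep c = γ
  generalize he : h.rep e = η
  have dα : A.d α = 0 := ha ▸ h.d_rep a
  have dβ : A.d β = 0 := hb ▸ h.d_rep b
  have dγ : A.d γ = 0 := hc ▸ h.d_rep c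
  have dη : A.d η = 0 := he ▸ h.d_rep e
  have key : h.harmCls (h.dm (α * β) * A.d (h.dm (γ * η)))
      - h.harmCls (A.d (h.dm (sgn A.gr α * sgn A.gr β)) * h.dm (γ * η)) = 0 := by
    have := h.harmCls_d (sgn A.gr (h.dm (α * β)) * h.dm (γ * η))
    rw [A.leibniz_sgn, sgn_sgn, sgn_dm, sgn_mul, map_add, map_neg, neg_mul, map_neg] at this
    rw [← this]; abel
  have h1 : h.harm (γ * η) = γ * η - A.d (h.dm (γ * η)) := by
    simp [harm_apply, A.leibniz_sgn, dγ, dη]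
  have h2 : h.harm (sgn A.gr α * sgn A.gr β) = sgn A.gr α * sgn A.gr β
      - A.d (h.dm (sgn A.gr α * sgn A.gr β)) := by
    simp [harm_apply, A.leibniz_sgn, A.d_sgn, dα, dβ]
  rw [← key]
  simp only [m3hat_apply, sgn_harm, sgn_mul, map_sub, mul_sub, sub_mul, mul_assoc]
  simp only [h2]
  have h3 : h.dm (α * β) * h.harm (γ * η) = h.dm (α * β) * (γ * η)
      - h.dm (α * β) * A.d (h.dm (γ * η)) := by rw [h1, mul_sub]
  rw [h3]
  simp only [map_sub, sub_mul, mul_assoc]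
  abel

theorem mu3_mem : h.mu3 ∈ A.H.ZHarr3 := by
  refine ⟨⟨fun i j k a ha b hb c hc => ?_, fun i j k a ha b hb c hc => ?_⟩, h.d3_mu3⟩
  · have ha := h.rep_mem ha
    have hb := h.rep_mem hb
    have hc := h.rep_mem hc
    refine h.harmCls_pred (x := h.m3hat (h.rep a) (h.rep b) (h.rep c)) ?_
    rw [m3hat_apply]
    refine sub_mem (mem_pred_mul A.gr (h.dm_mem (SetLike.mul_mem_graded ha hb)) hc) ?_
    rw [sgn_of_mem A.gr ha, smul_mul_assoc, add_assoc]
    exact Submodule.smul_mem _ _ (mul_mem_pred A.gr ha (h.dm_mem (SetLike.mul_mem_graded hb hc)))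
  · have ha := h.rep_mem ha
    have hb := h.rep_mem hb
    have hc := h.rep_mem hc
    simp only [mu3_apply]
    generalize h.rep a = α at *
    generalize h.rep b = β at *
    generalize h.rep c = γ at *
    suffices e : h.m3hat α β γ - (-1 : K) ^ (i * j) • h.m3hat β α γ
        + (-1 : K) ^ (i * (j + k)) • h.m3hat β γ α = 0 by
      simpa only [map_add, map_sub, map_smul, map_zero] using congrArg h.harmCls e
    simp only [m3hat_apply]
    rw [sgn_of_mem A.gr ha, sgn_of_mem A.gr hb, A.mul_comm' ha hb, A.mul_comm' ha hc,
      GCA.comm_pred ha (h.dm_mem (SetLike.mul_mem_graded hb hc))]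
    simp only [map_smul, smul_mul_assoc, mul_smul_comm]
    rcases GCA.neg_one_pow_cases (K := K) i with ⟨hi, hi'⟩ | ⟨hi, hi'⟩ <;>
    rcases GCA.neg_one_pow_cases (K := K) j with ⟨hj, hj'⟩ | ⟨hj, hj'⟩ <;>
    rcases GCA.neg_one_pow_cases (K := K) k with ⟨hk, hk'⟩ | ⟨hk, hk'⟩ <;>
    simp [hi, hj, hk, pow_add, pow_mul, mul_add] <;> abel

/-- The Harrison cohomology class `[μ₃] ∈ HHarr^{3,-1}(H(A), H(A))` defined by a Hodge homotopy. -/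
def harrisonClass : A.H.HHarr3 := Submodule.Quotient.mk ⟨h.mu3, h.mu3_mem⟩

end HodgeHomotopy
end PoincareDGCA
end HarrisonDGCA
end

/-!
# The secondary class of highly connected Poincaré DGCAs

Write `p a = [π a]` for the projection `A → H(A)` given by a Hodge homotopy, where
`π = id - d d⁻ - d⁻ d`.

**The class is an invariant of the homotopy type.** On an arbitrary DGCA, choose representatives of
all classes and graded symmetric primitives of the defect of multiplicativity of this choice
(`DGCA.MasseyDatum`). They define a ternary Massey operation on cohomology, and two choices give
operations which differ by a Harrison coboundary (`DGCA.MasseyDatum.massey_sub`). Massey data can be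
pushed forward along quasi-isomorphisms (`DGCA.Hom.mapDatum_massey`), so a zig-zag of
quasi-isomorphisms induces an isomorphism of the cohomology algebras which preserves the class
(`DGCA.SameHomotopyClass.sameSecondaryClass`). A Hodge homotopy is a particular Massey datum with
operation `μ₃`, and the algebra `(H(A), 0)` has a Massey datum with operation zero. This gives the
independence of choices and the necessity of the two criteria.

**The class determines the homotopy type.** Let `φ : H(A) ≃ H(A')` and `d κ = μ₃' - φ μ₃`. By
Poincaré duality and the bound `n ≤ 4r - 1`, the cohomology vanishes in all degrees `≥ 3r` except
possibly `n`, and there the orthogonality relations of a Hodge homotopy apply. Consequently `μ₃`,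
on classes of degree `≥ r`, is concentrated in degree `r` and vanishes unless `n = 4r - 1`
(`PoincareDGCA.HodgeHomotopy.mu3_eq_zero`). On the small model of `A` consisting of reduced elements
(`PoincareDGCA.HodgeHomotopy.IsReduced`), `p` extends to a `C∞`-morphism from `A` to
`(H(A), 0, ·, μ₃)` whose only higher component is an explicit bilinear map `quad`: it measures the
failure of `p` to be multiplicative (`harmCls_mul_sub_of_isReduced`), and its Hochschild coboundary
is `-μ₃` (`quad_cocycle`). For the same reasons of degree, `κ` may be assumed to live in the degrees
`r` and `2r` only (`exists_cochain`).

This allows one to write down a homotopy pullback of `A` and `A'` over `H(A')` as a strict DGCA, the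
algebra of paths (`PoincareDGCA.Gluing.path`). Its elements are triples `(x, x', ν)` of reduced
elements `x` of `A` and `x'` of `A'` and a class `ν` of `H(A')` in degree one less, with differential
`(d x, d x', p' x' - φ p x)` and product
`(x y, x' y', κ(x̄, ȳ) + quad'(x', y') - φ quad(x, y) + ν ȳ ± x̄ ω)`, where
`x̄ = (φ p x + p' x') / 2`. The Leibniz rule is the first property of `quad`, and associativity is the
second one combined with `d κ = μ₃' - φ μ₃` (`PoincareDGCA.Gluing.corr_assoc`). Both projections
`A ← path → A'` are quasi-isomorphisms. Applied to `A' = (H(A), 0)` with `d⁻ = 0`, this also shows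
that `A` is formal if its class vanishes.
-/

noncomputable section

namespace HarrisonDGCA

/-! ### Graded linear algebra -/

section GradeMap

variable {K V W : Type u} [Field K] [AddCommGroup V] [Module K V] [AddCommGroup W] [Module K W]

/-- The linear map which is given by `f k` on the component of degree `k`. -/
def gradeMap (g : ℕ → Submodule K V) [DirectSum.Decomposition g] (f : ℕ → V →ₗ[K] W) :
    V →ₗ[K] W :=
  (DirectSum.toModule K ℕ W (fun k => f k ∘ₗ (g k).subtype)) ∘ₗ
    (DirectSum.decomposeLinearEquiv g).toLinearMap

theorem gradeMap_of_mem (g : ℕ → Submodule K V) [DirectSum.Decomposition g]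
    (f : ℕ → V →ₗ[K] W) {k : ℕ} {x : V} (hx : x ∈ g k) : gradeMap g f x = f k x := by
  lift x to g k using hx
  simp [gradeMap]

end GradeMap

theorem pred_of_pos {K V : Type u} [Field K] [AddCommGroup V] [Module K V]
    (gr : ℕ → Submodule K V) {k : ℕ} (hk : 0 < k) : pred gr k = gr (k - 1) := by
  cases k with
  | zero => omega
  | succ k => rfl

namespace GCA

variable {K : Type u} [Field K] (B : GCA K)

/-- The projection to the component of degree `k - 1`. -/
def predProj : ℕ → B.carrier →ₗ[K] B.carrier
  | 0 => 0
  | k + 1 => GradedAlgebra.proj B.gr k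

theorem predProj_mem (k : ℕ) (a : B.carrier) : B.predProj k a ∈ pred B.gr k := by
  cases k with
  | zero => simp [predProj]
  | succ k => exact (DirectSum.decompose B.gr a k).2

theorem predProj_of_mem {k : ℕ} {x : B.carrier} (hx : x ∈ pred B.gr k) : B.predProj k x = x := by
  rcases mem_of_pred _ hx with rfl | ⟨j, rfl, h⟩
  · exact map_zero _
  · exact DirectSum.decompose_of_mem_same _ h

theorem predProj_of_mem_ne {j k : ℕ} {x : B.carrier} (hx : x ∈ pred B.gr j) (hjk : j ≠ k) :
    B.predProj k x = 0 := by
  rcases mem_of_pred _ hx with rfl | ⟨j, rfl, h⟩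
  · exact map_zero _
  · cases k with
    | zero => rfl
    | succ k => exact DirectSum.decompose_of_mem_ne _ h (by omega)

end GCA

namespace DGCA

variable {K : Type u} [Field K] (A : DGCA K)

/-- Over a field the differential admits a graded generalized inverse. -/
theorem exists_primitive : ∃ σ : A.carrier →ₗ[K] A.carrier,
    (∀ k, ∀ x ∈ A.gr k, σ x ∈ pred A.gr k) ∧ ∀ x, A.d (σ (A.d x)) = A.d x := by
  obtain ⟨g, hg⟩ := A.d.rangeRestrict.exists_rightInverse_of_surjective
    (LinearMap.range_rangeRestrict _)
  obtain ⟨τ, hτ⟩ := g.exists_extend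
  have hdτ : ∀ x, A.d (τ (A.d x)) = A.d x := fun x => by
    have h1 : τ (A.d x) = g ⟨A.d x, x, rfl⟩ := by rw [← hτ]; rfl
    have h2 := congrArg Subtype.val (LinearMap.congr_fun hg ⟨A.d x, x, rfl⟩)
    rw [h1]; exact h2
  refine ⟨gradeMap A.gr (fun k => A.predProj k ∘ₗ τ), fun k x hx => ?_, fun x => ?_⟩
  · rw [gradeMap_of_mem _ _ hx]; exact A.predProj_mem k _
  · induction x using hom_induction A.gr with
    | h0 => simp
    | h2 x y hx hy => simp only [map_add, hx, hy]
    | h1 k x hx =>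
      rw [gradeMap_of_mem _ _ (A.d_mem hx)]
      change A.d (A.proj k (τ (A.d x))) = _
      rw [d_proj, hdτ, proj_of_mem _ (A.d_mem hx)]

theorem cls_mem {k : ℕ} {z : A.cocycles} (hz : (z : A.carrier) ∈ A.gr k) :
    A.cls z ∈ A.H.gr k := ⟨z, hz, rfl⟩

theorem cls_mem_pred {k : ℕ} {z : A.cocycles} (hz : (z : A.carrier) ∈ pred A.gr k) :
    A.cls z ∈ pred A.H.gr k := by
  cases k with
  | zero =>
    have : z = 0 := Subtype.ext (by simpa [pred] using hz)
    rw [this, map_zero]; exact zero_mem _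
  | succ k => exact A.cls_mem hz

theorem exists_section : ∃ ι : A.H.carrier →ₗ[K] A.carrier,
    (∀ k, ∀ x ∈ A.H.gr k, ι x ∈ A.gr k) ∧
      ∃ h : ∀ x, A.d (ι x) = 0, ∀ x, A.cls ⟨ι x, h x⟩ = x := by
  obtain ⟨g, hg⟩ := A.cls.toLinearMap.exists_rightInverse_of_surjective
    (LinearMap.range_eq_top.2 A.cls_surjective)
  have hg' : ∀ x, A.cls (g x) = x := fun x => LinearMap.congr_fun hg x
  let ι : A.H.carrier →ₗ[K] A.cocycles := gradeMap A.H.gr (fun k => A.projZ k ∘ₗ g)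
  have hι : ∀ k, ∀ x ∈ A.H.gr k, ι x = A.projZ k (g x) := fun k x hx => gradeMap_of_mem _ _ hx
  refine ⟨A.cocycles.val.toLinearMap ∘ₗ ι, fun k x hx => ?_, fun x => (ι x).2, fun x => ?_⟩
  · change ((ι x : A.cocycles) : A.carrier) ∈ _
    rw [hι k x hx]
    exact A.proj_mem k _
  · change A.cls (ι x) = x
    induction x using hom_induction A.H.gr with
    | h0 => simp
    | h2 x y hx hy => rw [map_add, map_add, hx, hy]
    | h1 k x hx =>
      rw [hι k x hx]
      obtain ⟨z, hz, rfl⟩ := hx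
      have h1 : A.projZ k z = z := Subtype.ext (A.proj_of_mem hz)
      exact (A.qcls_projZ (hg' (A.cls z))).trans (congrArg A.cls h1)

/-! ### Massey data and the secondary class of a DGCA -/

/-- A *Massey datum* on a DGCA `A`: a graded linear section `rep` of the projection from cocycles to
cohomology, and a graded symmetric bilinear map `pri` of degree `-1` whose values are primitives of
the defect `rep a * rep b - rep (a * b)` of multiplicativity of `rep`. -/
structure MasseyDatum where
  rep : A.H.carrier →ₗ[K] A.carrier
  rep_mem : ∀ {k : ℕ} {a : A.H.carrier}, a ∈ A.H.gr k → rep a ∈ A.gr k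
  d_rep : ∀ a, A.d (rep a) = 0
  cls_rep : ∀ a, A.cls ⟨rep a, d_rep a⟩ = a
  pri : A.H.carrier →ₗ[K] A.H.carrier →ₗ[K] A.carrier
  pri_mem : ∀ {i j : ℕ} {a b : A.H.carrier}, a ∈ A.H.gr i → b ∈ A.H.gr j →
    pri a b ∈ pred A.gr (i + j)
  pri_comm : ∀ {i j : ℕ} {a b : A.H.carrier}, a ∈ A.H.gr i → b ∈ A.H.gr j →
    pri a b = (-1 : K) ^ (i * j) • pri b a
  d_pri : ∀ a b, A.d (pri a b) = rep a * rep b - rep (a * b)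

namespace MasseyDatum

variable {A} (s : A.MasseyDatum)

theorem rep_sgn (a : A.H.carrier) : s.rep (sgn A.H.gr a) = sgn A.gr (s.rep a) := by
  induction a using hom_induction A.H.gr with
  | h0 => simp
  | h2 x y hx hy => simp only [map_add, hx, hy]
  | h1 i a ha => rw [sgn_of_mem _ ha, sgn_of_mem _ (s.rep_mem ha), map_smul]

/-- The cocycle in `A` which represents the Massey operation of three classes. -/
def cocycle (a b c : A.H.carrier) : A.carrier :=
  s.pri a b * s.rep c + s.pri (a * b) c - s.pri a (b * c) - sgn A.gr (s.rep a) * s.pri b c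

theorem d_cocycle (a b c : A.H.carrier) : A.d (s.cocycle a b c) = 0 := by
  simp only [cocycle, map_sub, map_add, A.leibniz_sgn, A.d_sgn, s.d_rep, s.d_pri, sgn_sgn,
    map_zero, neg_zero, zero_mul, mul_zero, add_zero, zero_add, sub_mul, mul_sub, mul_assoc]
  abel

/-- The ternary Massey operation on cohomology defined by a Massey datum. -/
def massey (a b c : A.H.carrier) : A.H.carrier := A.cls ⟨s.cocycle a b c, s.d_cocycle a b c⟩

end MasseyDatum

theorem exists_masseyDatum : Nonempty A.MasseyDatum := by
  obtain ⟨ι, h1, h2, h3⟩ := A.exists_section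
  obtain ⟨σ, h4, h5⟩ := A.exists_primitive
  let F : A.H.carrier →ₗ[K] A.H.carrier →ₗ[K] A.carrier :=
    LinearMap.mk₂ K (fun a b => σ (ι a * ι b - ι (a * b)))
      (by intros; simp only [map_add, map_sub, add_mul]; abel)
      (by intros; simp only [map_smul, map_sub, smul_mul_assoc, smul_sub])
      (by intros; simp only [map_add, map_sub, mul_add]; abel)
      (by intros; simp only [map_smul, map_sub, mul_smul_comm, smul_sub])
  have hF : ∀ a b, F a b = σ (ι a * ι b - ι (a * b)) := fun _ _ => rfl
  refine ⟨⟨ι, @fun k a ha => h1 k a ha, h2, h3, F, @fun i j a b ha hb => ?_,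
    @fun i j a b ha hb => ?_, fun a b => ?_⟩⟩
  · exact h4 _ _ (sub_mem (SetLike.mul_mem_graded (h1 _ _ ha) (h1 _ _ hb))
      (h1 _ _ (SetLike.mul_mem_graded ha hb)))
  · rw [hF, hF, A.mul_comm' (h1 _ _ ha) (h1 _ _ hb), A.H.mul_comm' ha hb, map_smul, ← smul_sub,
      map_smul]
  · have e : A.cls ((⟨ι a, h2 a⟩ : A.cocycles) * ⟨ι b, h2 b⟩) = A.cls ⟨ι (a * b), h2 _⟩ := by
      rw [map_mul, h3, h3, h3]
    obtain ⟨y, hy⟩ := A.cls_eq.1 e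
    have hy' : A.d y = ι a * ι b - ι (a * b) := hy
    rw [hF, ← hy', h5]

end DGCA

namespace DGCA
namespace MasseyDatum

variable {K : Type u} [Field K] {A : DGCA K}

/-- The Massey datum obtained by moving the representatives by the coboundaries `d (η a)`. The
correction of the primitives is symmetrized, which needs `2` to be invertible. -/
def changeRep [CharZero K] (s : A.MasseyDatum) (η : A.H.carrier →ₗ[K] A.carrier)
    (hη : ∀ k, ∀ a ∈ A.H.gr k, η a ∈ pred A.gr k) : A.MasseyDatum where
  rep := s.rep + A.d ∘ₗ η
  rep_mem {k a} ha := by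
    refine add_mem (s.rep_mem ha) ?_
    change A.d (η a) ∈ _
    rcases mem_of_pred A.gr (hη k a ha) with h | ⟨j, rfl, h⟩
    · simp [h]
    · exact A.d_mem h
  d_rep a := by simp [s.d_rep, A.d_d]
  cls_rep a := by
    refine Eq.trans ?_ (s.cls_rep a)
    exact A.cls_eq.2 ⟨η a, by simp⟩
  pri := LinearMap.mk₂ K
    (fun a b => s.pri a b + η a * s.rep b + sgn A.gr (s.rep a) * η b
      + (2 : K)⁻¹ • (η a * A.d (η b) + sgn A.gr (A.d (η a)) * η b) - η (a * b))
    (by intros; simp only [map_add, add_mul, LinearMap.add_apply, smul_add]; abel)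
    (by
      intros
      simp only [map_smul, smul_mul_assoc, LinearMap.smul_apply, smul_add, smul_sub]
      congr 3 <;> rw [smul_comm])
    (by intros; simp only [map_add, mul_add, smul_add]; abel)
    (by
      intros
      simp only [map_smul, mul_smul_comm, smul_add, smul_sub]
      congr 3 <;> rw [smul_comm])
  pri_mem {i j a b} ha hb := by
    have hdη : ∀ k, ∀ a ∈ A.H.gr k, A.d (η a) ∈ A.gr k := fun k a ha => by
      rcases mem_of_pred A.gr (hη k a ha) with h | ⟨j, rfl, h⟩
      · simp [h]
      · exact A.d_mem h
    simp only [LinearMap.mk₂_apply]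
    refine sub_mem (add_mem (add_mem (add_mem (s.pri_mem ha hb) ?_) ?_)
      (Submodule.smul_mem _ _ (add_mem ?_ ?_))) (hη _ _ (SetLike.mul_mem_graded ha hb))
    · exact mem_pred_mul A.gr (hη _ _ ha) (s.rep_mem hb)
    · rw [sgn_of_mem _ (s.rep_mem ha), smul_mul_assoc]
      exact Submodule.smul_mem _ _ (mul_mem_pred A.gr (s.rep_mem ha) (hη _ _ hb))
    · exact mem_pred_mul A.gr (hη _ _ ha) (hdη _ _ hb)
    · rw [sgn_of_mem _ (hdη _ _ ha), smul_mul_assoc]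
      exact Submodule.smul_mem _ _ (mul_mem_pred A.gr (hdη _ _ ha) (hη _ _ hb))
  pri_comm {i j a b} ha hb := by
    have hdη : ∀ k, ∀ a ∈ A.H.gr k, A.d (η a) ∈ A.gr k := fun k a ha => by
      rcases mem_of_pred A.gr (hη k a ha) with h | ⟨j, rfl, h⟩
      · simp [h]
      · exact A.d_mem h
    simp only [LinearMap.mk₂_apply]
    rw [s.pri_comm ha hb, A.H.mul_comm' ha hb, sgn_of_mem _ (s.rep_mem ha),
      sgn_of_mem _ (s.rep_mem hb), sgn_of_mem _ (hdη _ _ ha), sgn_of_mem _ (hdη _ _ hb),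
      GCA.comm_pred (s.rep_mem hb) (hη _ _ ha), GCA.comm_pred (s.rep_mem ha) (hη _ _ hb),
      GCA.comm_pred (hdη _ _ hb) (hη _ _ ha), GCA.comm_pred (hdη _ _ ha) (hη _ _ hb)]
    simp only [map_smul, smul_mul_assoc, smul_add, smul_sub, smul_smul]
    rcases GCA.neg_one_pow_cases (K := K) i with ⟨hi, hi'⟩ | ⟨hi, hi'⟩ <;>
    rcases GCA.neg_one_pow_cases (K := K) j with ⟨hj, hj'⟩ | ⟨hj, hj'⟩ <;>
    simp [hi, hj, pow_add, pow_mul] <;> abel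
  d_pri a b := by
    have h2 : (2 : K)⁻¹ • (A.d (η a) * A.d (η b) + A.d (η a) * A.d (η b))
        = A.d (η a) * A.d (η b) := by
      rw [← two_smul K, smul_smul, inv_mul_cancel₀ two_ne_zero, one_smul]
    simp only [LinearMap.mk₂_apply, map_sub, map_add, map_smul, A.leibniz_sgn, A.d_sgn, s.d_rep,
      s.d_pri, sgn_sgn, map_zero, neg_zero, zero_mul, mul_zero, add_zero, zero_add, A.d_d,
      LinearMap.add_apply, LinearMap.comp_apply, add_mul, mul_add, h2]
    abel

/-- The Massey operation does not change at all: the two cocycles differ by an explicit coboundary. -/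
theorem changeRep_massey [CharZero K] (s : A.MasseyDatum) (η : A.H.carrier →ₗ[K] A.carrier)
    (hη : ∀ k, ∀ a ∈ A.H.gr k, η a ∈ pred A.gr k) (a b c : A.H.carrier) :
    (s.changeRep η hη).massey a b c = s.massey a b c := by
  refine A.cls_eq.2 ⟨sgn A.gr (s.pri a b) * η c + sgn A.gr (η a) * s.pri b c
    + sgn A.gr (η a * s.rep b) * η c
    + (2 : K)⁻¹ • (-(sgn A.gr (η (a * b)) * η c) - sgn A.gr (η a) * η (b * c)
      + sgn A.gr (η a) * η b * s.rep c + s.rep a * (sgn A.gr (η b) * η c)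
      + sgn A.gr (η a * A.d (η b)) * η c), ?_⟩
  change _ = (s.changeRep η hη).cocycle a b c - s.cocycle a b c
  simp only [cocycle, changeRep, LinearMap.mk₂_apply, map_sub, map_add, map_neg, map_smul,
    A.leibniz_sgn, A.d_sgn, s.d_rep, s.d_pri, sgn_sgn, sgn_mul, map_zero, neg_zero, zero_mul,
    mul_zero, add_zero, zero_add, A.d_d, LinearMap.add_apply, LinearMap.comp_apply, add_mul,
    mul_add, sub_mul, mul_sub, mul_assoc, neg_mul, mul_neg, smul_mul_assoc,
    mul_smul_comm, smul_add, smul_sub, smul_neg]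
  module
end MasseyDatum
end DGCA

namespace DGCA
namespace MasseyDatum

variable {K : Type u} [Field K] {A : DGCA K}

/-- If two Massey data have the same representatives, their primitives differ by cocycles, whose
classes form a Harrison cochain. -/
theorem massey_sub_of_rep_eq (s t : A.MasseyDatum) (hst : ∀ a, s.rep a = t.rep a) :
    ∃ κ ∈ A.H.CHarr2, ∀ a b c, t.massey a b c - s.massey a b c = A.H.d2 κ a b c := by
  have hd : ∀ a b, A.d (s.pri a b - t.pri a b) = 0 := fun a b => by
    rw [map_sub, s.d_pri, t.d_pri, hst, hst, hst, sub_self]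
  let z : A.H.carrier → A.H.carrier → A.cocycles := fun a b => ⟨s.pri a b - t.pri a b, hd a b⟩
  have hz : ∀ a b, (z a b : A.carrier) = s.pri a b - t.pri a b := fun _ _ => rfl
  let κ : A.H.Coch2 := LinearMap.mk₂ K (fun a b => A.cls (z a b))
    (fun a a' b => by
      rw [← map_add]
      exact congrArg _ (Subtype.ext (by
        simp only [hz, map_add, LinearMap.add_apply, Subalgebra.coe_add]; abel)))
    (fun t a b => by
      rw [← map_smul]
      exact congrArg _ (Subtype.ext (by
        simp only [hz, map_smul, LinearMap.smul_apply, Subalgebra.coe_smul, smul_sub])))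
    (fun a b b' => by
      rw [← map_add]
      exact congrArg _ (Subtype.ext (by
        simp only [hz, map_add, Subalgebra.coe_add]; abel)))
    (fun t a b => by
      rw [← map_smul]
      exact congrArg _ (Subtype.ext (by
        simp only [hz, map_smul, Subalgebra.coe_smul, smul_sub])))
  have hκ : ∀ a b, κ a b = A.cls (z a b) := fun _ _ => rfl
  refine ⟨κ, ⟨fun i j a ha b hb => ?_, fun i j a ha b hb => ?_⟩, fun a b c => ?_⟩
  · exact A.cls_mem_pred (sub_mem (s.pri_mem ha hb) (t.pri_mem ha hb))
  · rw [hκ, hκ, ← map_smul, ← map_sub, ← map_zero A.cls]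
    refine congrArg _ (Subtype.ext ?_)
    simp only [hz, Subalgebra.coe_sub, Subalgebra.coe_smul, s.pri_comm ha hb, t.pri_comm ha hb,
      ← smul_sub, sub_self, Subalgebra.coe_zero]
  · have e1 : sgn A.H.gr a * κ b c
        = A.cls ((⟨s.rep (sgn A.H.gr a), s.d_rep _⟩ : A.cocycles) * z b c) := by
      rw [map_mul, s.cls_rep]; rfl
    have e2 : κ a b * c = A.cls (z a b * (⟨s.rep c, s.d_rep _⟩ : A.cocycles)) := by
      rw [map_mul, s.cls_rep]; rfl
    rw [GCA.d2_apply, e1, e2, hκ, hκ]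
    simp only [massey, ← map_sub, ← map_add]
    refine congrArg _ (Subtype.ext ?_)
    simp only [Subalgebra.coe_sub, Subalgebra.coe_add, Subalgebra.coe_mul, hz, cocycle, ← hst,
      s.rep_sgn, mul_sub, sub_mul]
    abel

/-- The Massey operations of two Massey data on the same DGCA differ by a Harrison coboundary. -/
theorem massey_sub [CharZero K] (s t : A.MasseyDatum) :
    ∃ κ ∈ A.H.CHarr2, ∀ a b c, t.massey a b c - s.massey a b c = A.H.d2 κ a b c := by
  obtain ⟨σ, h4, h5⟩ := A.exists_primitive
  have hη : ∀ k, ∀ a ∈ A.H.gr k, (σ ∘ₗ (t.rep - s.rep)) a ∈ pred A.gr k :=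
    fun _ a ha => h4 _ _ (sub_mem (t.rep_mem ha) (s.rep_mem ha))
  obtain ⟨κ, h1, h2⟩ := massey_sub_of_rep_eq (s.changeRep (σ ∘ₗ (t.rep - s.rep)) hη) t (fun a => by
    obtain ⟨y, hy⟩ := A.cls_eq.1 ((t.cls_rep a).trans (s.cls_rep a).symm)
    have hy' : A.d y = t.rep a - s.rep a := hy
    change s.rep a + A.d (σ (t.rep a - s.rep a)) = t.rep a
    rw [← hy', h5, hy']; abel)
  refine ⟨κ, h1, fun a b c => ?_⟩
  rw [← h2, changeRep_massey]

end MasseyDatum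
end DGCA

/-! ### Isomorphisms of graded commutative algebras -/

namespace GCA.Iso

variable {K : Type u} [Field K] {B B' B'' : GCA K}

/-- The identity isomorphism. -/
def refl (B : GCA K) : Iso B B := ⟨AlgEquiv.refl, fun _ => Submodule.map_id _⟩

/-- The inverse isomorphism. -/
def symm (f : Iso B B') : Iso B' B where
  toAlgEquiv := f.toAlgEquiv.symm
  map_gr k := by
    ext x
    constructor
    · rintro ⟨y, hy, rfl⟩
      exact f.symm_mem hy
    · intro hx
      exact ⟨f.toAlgEquiv x, f.map_mem hx, f.toAlgEquiv.symm_apply_apply x⟩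

/-- The composition of isomorphisms. -/
def trans (f : Iso B B') (g : Iso B' B'') : Iso B B'' where
  toAlgEquiv := f.toAlgEquiv.trans g.toAlgEquiv
  map_gr k := by
    ext x
    constructor
    · rintro ⟨y, hy, rfl⟩
      exact g.map_mem (f.map_mem hy)
    · intro hx
      exact ⟨f.toAlgEquiv.symm (g.toAlgEquiv.symm x), f.symm_mem (g.symm_mem hx), by simp⟩

theorem map_sgn (f : Iso B B') (x : B.carrier) :
    f.toAlgEquiv (sgn B.gr x) = sgn B'.gr (f.toAlgEquiv x) := f.symm.symm_sgn x

end GCA.Iso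

namespace DGCA

variable {K : Type u} [Field K]

/-! ### Quasi-isomorphisms and the secondary class -/

namespace Hom

variable {A B : DGCA K} (f : Hom A B)

theorem mapH_cls (z : A.cocycles) : f.mapH (A.cls z) = B.cls (f.mapZ z) := rfl

theorem mapH_mul (x y : A.H.carrier) : f.mapH (x * y) = f.mapH x * f.mapH y := by
  obtain ⟨z, rfl⟩ := A.cls_surjective x
  obtain ⟨w, rfl⟩ := A.cls_surjective y
  rw [← map_mul, mapH_cls, mapH_cls, mapH_cls, map_mul, map_mul]

theorem mapH_one : f.mapH 1 = 1 := by
  rw [← map_one A.cls, mapH_cls, map_one, map_one]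

theorem mapH_mem {k : ℕ} {x : A.H.carrier} (hx : x ∈ A.H.gr k) : f.mapH x ∈ B.H.gr k := by
  obtain ⟨z, hz, rfl⟩ := hx
  exact ⟨f.mapZ z, f.map_gr hz, rfl⟩

theorem mapH_decompose (k : ℕ) (x : A.H.carrier) :
    f.mapH (GradedAlgebra.proj A.H.gr k x) = GradedAlgebra.proj B.H.gr k (f.mapH x) := by
  induction x using hom_induction A.H.gr with
  | h0 => simp
  | h2 x y hx hy => rw [map_add, map_add, hx, hy, map_add, map_add]
  | h1 i x hx =>
    simp only [GradedAlgebra.proj_apply]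
    by_cases h : i = k
    · subst h
      rw [DirectSum.decompose_of_mem_same _ hx, DirectSum.decompose_of_mem_same _ (f.mapH_mem hx)]
    · rw [DirectSum.decompose_of_mem_ne _ hx h, DirectSum.decompose_of_mem_ne _ (f.mapH_mem hx) h,
        map_zero]

/-- The isomorphism of cohomology algebras induced by a quasi-isomorphism. -/
def isoOfQuasiIso (hf : f.IsQuasiIso) : GCA.Iso A.H B.H where
  toAlgEquiv := AlgEquiv.ofBijective
    (AlgHom.ofLinearMap f.mapH f.mapH_one f.mapH_mul) hf
  map_gr k := by
    ext x
    constructor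
    · rintro ⟨y, hy, rfl⟩
      exact f.mapH_mem hy
    · intro hx
      obtain ⟨y, rfl⟩ := hf.2 x
      refine ⟨y, ?_, rfl⟩
      have e : GradedAlgebra.proj A.H.gr k y = y := by
        apply hf.1
        rw [mapH_decompose]
        exact DirectSum.decompose_of_mem_same _ hx
      rw [← e]
      exact (DirectSum.decompose A.H.gr y k).2

theorem isoOfQuasiIso_apply (hf : f.IsQuasiIso) (x : A.H.carrier) :
    (f.isoOfQuasiIso hf).toAlgEquiv x = f.mapH x := rfl

theorem map_pred {k : ℕ} {x : A.carrier} (hx : x ∈ pred A.gr k) :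
    f.toAlgHom x ∈ pred B.gr k := by
  rcases mem_of_pred A.gr hx with rfl | ⟨j, rfl, h⟩
  · simp
  · exact f.map_gr h

theorem map_sgn (x : A.carrier) : f.toAlgHom (sgn A.gr x) = sgn B.gr (f.toAlgHom x) := by
  induction x using hom_induction A.gr with
  | h0 => simp
  | h2 x y hx hy => simp only [map_add, hx, hy]
  | h1 i a ha => rw [sgn_of_mem _ ha, sgn_of_mem _ (f.map_gr ha), map_smul]

/-- The image of a Massey datum under a quasi-isomorphism. -/
def mapDatum (hf : f.IsQuasiIso) (s : A.MasseyDatum) : B.MasseyDatum where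
  rep := f.toAlgHom.toLinearMap ∘ₗ s.rep ∘ₗ (f.isoOfQuasiIso hf).toAlgEquiv.symm.toLinearMap
  rep_mem ha := f.map_gr (s.rep_mem ((f.isoOfQuasiIso hf).symm_mem ha))
  d_rep a := by
    change B.d (f.toAlgHom (s.rep ((f.isoOfQuasiIso hf).toAlgEquiv.symm a))) = 0
    rw [← f.map_d, s.d_rep, map_zero]
  cls_rep a := by
    refine Eq.trans ?_ ((f.isoOfQuasiIso hf).toAlgEquiv.apply_symm_apply a)
    exact (f.mapH_cls ⟨_, s.d_rep _⟩).symm.trans (congrArg f.mapH (s.cls_rep _))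
  pri := LinearMap.mk₂ K
    (fun a b => f.toAlgHom (s.pri ((f.isoOfQuasiIso hf).toAlgEquiv.symm a)
      ((f.isoOfQuasiIso hf).toAlgEquiv.symm b)))
    (by intros; simp) (by intros; simp) (by intros; simp) (by intros; simp)
  pri_mem ha hb := f.map_pred
    (s.pri_mem ((f.isoOfQuasiIso hf).symm_mem ha) ((f.isoOfQuasiIso hf).symm_mem hb))
  pri_comm ha hb := by
    simp only [LinearMap.mk₂_apply]
    rw [s.pri_comm ((f.isoOfQuasiIso hf).symm_mem ha) ((f.isoOfQuasiIso hf).symm_mem hb), map_smul]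
  d_pri a b := by
    simp only [LinearMap.mk₂_apply, LinearMap.comp_apply, AlgEquiv.toLinearMap_apply,
      AlgHom.toLinearMap_apply, map_mul]
    rw [← f.map_d, s.d_pri, map_sub, map_mul]

theorem mapDatum_massey (hf : f.IsQuasiIso) (s : A.MasseyDatum) (a b c : B.H.carrier) :
    (f.mapDatum hf s).massey a b c = (f.isoOfQuasiIso hf).toAlgEquiv
      (s.massey ((f.isoOfQuasiIso hf).toAlgEquiv.symm a)
        ((f.isoOfQuasiIso hf).toAlgEquiv.symm b) ((f.isoOfQuasiIso hf).toAlgEquiv.symm c)) := by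
  rw [isoOfQuasiIso_apply, MasseyDatum.massey, MasseyDatum.massey, mapH_cls]
  refine congrArg _ (Subtype.ext ?_)
  change _ = f.toAlgHom (s.cocycle _ _ _)
  simp only [MasseyDatum.cocycle, mapDatum, LinearMap.mk₂_apply, LinearMap.comp_apply,
    AlgEquiv.toLinearMap_apply, AlgHom.toLinearMap_apply, map_mul, map_sub, map_add, map_sgn]

end Hom

/-- There is an isomorphism of the cohomology algebras which identifies, up to Harrison
coboundaries, the Massey operations defined by arbitrary Massey data. -/
def SameSecondaryClass (A B : DGCA K) : Prop :=
  ∃ φ : GCA.Iso A.H B.H, ∀ (s : A.MasseyDatum) (t : B.MasseyDatum),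
    ∃ κ ∈ B.H.CHarr2, ∀ a b c, t.massey a b c - φ.toAlgEquiv
      (s.massey (φ.toAlgEquiv.symm a) (φ.toAlgEquiv.symm b) (φ.toAlgEquiv.symm c))
        = B.H.d2 κ a b c

theorem SameSecondaryClass.symm {A B : DGCA K} (h : SameSecondaryClass A B) :
    SameSecondaryClass B A := by
  obtain ⟨φ, hφ⟩ := h
  refine ⟨φ.symm, fun s t => ?_⟩
  obtain ⟨κ, h1, h2⟩ := hφ t s
  refine ⟨(-1 : K) • φ.symm.map2 κ, Submodule.smul_mem _ _ (φ.symm.map2_mem h1), fun a b c => ?_⟩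
  have h3 := congrArg φ.toAlgEquiv.symm
    (h2 (φ.toAlgEquiv a) (φ.toAlgEquiv b) (φ.toAlgEquiv c))
  rw [map_smul, ← GCA.Iso.map3_d2]
  rw [map_sub] at h3
  simp only [AlgEquiv.symm_apply_apply] at h3
  change t.massey a b c - φ.toAlgEquiv.symm
    (s.massey (φ.toAlgEquiv a) (φ.toAlgEquiv b) (φ.toAlgEquiv c))
    = (-1 : K) • φ.toAlgEquiv.symm (B.H.d2 κ (φ.toAlgEquiv a) (φ.toAlgEquiv b) (φ.toAlgEquiv c))
  rw [← h3]; module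

theorem SameSecondaryClass.trans {A B C : DGCA K} (h : SameSecondaryClass A B)
    (h' : SameSecondaryClass B C) : SameSecondaryClass A C := by
  obtain ⟨φ, hφ⟩ := h
  obtain ⟨ψ, hψ⟩ := h'
  obtain ⟨m⟩ := B.exists_masseyDatum
  -- an auxiliary Massey datum `m` on the intermediate DGCA
  refine ⟨φ.trans ψ, fun s t => ?_⟩
  obtain ⟨κ, h1, h2⟩ := hφ s m
  obtain ⟨κ', h3, h4⟩ := hψ m t
  refine ⟨κ' + ψ.map2 κ, add_mem h3 (ψ.map2_mem h1), fun a b c => ?_⟩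
  have h5 := congrArg ψ.toAlgEquiv
    (h2 (ψ.toAlgEquiv.symm a) (ψ.toAlgEquiv.symm b) (ψ.toAlgEquiv.symm c))
  rw [map_sub] at h5
  rw [map_add, ← GCA.Iso.map3_d2]
  change _ = C.H.d2 κ' a b c + ψ.toAlgEquiv (B.H.d2 κ
    (ψ.toAlgEquiv.symm a) (ψ.toAlgEquiv.symm b) (ψ.toAlgEquiv.symm c))
  rw [← h4, ← h5]
  change t.massey a b c - ψ.toAlgEquiv (φ.toAlgEquiv (s.massey _ _ _)) = _
  rw [sub_add_sub_cancel]
  rfl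

theorem sameSecondaryClass_refl [CharZero K] (A : DGCA K) : SameSecondaryClass A A :=
  ⟨GCA.Iso.refl _, fun s t => s.massey_sub t⟩

theorem Hom.sameSecondaryClass [CharZero K] {A B : DGCA K} (f : Hom A B) (hf : f.IsQuasiIso) :
    SameSecondaryClass A B := by
  refine ⟨f.isoOfQuasiIso hf, fun s t => ?_⟩
  obtain ⟨κ, h1, h2⟩ := (f.mapDatum hf s).massey_sub t
  refine ⟨κ, h1, fun a b c => ?_⟩
  rw [← h2, mapDatum_massey]

/-- The secondary class is an invariant of the homotopy class. -/
theorem SameHomotopyClass.sameSecondaryClass [CharZero K] {A B : DGCA K}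
    (h : SameHomotopyClass A B) : SameSecondaryClass A B := by
  induction h with
  | rel A B h =>
    obtain ⟨f, hf⟩ := h
    exact f.sameSecondaryClass hf
  | refl A => exact sameSecondaryClass_refl A
  | symm A B _ h => exact h.symm
  | trans A B C _ _ h h' => exact h.trans h'

end DGCA

namespace GCA

variable {K : Type u} [Field K] (B : GCA K)

theorem cls_toDGCA_injective : Function.Injective B.toDGCA.cls := by
  intro z w h
  obtain ⟨y, hy⟩ := B.toDGCA.cls_eq.1 h
  have hy' : (0 : B.toDGCA.carrier) = z - w := hy
  exact Subtype.ext (sub_eq_zero.1 hy'.symm)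

/-- A graded commutative algebra is the cohomology of the DGCA with zero differential. -/
def isoCoh : Iso B B.toDGCA.H where
  toAlgEquiv := AlgEquiv.ofBijective
    (B.toDGCA.cls.comp ((AlgHom.id K B.carrier).codRestrict B.toDGCA.cocycles (fun _ => rfl)))
    ⟨fun x y h => congrArg Subtype.val (B.cls_toDGCA_injective h), fun x => by
      obtain ⟨z, rfl⟩ := B.toDGCA.cls_surjective x
      exact ⟨(z : B.toDGCA.carrier), rfl⟩⟩
  map_gr k := by
    ext x
    constructor
    · rintro ⟨y, hy, rfl⟩
      exact ⟨⟨y, rfl⟩, hy, rfl⟩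
    · rintro ⟨z, hz, rfl⟩
      exact ⟨(z : B.toDGCA.carrier), hz, rfl⟩

theorem isoCoh_symm_cls (z : B.toDGCA.cocycles) :
    B.isoCoh.toAlgEquiv.symm (B.toDGCA.cls z) = (z : B.toDGCA.carrier) := by
  exact (AlgEquiv.symm_apply_eq _).2 rfl

/-- The Massey datum on a graded commutative algebra with zero differential. -/
def trivialDatum : B.toDGCA.MasseyDatum where
  rep := B.isoCoh.toAlgEquiv.symm.toLinearMap
  rep_mem ha := B.isoCoh.symm_mem ha
  d_rep _ := rfl
  cls_rep a := by
    obtain ⟨z, rfl⟩ := B.toDGCA.cls_surjective a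
    exact congrArg _ (Subtype.ext (B.isoCoh_symm_cls z))
  pri := 0
  pri_mem _ _ := zero_mem _
  pri_comm _ _ := by simp
  d_pri a b := by
    change (0 : B.carrier) = B.isoCoh.toAlgEquiv.symm a * B.isoCoh.toAlgEquiv.symm b
      - B.isoCoh.toAlgEquiv.symm (a * b)
    rw [map_mul, sub_self]

theorem trivialDatum_massey (a b c : B.toDGCA.H.carrier) : B.trivialDatum.massey a b c = 0 := by
  refine B.toDGCA.cls_eq_zero.2 ⟨0, ?_⟩
  simp [DGCA.MasseyDatum.cocycle, trivialDatum]

end GCA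

namespace PoincareDGCA.HodgeHomotopy

variable {K : Type u} [Field K] {n : ℕ} {A : PoincareDGCA K n} (h : A.HodgeHomotopy)

/-- The Massey datum given by a Hodge homotopy: harmonic representatives, and the primitives
`d⁻ (α β)`. -/
def datum : A.MasseyDatum where
  rep := h.rep
  rep_mem := h.rep_mem
  d_rep := h.d_rep
  cls_rep a := (h.harmCls_cocycle ⟨h.rep a, h.d_rep a⟩).symm.trans (h.harmCls_rep a)
  pri := LinearMap.mk₂ K (fun a b => h.dm (h.rep a * h.rep b))
    (by intros; simp [add_mul]) (by intros; simp) (by intros; simp [mul_add]) (by intros; simp)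
  pri_mem ha hb := h.dm_mem (SetLike.mul_mem_graded (h.rep_mem ha) (h.rep_mem hb))
  pri_comm ha hb := by
    simp only [LinearMap.mk₂_apply]
    rw [A.mul_comm' (h.rep_mem ha) (h.rep_mem hb), map_smul]
  d_pri a b := by
    simp only [LinearMap.mk₂_apply]
    rw [rep_mul, harm_apply, A.leibniz_sgn, h.d_rep, h.d_rep]
    simp

theorem datum_massey (a b c : A.H.carrier) : h.datum.massey a b c = h.mu3 a b c := by
  have e := h.harmCls_cocycle ⟨h.datum.cocycle a b c, h.datum.d_cocycle a b c⟩
  refine e.symm.trans ?_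
  simp only [DGCA.MasseyDatum.cocycle, datum, LinearMap.mk₂_apply, map_sub, map_add, harmCls_dm,
    mu3_apply, m3hat_apply]
  abel

/-- Equality of Harrison classes, spelled out on cocycles. -/
theorem mapHHarr3_eq_iff {n' : ℕ} {A' : PoincareDGCA K n'} (h' : A'.HodgeHomotopy)
    (φ : GCA.Iso A.H A'.H) : φ.mapHHarr3 h.harrisonClass = h'.harrisonClass ↔
      ∃ κ ∈ A'.H.CHarr2, ∀ a b c, h'.mu3 a b c - φ.map3 h.mu3 a b c = A'.H.d2 κ a b c := by
  rw [eq_comm]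
  refine (Submodule.Quotient.eq _).trans ⟨?_, ?_⟩
  · rintro ⟨κ, hκ⟩
    refine ⟨κ.1, κ.2, fun a b c => ?_⟩
    have := congrArg Subtype.val hκ
    change A'.H.d2 κ.1 = h'.mu3 - φ.map3 h.mu3 at this
    rw [this]; rfl
  · rintro ⟨κ, h1, h2⟩
    refine ⟨⟨κ, h1⟩, Subtype.ext ?_⟩
    change A'.H.d2 κ = h'.mu3 - φ.map3 h.mu3
    ext a b c
    rw [← h2]; rfl

theorem harrisonClass_eq_zero_iff : h.harrisonClass = 0 ↔
    ∃ κ ∈ A.H.CHarr2, ∀ a b c, h.mu3 a b c = A.H.d2 κ a b c := by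
  refine (Submodule.Quotient.mk_eq_zero _).trans ⟨?_, ?_⟩
  · rintro ⟨κ, hκ⟩
    refine ⟨κ.1, κ.2, fun a b c => ?_⟩
    have := congrArg Subtype.val hκ
    change A.H.d2 κ.1 = h.mu3 at this
    rw [this]
  · rintro ⟨κ, h1, h2⟩
    refine ⟨⟨κ, h1⟩, Subtype.ext ?_⟩
    change A.H.d2 κ = h.mu3
    ext a b c
    rw [← h2]

/-- The Harrison class does not depend on the Hodge homotopy. -/
theorem harrisonClass_eq [CharZero K] (k : A.HodgeHomotopy) :
    k.harrisonClass = h.harrisonClass := by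
  obtain ⟨κ, h1, h2⟩ := h.datum.massey_sub k.datum
  refine (Submodule.Quotient.eq _).2 ⟨⟨κ, h1⟩, Subtype.ext ?_⟩
  change A.H.d2 κ = k.mu3 - h.mu3
  ext a b c
  rw [← h2, datum_massey, datum_massey]; rfl

theorem exists_iso_of_sameHomotopyClass [CharZero K] {n' : ℕ} {A' : PoincareDGCA K n'}
    (h' : A'.HodgeHomotopy) (e : A.SameHomotopyClass A'.toDGCA) :
    ∃ φ : GCA.Iso A.H A'.H, φ.mapHHarr3 h.harrisonClass = h'.harrisonClass := by
  obtain ⟨φ, hφ⟩ := e.sameSecondaryClass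
  obtain ⟨κ, h1, h2⟩ := hφ h.datum h'.datum
  refine ⟨φ, (mapHHarr3_eq_iff h h' φ).2 ⟨κ, h1, fun a b c => ?_⟩⟩
  rw [← h2, datum_massey, datum_massey]; rfl

theorem harrisonClass_eq_zero_of_isFormal [CharZero K] (e : A.IsFormal) :
    h.harrisonClass = 0 := by
  obtain ⟨φ, hφ⟩ := DGCA.SameHomotopyClass.sameSecondaryClass e |>.symm
  obtain ⟨κ, h1, h2⟩ := hφ A.H.trivialDatum h.datum
  refine (harrisonClass_eq_zero_iff h).2 ⟨κ, h1, fun a b c => ?_⟩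
  rw [← h2, datum_massey, GCA.trivialDatum_massey, map_zero, sub_zero]

end PoincareDGCA.HodgeHomotopy

namespace PoincareDGCA

/-! ### Cohomology of highly connected Poincaré DGCAs -/

variable {K : Type u} [Field K] {n : ℕ} (A : PoincareDGCA K n)

variable {A} in
theorem coh_one_ne_zero {r : ℕ} (hA : A.IsConnected r) : (1 : A.H.carrier) ≠ 0 := by
  intro h
  have h0 : A.H.gr 0 = ⊥ := (Submodule.eq_bot_iff _).2 fun x _ => by
    rw [← one_mul x, h, zero_mul]
  have := hA.1
  rw [h0, finrank_bot] at this
  omega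

variable {A} in
theorem exists_smul_one {r : ℕ} (hA : A.IsConnected r) {x : A.H.carrier} (hx : x ∈ A.H.gr 0) :
    ∃ c : K, x = c • 1 := by
  have h1 : (⟨1, SetLike.one_mem_graded A.H.gr⟩ : A.H.gr 0) ≠ 0 := fun h =>
    coh_one_ne_zero hA (congrArg Subtype.val h)
  obtain ⟨c, hc⟩ := (finrank_eq_one_iff_of_nonzero' _ h1).1 hA.1 ⟨x, hx⟩
  exact ⟨c, (congrArg Subtype.val hc).symm⟩

theorem coh_eq_bot_of_lt {k : ℕ} (hk : n < k) : A.H.gr k = ⊥ := by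
  refine (Submodule.eq_bot_iff _).2 ?_
  rintro _ ⟨z, hz, rfl⟩
  have hz' : (z : A.carrier) ∈ A.gr k := hz
  rw [A.bounded k hk, Submodule.mem_bot] at hz'
  have : z = 0 := Subtype.ext hz'
  rw [this]; exact map_zero _

variable {A} in
/-- A class is zero if it pairs trivially with the complementary degree. -/
theorem eq_zero_of_integral {i j : ℕ} (hij : i + j = n) {x : A.H.carrier} (hx : x ∈ A.H.gr i)
    (h : ∀ y ∈ A.H.gr j, A.integral (x * y) = 0) : x = 0 := by
  refine A.nondegenerate x fun y => ?_
  induction y using hom_induction A.H.gr with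
  | h0 => simp
  | h2 y z hy hz => rw [mul_add, map_add, hy, hz, add_zero]
  | h1 k y hy =>
    by_cases hk : k = j
    · subst hk; exact h y hy
    · exact A.integral_of_ne (i + k) (by omega) _ (SetLike.mul_mem_graded hx hy)

variable {A} in
theorem eq_zero_of_integral_eq_zero {r : ℕ} (hA : A.IsConnected r) {x : A.H.carrier}
    (hx : x ∈ A.H.gr n) (h : A.integral x = 0) : x = 0 := by
  refine eq_zero_of_integral (add_zero n) hx fun y hy => ?_
  obtain ⟨c, rfl⟩ := exists_smul_one hA hy
  rw [mul_smul_comm, mul_one, map_smul, h, smul_zero]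

variable {A} in
/-- Poincaré duality: the cohomology vanishes in degrees `n - r < k < n`, and above `n`. -/
theorem coh_eq_bot {r : ℕ} (hA : A.IsConnected r) {k : ℕ} (hk : n < k + r) (hkn : k ≠ n) :
    A.H.gr k = ⊥ := by
  rcases Nat.lt_or_ge n k with h | h
  · exact A.coh_eq_bot_of_lt h
  · refine (Submodule.eq_bot_iff _).2 fun x hx => ?_
    refine eq_zero_of_integral (j := n - k) (by omega) hx fun y hy => ?_
    rw [hA.2 (n - k) (by omega) (by omega), Submodule.mem_bot] at hy
    rw [hy, mul_zero, map_zero]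

variable {A} in
theorem coh_top_ne_bot {r : ℕ} (hA : A.IsConnected r) : A.H.gr n ≠ ⊥ := by
  intro h
  refine coh_one_ne_zero hA (eq_zero_of_integral (zero_add n) (SetLike.one_mem_graded A.H.gr) ?_)
  intro y hy
  rw [h, Submodule.mem_bot] at hy
  rw [hy, mul_zero, map_zero]

/-- Isomorphic cohomology algebras have the same formal dimension. -/
theorem dimension_eq_of_iso {n' r r' : ℕ} {A : PoincareDGCA K n} {A' : PoincareDGCA K n'}
    (hA : A.IsConnected r) (hA' : A'.IsConnected r') (φ : GCA.Iso A.H A'.H) : n = n' := by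
  have key : ∀ k, A.H.gr k = ⊥ ↔ A'.H.gr k = ⊥ := fun k => by
    rw [← φ.map_gr k, Submodule.map_eq_bot_iff]
  rcases Nat.lt_trichotomy n n' with h | h | h
  · exact absurd ((key _).1 (A.coh_eq_bot_of_lt h)) (coh_top_ne_bot hA')
  · exact h
  · exact absurd ((key _).2 (A'.coh_eq_bot_of_lt h)) (coh_top_ne_bot hA)

namespace HodgeHomotopy

variable {A} (h : A.HodgeHomotopy) {r : ℕ}

/-! ### The secondary projection to cohomology -/

theorem sgn_harmCls (x : A.carrier) : sgn A.H.gr (h.harmCls x) = h.harmCls (sgn A.gr x) := by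
  induction x using hom_induction A.gr with
  | h0 => simp
  | h2 x y hx hy => simp only [map_add, hx, hy]
  | h1 i a ha => rw [sgn_of_mem _ ha, sgn_of_mem _ (h.harmCls_mem ha), map_smul]

theorem pairing_eq {i j : ℕ} (hij : i + j = n) {x y : A.carrier} (hx : x ∈ A.gr i)
    (hy : y ∈ A.gr j) : A.pairing x y = A.integral (h.harmCls (x * y)) := by
  have hxy : x * y ∈ A.gr n := by
    have := SetLike.mul_mem_graded (A := A.gr) hx hy
    rwa [hij] at this
  have e : ((A.topZ (x * y) : A.cocycles) : A.carrier) = x * y := A.proj_of_mem hxy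
  rw [pairing, ← h.harmCls_cocycle, e]

/-- In degrees where it is detected by the pairing, the cohomology class of the product of an
element of `ker d⁻` and an element of `im d⁻` vanishes, since these spaces are orthogonal. -/
theorem harmCls_mul_dm (hA : A.IsConnected r) {i j : ℕ}
    (hij : A.H.gr (i + j) = ⊥ ∨ i + j = n) {x y : A.carrier} (hx : x ∈ A.gr i) (hy : y ∈ A.gr j)
    (hx0 : h.dm x = 0) (hy0 : h.dm (A.d y) = y) : h.harmCls (x * y) = 0 := by
  have hm := h.harmCls_mem (SetLike.mul_mem_graded hx hy)
  rcases hij with hij | hij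
  · rwa [hij, Submodule.mem_bot] at hm
  · rw [hij] at hm
    refine eq_zero_of_integral_eq_zero hA hm ?_
    rw [← h.pairing_eq hij hx hy, ← hy0]
    have ex : x = (x - A.d (h.dm x) - h.dm (A.d x)) + h.dm (A.d x) := by simp [hx0]
    have e1 := h.pairing_harm_dm x (A.d y)
    have e2 := h.pairing_dm_dm (A.d x) (A.d y)
    rw [pairing] at e1 e2 ⊢
    rw [ex, add_mul, map_add, map_add, map_add, e1, e2, add_zero]

theorem harmCls_dm_mul (hA : A.IsConnected r) {i j : ℕ}
    (hij : A.H.gr (i + j) = ⊥ ∨ i + j = n) {x y : A.carrier} (hx : x ∈ A.gr i) (hy : y ∈ A.gr j)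
    (hx0 : h.dm (A.d x) = x) (hy0 : h.dm y = 0) : h.harmCls (x * y) = 0 := by
  rw [A.mul_comm' hx hy, map_smul,
    h.harmCls_mul_dm hA (by rwa [add_comm j i]) hy hx hy0 hx0, smul_zero]

/-- The quadratic component of the `C∞`-morphism from `A` to `H(A)` extending `a ↦ [π a]`. It is the
homotopy `d⁻ ⊗ (1 - ½ d d⁻) + (1 - ½ d d⁻) ⊗ d⁻` followed by the product, symmetrized so that it
is graded symmetric. -/
def quad : A.carrier →ₗ[K] A.carrier →ₗ[K] A.H.carrier :=
  LinearMap.mk₂ K (fun x y => h.harmCls (h.dm x * (y - (2 : K)⁻¹ • A.d (h.dm y))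
      + sgn A.gr (x - (2 : K)⁻¹ • A.d (h.dm x)) * h.dm y))
    (by
      intros
      rw [← map_add]; congr 1
      simp only [map_add, map_sub, map_smul, add_mul, sub_mul, smul_mul_assoc]; module)
    (by
      intros
      rw [← h.harmCls.map_smul]; congr 1
      simp only [map_sub, LinearMap.map_smul, sub_mul, smul_mul_assoc]; module)
    (by
      intros
      rw [← map_add]; congr 1
      simp only [map_add, mul_add, mul_sub, mul_smul_comm]; module)
    (by
      intros
      rw [← h.harmCls.map_smul]; congr 1
      simp only [map_smul, mul_sub, mul_smul_comm]; module)

theorem quad_apply (x y : A.carrier) :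
    h.quad x y = h.harmCls (h.dm x * (y - (2 : K)⁻¹ • A.d (h.dm y))
      + sgn A.gr (x - (2 : K)⁻¹ • A.d (h.dm x)) * h.dm y) := rfl

theorem d_dm_mem {k : ℕ} {x : A.carrier} (hx : x ∈ A.gr k) : A.d (h.dm x) ∈ A.gr k := by
  rcases mem_of_pred A.gr (h.dm_mem hx) with h0 | ⟨j, rfl, h1⟩
  · simp [h0]
  · exact A.d_mem h1

theorem quad_mem {i j : ℕ} {x y : A.carrier} (hx : x ∈ A.gr i) (hy : y ∈ A.gr j) :
    h.quad x y ∈ pred A.H.gr (i + j) := by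
  have hx' : x - (2 : K)⁻¹ • A.d (h.dm x) ∈ A.gr i :=
    sub_mem hx (Submodule.smul_mem _ _ (h.d_dm_mem hx))
  refine h.harmCls_pred (add_mem (mem_pred_mul A.gr (h.dm_mem hx)
    (sub_mem hy (Submodule.smul_mem _ _ (h.d_dm_mem hy)))) ?_)
  rw [sgn_of_mem _ hx', smul_mul_assoc]
  exact Submodule.smul_mem _ _ (mul_mem_pred A.gr hx' (h.dm_mem hy))

theorem quad_comm {i j : ℕ} {x y : A.carrier} (hx : x ∈ A.gr i) (hy : y ∈ A.gr j) :
    h.quad x y = (-1 : K) ^ (i * j) • h.quad y x := by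
  have hx' : x - (2 : K)⁻¹ • A.d (h.dm x) ∈ A.gr i :=
    sub_mem hx (Submodule.smul_mem _ _ (h.d_dm_mem hx))
  have hy' : y - (2 : K)⁻¹ • A.d (h.dm y) ∈ A.gr j :=
    sub_mem hy (Submodule.smul_mem _ _ (h.d_dm_mem hy))
  rw [quad_apply, quad_apply, sgn_of_mem _ hx', sgn_of_mem _ hy', smul_mul_assoc, smul_mul_assoc,
    GCA.comm_pred hy' (h.dm_mem hx), GCA.comm_pred hx' (h.dm_mem hy), ← map_smul]
  rcases GCA.neg_one_pow_cases (K := K) i with ⟨hi, hi'⟩ | ⟨hi, hi'⟩ <;>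
  rcases GCA.neg_one_pow_cases (K := K) j with ⟨hj, hj'⟩ | ⟨hj, hj'⟩ <;>
  simp [hi, hj, pow_add, pow_mul] <;> abel

theorem quad_of_dm_eq_zero {x y : A.carrier} (hx : h.dm x = 0) (hy : h.dm y = 0) :
    h.quad x y = 0 := by
  rw [quad_apply, hx, hy]; simp

theorem quad_of_left {x y : A.carrier} (hx : h.dm x = 0) :
    h.quad x y = h.harmCls (sgn A.gr x * h.dm y) := by
  rw [quad_apply, hx]; simp

theorem quad_of_right {x y : A.carrier} (hy : h.dm y = 0) :
    h.quad x y = h.harmCls (h.dm x * y) := by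
  rw [quad_apply, hy]; simp

theorem dm_one : h.dm 1 = 0 := by
  simpa [pred] using h.dm_mem (SetLike.one_mem_graded A.gr)

theorem quad_one_left (y : A.carrier) : h.quad 1 y = 0 := by
  rw [h.quad_of_left h.dm_one, sgn_of_mem _ (SetLike.one_mem_graded A.gr)]
  simp [harmCls_dm]

theorem quad_one_right (x : A.carrier) : h.quad x 1 = 0 := by
  rw [h.quad_of_right h.dm_one, mul_one, harmCls_dm]

theorem harmCls_one : h.harmCls 1 = 1 := by
  rw [← map_one A.cls]
  exact h.harmCls_cocycle 1

/-- The defect of multiplicativity of `a ↦ [π a]` is the coboundary of `quad`, up to products of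
two elements of `im d⁻`. -/
theorem harmCls_mul_sub [CharZero K] (x y : A.carrier) :
    h.harmCls (x * y) - h.harmCls x * h.harmCls y
      = h.quad (A.d x) y + h.quad (sgn A.gr x) (A.d y)
        - h.harmCls (h.dm (A.d x) * h.dm (A.d y)) := by
  -- the Hodge decompositions are `x = X + d a + u` with `X = π x`, `a = d⁻ x`, `u = d⁻ d x`, and
  -- likewise `y = Y + d b + v`; all mixed terms are part of `quad` up to coboundaries
  have key : ∀ X a u Y b v : A.carrier, A.d X = 0 → A.d Y = 0 →
      (X + A.d a + u) * (Y + A.d b + v) = X * Y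
        + (u * (Y + (2 : K)⁻¹ • A.d b + v) + (2 : K)⁻¹ • (sgn A.gr (A.d u) * b))
        + (-((2 : K)⁻¹ • (sgn A.gr a * A.d v)) + (X + (2 : K)⁻¹ • A.d a + u) * v) - u * v
        + A.d (sgn A.gr X * b + a * Y + a * A.d b
          + (2 : K)⁻¹ • (sgn A.gr u * b) + (2 : K)⁻¹ • (a * v)) := by
    intro X a u Y b v hX hY
    simp only [map_add, map_smul, A.leibniz_sgn, A.d_sgn, sgn_sgn, hX, hY, A.d_d, map_zero,
      neg_zero, zero_mul, mul_zero, add_zero, zero_add, mul_add, add_mul, smul_mul_assoc,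
      mul_smul_comm, smul_add, neg_mul]
    module
  have dec : ∀ z : A.carrier, h.harm z + A.d (h.dm z) + h.dm (A.d z) = z := fun z => by
    rw [harm_apply]; abel
  have k := congrArg h.harmCls
    (key (h.harm x) (h.dm x) (h.dm (A.d x)) (h.harm y) (h.dm y) (h.dm (A.d y))
      (h.d_harm x) (h.d_harm y))
  rw [dec, dec] at k
  have e1 : h.quad (A.d x) y = h.harmCls (h.dm (A.d x) * (h.harm y + (2 : K)⁻¹ • A.d (h.dm y)
      + h.dm (A.d y)) + (2 : K)⁻¹ • (sgn A.gr (A.d (h.dm (A.d x))) * h.dm y)) := by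
    rw [quad_apply, h.d_dm_d]
    congr 2
    · congr 1
      nth_rewrite 1 [← dec y]
      module
    · rw [← smul_mul_assoc]
      congr 1
      rw [map_sub, map_smul]
      module
  have e2 : h.quad (sgn A.gr x) (A.d y) = h.harmCls (-((2 : K)⁻¹ • (sgn A.gr (h.dm x)
      * A.d (h.dm (A.d y)))) + (h.harm x + (2 : K)⁻¹ • A.d (h.dm x) + h.dm (A.d x))
        * h.dm (A.d y)) := by
    have s1 : h.dm (sgn A.gr x) = -sgn A.gr (h.dm x) := by rw [sgn_dm, neg_neg]
    rw [quad_apply, h.d_dm_d, s1]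
    congr 2
    · rw [neg_mul, ← mul_smul_comm]
      congr 2
      module
    · congr 1
      rw [map_sub, sgn_sgn, map_neg, A.d_sgn, neg_neg, map_smul, sgn_sgn]
      nth_rewrite 1 [← dec x]
      module
  rw [e1, e2, k, map_add, map_sub, map_add, map_add, harmCls_d,
    h.harmCls_mul_cocycle (h.d_harm x) (h.d_harm y), harmCls_harm, harmCls_harm]
  abel

end HodgeHomotopy
end PoincareDGCA

namespace PoincareDGCA
namespace HodgeHomotopy

/-! ### Reduced elements -/

variable {K : Type u} [Field K] {n : ℕ} {A : PoincareDGCA K n}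

/-- The elements of degree `k` of a small model of an `(r-1)`-connected Poincaré DGCA: harmonic
elements in degrees `k < 2r - 1`, elements of `ker d⁻` in degree `2r - 1`, and arbitrary elements in
degrees `k ≥ 2r`. -/
structure IsReduced (h : A.HodgeHomotopy) (r k : ℕ) (x : A.carrier) : Prop where
  mem : x ∈ A.gr k
  dm_eq_zero : k < 2 * r → h.dm x = 0
  d_eq_zero : k + 1 < 2 * r → A.d x = 0

variable {h : A.HodgeHomotopy} {r : ℕ}

theorem isReduced_of_le {k : ℕ} (hk : 2 * r ≤ k) {x : A.carrier} (hx : x ∈ A.gr k) :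
    h.IsReduced r k x := ⟨hx, fun _ => by omega, fun _ => by omega⟩

namespace IsReduced

theorem harm_eq {k : ℕ} {x : A.carrier} (hx : h.IsReduced r k x) (hk : k + 1 < 2 * r) :
    h.harm x = x := by
  rw [harm_apply, hx.dm_eq_zero (by omega), hx.d_eq_zero hk]; simp

theorem eq_smul_one (hA : A.IsConnected r) (hr : 2 ≤ r) {x : A.carrier} (hx : h.IsReduced r 0 x) :
    ∃ c : K, x = c • 1 := by
  obtain ⟨c, hc⟩ := exists_smul_one hA (h.harmCls_mem hx.mem)
  refine ⟨c, ?_⟩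
  have h1 : h.harm 1 = 1 := by rw [harm_apply, h.dm_one, A.d_one]; simp
  rw [← hx.harm_eq (by omega), ← h.rep_harmCls, hc, map_smul, ← h.harmCls_one, h.rep_harmCls, h1]

theorem eq_zero (hA : A.IsConnected r) {k : ℕ} (h1 : 1 ≤ k) (h2 : k < r) {x : A.carrier}
    (hx : h.IsReduced r k x) : x = 0 := by
  have hc := h.harmCls_mem hx.mem
  rw [hA.2 k h1 (by omega), Submodule.mem_bot] at hc
  rw [← hx.harm_eq (by omega), ← h.rep_harmCls, hc, map_zero]

theorem zero (k : ℕ) : h.IsReduced r k 0 :=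
  ⟨zero_mem _, fun _ => map_zero _, fun _ => map_zero _⟩

theorem add {k : ℕ} {x y : A.carrier} (hx : h.IsReduced r k x) (hy : h.IsReduced r k y) :
    h.IsReduced r k (x + y) :=
  ⟨add_mem hx.mem hy.mem,
    fun hk => by rw [map_add, hx.dm_eq_zero hk, hy.dm_eq_zero hk, add_zero],
    fun hk => by rw [map_add, hx.d_eq_zero hk, hy.d_eq_zero hk, add_zero]⟩

theorem smul {k : ℕ} (c : K) {x : A.carrier} (hx : h.IsReduced r k x) :
    h.IsReduced r k (c • x) :=
  ⟨Submodule.smul_mem _ _ hx.mem, fun hk => by rw [map_smul, hx.dm_eq_zero hk, smul_zero],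
    fun hk => by rw [map_smul, hx.d_eq_zero hk, smul_zero]⟩

theorem sgn {k : ℕ} {x : A.carrier} (hx : h.IsReduced r k x) :
    h.IsReduced r k (HarrisonDGCA.sgn A.gr x) := by
  rw [sgn_of_mem _ hx.mem]
  exact hx.smul _

end IsReduced

/-- Since `n - r < 3r`, Poincaré duality leaves only the top degree in degrees `≥ 3r`. -/
theorem coh_eq_bot_of_le (hA : A.IsConnected r) (hn : n ≤ 4 * r - 1) {k : ℕ} (hk : 3 * r ≤ k)
    (hkn : k ≠ n) : A.H.gr k = ⊥ := coh_eq_bot hA (by omega) hkn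

theorem coh_or (hA : A.IsConnected r) (hn : n ≤ 4 * r - 1) {k : ℕ} (hk : 3 * r ≤ k) :
    A.H.gr k = ⊥ ∨ k = n := by
  by_cases hkn : k = n
  · exact Or.inr hkn
  · exact Or.inl (coh_eq_bot_of_le hA hn hk hkn)

/-- On reduced elements, `quad` measures the failure of `a ↦ [π a]` to be multiplicative. -/
theorem harmCls_mul_sub_of_isReduced [CharZero K] (hr : 2 ≤ r) (hn : n ≤ 4 * r - 1)
    (hA : A.IsConnected r) {i j : ℕ} {x y : A.carrier} (hx : h.IsReduced r i x) (hy : h.IsReduced r j y) :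
    h.harmCls (x * y) - h.harmCls x * h.harmCls y
      = h.quad (A.d x) y + h.quad (sgn A.gr x) (A.d y) := by
  rw [harmCls_mul_sub, sub_eq_self]
  by_cases hi : i + 1 < 2 * r
  · rw [hx.d_eq_zero hi]; simp
  by_cases hj : j + 1 < 2 * r
  · rw [hy.d_eq_zero hj]; simp
  exact h.harmCls_mul_dm hA (coh_or hA hn (by omega)) (h.dm_mem (A.d_mem hx.mem))
    (h.dm_mem (A.d_mem hy.mem)) (h.dm_dm _) (h.dm_d_dm _)

/-- In low degrees both factors lie in `ker d⁻`, unless one of them is a scalar. -/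
theorem quad_eq_zero_of_lt (hr : 2 ≤ r) (hA : A.IsConnected r)
    {i j : ℕ} {x y : A.carrier} (hx : h.IsReduced r i x) (hy : h.IsReduced r j y)
    (hij : i + j < 3 * r) : h.quad x y = 0 := by
  rcases Nat.eq_zero_or_pos i with rfl | hi
  · obtain ⟨c, rfl⟩ := hx.eq_smul_one hA hr
    rw [map_smul, LinearMap.smul_apply, quad_one_left, smul_zero]
  rcases Nat.eq_zero_or_pos j with rfl | hj
  · obtain ⟨c, rfl⟩ := hy.eq_smul_one hA hr
    rw [map_smul, quad_one_right, smul_zero]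
  by_cases hi' : i < r
  · rw [hx.eq_zero hA hi hi']; simp
  by_cases hj' : j < r
  · rw [hy.eq_zero hA hj hj']; simp
  exact h.quad_of_dm_eq_zero (hx.dm_eq_zero (by omega)) (hy.dm_eq_zero (by omega))

/-- In the top degree, `quad` is given by either of the two one-sided homotopies. -/
theorem quad_top [CharZero K] (hA : A.IsConnected r) {i j : ℕ} (hij : i + j = n + 1)
    {x y : A.carrier} (hx : x ∈ A.gr i) (hy : y ∈ A.gr j) :
    h.quad x y = h.harmCls (h.dm x * y) ∧ h.quad x y = h.harmCls (sgn A.gr x * h.dm y) := by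
  rcases mem_of_pred A.gr (h.dm_mem hx) with hx0 | ⟨i, rfl, hx1⟩
  · rcases mem_of_pred A.gr (h.dm_mem hy) with hy0 | ⟨j, rfl, hy1⟩
    · rw [h.quad_of_left hx0, hx0, hy0]; simp
    · have := h.harmCls_mul_dm hA (i := i) (j := j) (Or.inr (by omega))
        (x := sgn A.gr x) (y := h.dm y) (by
          rw [sgn_of_mem _ hx]; exact Submodule.smul_mem _ _ hx) hy1
        (by rw [sgn_of_mem _ hx, map_smul, hx0, smul_zero]) (h.dm_d_dm y)
      rw [h.quad_of_left hx0, hx0, this]; simp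
  · rcases mem_of_pred A.gr (h.dm_mem hy) with hy0 | ⟨j, rfl, hy1⟩
    · have := h.harmCls_dm_mul hA (i := i) (j := j) (Or.inr (by omega))
        (x := h.dm x) (y := y) hx1 hy (h.dm_d_dm x) hy0
      rw [h.quad_of_right hy0, hy0, this]; simp
    · have e1 : h.harmCls (h.dm x * (y - A.d (h.dm y))) = 0 :=
        h.harmCls_dm_mul hA (i := i) (j := j + 1) (Or.inr (by omega)) hx1
          (sub_mem hy (h.d_dm_mem hy)) (h.dm_d_dm x) (by rw [map_sub, h.dm_d_dm, sub_self])
      have e2 : h.harmCls (sgn A.gr (x - A.d (h.dm x)) * h.dm y) = 0 := by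
        have hm := sub_mem hx (h.d_dm_mem hx)
        rw [sgn_of_mem _ hm, smul_mul_assoc, map_smul,
          h.harmCls_mul_dm hA (i := i + 1) (j := j) (Or.inr (by omega)) hm hy1
          (by rw [map_sub, h.dm_d_dm, sub_self]) (h.dm_d_dm y), smul_zero]
      have e3 := h.harmCls_d (sgn A.gr (h.dm x) * h.dm y)
      rw [A.leibniz_sgn, A.d_sgn, sgn_sgn, neg_mul, map_add, map_neg] at e3
      rw [mul_sub, map_sub, sub_eq_zero] at e1
      rw [map_sub, sub_mul, map_sub, sub_eq_zero] at e2
      have e4 : h.harmCls (sgn A.gr (A.d (h.dm x)) * h.dm y)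
          = h.harmCls (h.dm x * A.d (h.dm y)) := by
        rw [← sub_eq_zero, ← neg_eq_zero, ← e3]; abel
      rw [quad_apply]
      simp only [map_add, map_sub, map_smul, mul_sub, sub_mul, mul_smul_comm, smul_mul_assoc, e1,
        e2, e4]
      constructor <;> module

theorem dm_rep (h : A.HodgeHomotopy) (x : A.H.carrier) : h.dm (h.rep x) = 0 := by
  rw [← h.harmCls_rep x, h.rep_harmCls, harm_apply]
  simp [h.dm_dm, h.dm_d_dm]

/-- On classes of degree `≥ r`, the operation `μ₃` is concentrated in degree `r`, and it vanishes
unless the formal dimension is `4r - 1`: values in the top degree vanish because harmonic elements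
are orthogonal to `im d⁻`, and other values lie in a degree without cohomology. -/
theorem mu3_eq_zero (hr : 2 ≤ r) (hn : n ≤ 4 * r - 1) (hA : A.IsConnected r) {i j k : ℕ}
    {a b c : A.H.carrier} (ha : a ∈ A.H.gr i) (hb : b ∈ A.H.gr j) (hc : c ∈ A.H.gr k)
    (hi : r ≤ i) (hj : r ≤ j) (hk : r ≤ k) (hne : 3 * r < i + j + k ∨ n ≠ 4 * r - 1) :
    h.mu3 a b c = 0 := by
  by_cases ht : i + j + k = n + 1
  · have ha' := h.rep_mem ha
    have hb' := h.rep_mem hb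
    have hc' := h.rep_mem hc
    have hab := h.dm_mem (SetLike.mul_mem_graded ha' hb')
    have hbc := h.dm_mem (SetLike.mul_mem_graded hb' hc')
    rw [pred_of_pos _ (by omega)] at hab hbc
    rw [mu3_apply, m3hat_apply, map_sub, sgn_of_mem _ ha', smul_mul_assoc, map_smul,
      h.harmCls_dm_mul hA (Or.inr (by omega)) hab hc' (h.dm_d_dm _) (h.dm_rep c),
      h.harmCls_mul_dm hA (Or.inr (by omega)) ha' hbc (h.dm_rep a) (h.dm_d_dm _)]
    simp
  · have hm := h.mu3_mem.1.1 i j k a ha b hb c hc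
    rw [pred_of_pos _ (by omega), coh_eq_bot hA (by omega) (by omega), Submodule.mem_bot] at hm
    exact hm

/-- The quadratic component of the `C∞`-morphism `A → H(A)` has coboundary `-μ₃`; there is no cubic
correction on reduced elements, for reasons of degree. -/
theorem quad_cocycle [CharZero K] (hr : 2 ≤ r) (hn : n ≤ 4 * r - 1) (hA : A.IsConnected r)
    {i j k : ℕ} {x y z : A.carrier} (hx : h.IsReduced r i x) (hy : h.IsReduced r j y)
    (hz : h.IsReduced r k z) (hi : r ≤ i) (hj : r ≤ j) (hk : r ≤ k) :
    sgn A.H.gr (h.harmCls x) * h.quad y z - h.quad (x * y) z + h.quad x (y * z)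
      - h.quad x y * h.harmCls z = -h.mu3 (h.harmCls x) (h.harmCls y) (h.harmCls z) := by
  have hxy := SetLike.mul_mem_graded hx.mem hy.mem
  have hyz := SetLike.mul_mem_graded hy.mem hz.mem
  by_cases h3 : i + j + k = 3 * r
  · rw [mu3_apply, h.rep_harmCls, h.rep_harmCls, h.rep_harmCls, hx.harm_eq (by omega),
      hy.harm_eq (by omega), hz.harm_eq (by omega), m3hat_apply,
      h.quad_of_dm_eq_zero (hx.dm_eq_zero (by omega)) (hy.dm_eq_zero (by omega)),
      h.quad_of_dm_eq_zero (hy.dm_eq_zero (by omega)) (hz.dm_eq_zero (by omega)),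
      h.quad_of_right (hz.dm_eq_zero (by omega)), h.quad_of_left (hx.dm_eq_zero (by omega)),
      map_sub]
    simp only [mul_zero, zero_mul, sub_zero, zero_sub]
    abel
  rw [mu3_eq_zero hr hn hA (h.harmCls_mem hx.mem) (h.harmCls_mem hy.mem) (h.harmCls_mem hz.mem)
    hi hj hk (Or.inl (by omega)), neg_zero]
  by_cases ht : i + j + k = n + 1
  · have hl : ∀ {i : ℕ} {x u : A.carrier}, h.IsReduced r i x → i + 1 < 2 * r →
        (∃ j, i + j = n ∧ u ∈ A.gr j) → h.harmCls x * h.harmCls u = h.harmCls (x * u) := by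
      rintro i x u hx hi ⟨j, hij, hu⟩
      rw [mul_harmCls, h.rep_harmCls, hx.harm_eq hi, sub_eq_self]
      exact h.harmCls_mul_dm hA (Or.inr hij) hx.mem (h.dm_mem (A.d_mem hu))
        (hx.dm_eq_zero (by omega)) (h.dm_d_dm _)
    have hr' : ∀ {i : ℕ} {x u : A.carrier}, h.IsReduced r i x → i + 1 < 2 * r →
        (∃ j, j + i = n ∧ u ∈ A.gr j) → h.harmCls u * h.harmCls x = h.harmCls (u * x) := by
      rintro i x u hx hi ⟨j, hij, hu⟩
      rw [harmCls_mul, h.rep_harmCls, hx.harm_eq hi, sub_eq_self]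
      exact h.harmCls_dm_mul hA (Or.inr hij) (h.dm_mem (A.d_mem hu)) hx.mem
        (h.dm_d_dm _) (hx.dm_eq_zero (by omega))
    have dmm : ∀ {k : ℕ} {x : A.carrier}, 0 < k → x ∈ A.gr k → h.dm x ∈ A.gr (k - 1) :=
      fun hk hx => by have := h.dm_mem hx; rwa [pred_of_pos _ hk] at this
    have sgm : ∀ {k : ℕ} {x : A.carrier}, x ∈ A.gr k → sgn A.gr x ∈ A.gr k := fun hx => by
      rw [sgn_of_mem _ hx]; exact Submodule.smul_mem _ _ hx
    rw [sgn_harmCls]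
    by_cases hi2 : 2 * r ≤ i
    · -- `x` has degree `2r`, and `y`, `z` are harmonic of degree `r`
      rw [h.quad_of_dm_eq_zero (hy.dm_eq_zero (by omega)) (hz.dm_eq_zero (by omega)),
        (quad_top hA (by omega) hxy hz.mem).2, hz.dm_eq_zero (by omega),
        (quad_top hA (by omega) hx.mem hyz).1, h.quad_of_right (hy.dm_eq_zero (by omega)),
        hr' hz (by omega) ⟨i - 1 + j, by omega,
          SetLike.mul_mem_graded (dmm (by omega) hx.mem) hy.mem⟩,
        mul_assoc]
      simp
    by_cases hk2 : 2 * r ≤ k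
    · rw [h.quad_of_dm_eq_zero (hx.dm_eq_zero (by omega)) (hy.dm_eq_zero (by omega)),
        (quad_top hA (by omega) hxy hz.mem).2,
        (quad_top hA (by omega) hx.mem hyz).1, hx.dm_eq_zero (by omega),
        h.quad_of_left (hy.dm_eq_zero (by omega)),
        hl hx.sgn (by omega) ⟨j + (k - 1), by omega,
          SetLike.mul_mem_graded (sgm hy.mem) (dmm (by omega) hz.mem)⟩, sgn_mul, mul_assoc]
      simp
    rw [(quad_top hA (by omega) hxy hz.mem).2, hz.dm_eq_zero (by omega),
      (quad_top hA (by omega) hx.mem hyz).1, hx.dm_eq_zero (by omega),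
      h.quad_of_left (hx.dm_eq_zero (by omega)), h.quad_of_right (hz.dm_eq_zero (by omega))]
    by_cases hj2 : 2 * r ≤ j
    · rw [hl hx.sgn (by omega) ⟨j - 1 + k, by omega,
          SetLike.mul_mem_graded (dmm (by omega) hy.mem) hz.mem⟩,
        hr' hz (by omega) ⟨i + (j - 1), by omega,
          SetLike.mul_mem_graded (sgm hx.mem) (dmm (by omega) hy.mem)⟩, mul_assoc]
      simp
    · rw [hy.dm_eq_zero (by omega)]; simp
  · have hbot : pred A.H.gr (i + j + k) = ⊥ := by
      rw [pred_of_pos _ (by omega)]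
      exact coh_eq_bot_of_le hA hn (by omega) (by omega)
    rw [← Submodule.mem_bot K, ← hbot]
    refine sub_mem (add_mem (sub_mem ?_ (h.quad_mem hxy hz.mem)) ?_)
      (mem_pred_mul _ (h.quad_mem hx.mem hy.mem) (h.harmCls_mem hz.mem))
    · rw [sgn_of_mem _ (h.harmCls_mem hx.mem), smul_mul_assoc, add_assoc]
      exact Submodule.smul_mem _ _ (mul_mem_pred _ (h.harmCls_mem hx.mem)
        (h.quad_mem hy.mem hz.mem))
    · rw [add_assoc]; exact h.quad_mem hx.mem hyz

end HodgeHomotopy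
end PoincareDGCA

/-! ### DGCAs from homogeneous data -/

/-- Data for a DGCA whose underlying space consists of those elements of an ambient space `T` whose
components lie in given subspaces `W k`. The product and the differential are defined on all of `T`,
but the axioms are only required on the spaces `W k`. -/
structure PreDGCA (K : Type u) [Field K] where
  T : Type u
  [grp : AddCommGroup T]
  [mod : Module K T]
  /-- the projection to the component of degree `k` -/
  pr : ℕ → T →ₗ[K] T
  exists_sum : ∀ x, ∃ N, x = ∑ k ∈ Finset.range N, pr k x
  W : ℕ → Submodule K T
  pr_self : ∀ {k x}, x ∈ W k → pr k x = x
  pr_ne : ∀ {j k x}, x ∈ W j → j ≠ k → pr k x = 0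
  mul : T →ₗ[K] T →ₗ[K] T
  one : T
  d : T →ₗ[K] T
  mul_mem : ∀ {i j x y}, x ∈ W i → y ∈ W j → mul x y ∈ W (i + j)
  one_mem : one ∈ W 0
  d_mem : ∀ {i x}, x ∈ W i → d x ∈ W (i + 1)
  mul_assoc : ∀ {i j k x y z}, x ∈ W i → y ∈ W j → z ∈ W k → mul (mul x y) z = mul x (mul y z)
  one_mul : ∀ {i x}, x ∈ W i → mul one x = x
  mul_comm : ∀ {i j x y}, x ∈ W i → y ∈ W j → mul x y = (-1 : K) ^ (i * j) • mul y x
  d_d : ∀ {i x}, x ∈ W i → d (d x) = 0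
  leibniz : ∀ {i j x y}, x ∈ W i → y ∈ W j →
    d (mul x y) = mul (d x) y + (-1 : K) ^ i • mul x (d y)

namespace PreDGCA

attribute [instance] PreDGCA.grp PreDGCA.mod

variable {K : Type u} [Field K] (P : PreDGCA K)

/-- The elements all of whose components lie in the spaces `W k`. -/
def tot : Submodule K P.T where
  carrier := {x | ∀ k, P.pr k x ∈ P.W k}
  zero_mem' k := by simp
  add_mem' hx hy k := by rw [map_add]; exact add_mem (hx k) (hy k)
  smul_mem' t x hx k := by rw [map_smul]; exact Submodule.smul_mem _ _ (hx k)

variable {P} in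
theorem mem_tot {k : ℕ} {x : P.T} (hx : x ∈ P.W k) : x ∈ P.tot := fun j => by
  by_cases h : k = j
  · subst h; rwa [P.pr_self hx]
  · rw [P.pr_ne hx h]; exact zero_mem _

variable {P} in
theorem tot_induction {p : (x : P.T) → x ∈ P.tot → Prop}
    (h1 : ∀ k x (hx : x ∈ P.W k), p x (mem_tot hx)) (h0 : p 0 (zero_mem _))
    (h2 : ∀ x y hx hy, p x hx → p y hy → p (x + y) (add_mem hx hy)) {x : P.T} (hx : x ∈ P.tot) :
    p x hx := by
  have key : ∃ hx, p x hx := by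
    obtain ⟨N, hN⟩ := P.exists_sum x
    rw [hN]
    refine Finset.sum_induction _ (fun x => ∃ hx, p x hx) ?_ ⟨_, h0⟩
      fun k _ => ⟨_, h1 k _ (hx k)⟩
    rintro x y ⟨hx, h⟩ ⟨hy, h'⟩
    exact ⟨_, h2 x y hx hy h h'⟩
  exact key.2

theorem mul_mem_tot {x y : P.T} (hx : x ∈ P.tot) (hy : y ∈ P.tot) : P.mul x y ∈ P.tot := by
  induction hx using tot_induction with
  | h0 => simp
  | h2 x x' _ _ h h' => rw [map_add, LinearMap.add_apply]; exact add_mem h h'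
  | h1 i x hx =>
    induction hy using tot_induction with
    | h0 => simp
    | h2 y y' _ _ h h' => rw [map_add]; exact add_mem h h'
    | h1 j y hy => exact mem_tot (P.mul_mem hx hy)

theorem d_mem_tot {x : P.T} (hx : x ∈ P.tot) : P.d x ∈ P.tot := by
  induction hx using tot_induction with
  | h0 => simp
  | h2 x x' _ _ h h' => rw [map_add]; exact add_mem h h'
  | h1 i x hx => exact mem_tot (P.d_mem hx)

theorem mul_assoc_tot {x y z : P.T} (hx : x ∈ P.tot) (hy : y ∈ P.tot) (hz : z ∈ P.tot) :
    P.mul (P.mul x y) z = P.mul x (P.mul y z) := by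
  induction hx using tot_induction with
  | h0 => simp
  | h2 x x' _ _ h h' => simp only [map_add, LinearMap.add_apply, h, h']
  | h1 i x hx =>
    induction hy using tot_induction with
    | h0 => simp
    | h2 y y' _ _ h h' => simp only [map_add, LinearMap.add_apply, h, h']
    | h1 j y hy =>
      induction hz using tot_induction with
      | h0 => simp
      | h2 z z' _ _ h h' => simp only [map_add, h, h']
      | h1 k z hz => exact P.mul_assoc hx hy hz

theorem one_mul_tot {x : P.T} (hx : x ∈ P.tot) : P.mul P.one x = x := by
  induction hx using tot_induction with
  | h0 => simp
  | h2 x x' _ _ h h' => rw [map_add, h, h']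
  | h1 i x hx => exact P.one_mul hx

theorem mul_one_tot {x : P.T} (hx : x ∈ P.tot) : P.mul x P.one = x := by
  induction hx using tot_induction with
  | h0 => simp
  | h2 x x' _ _ h h' => rw [map_add, LinearMap.add_apply, h, h']
  | h1 i x hx => rw [P.mul_comm hx P.one_mem, P.one_mul hx]; simp

/-- The underlying space of the DGCA defined by `P`. -/
def Carrier : Type u := P.tot

instance : AddCommGroup P.Carrier := inferInstanceAs (AddCommGroup P.tot)

instance : Module K P.Carrier := inferInstanceAs (Module K P.tot)

/-- The inclusion into the ambient space. -/
def val : P.Carrier →ₗ[K] P.T := P.tot.subtype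

variable {P} in
theorem ext {x y : P.Carrier} (h : P.val x = P.val y) : x = y := Subtype.ext h

instance : Ring P.Carrier :=
  { (inferInstance : AddCommGroup P.Carrier) with
    mul := fun x y => ⟨P.mul x.1 y.1, P.mul_mem_tot x.2 y.2⟩
    one := ⟨P.one, mem_tot P.one_mem⟩
    left_distrib := fun x y z => Subtype.ext (map_add (P.mul x.1) y.1 z.1)
    right_distrib := fun x y z => Subtype.ext (by
      change P.mul (x.1 + y.1) z.1 = P.mul x.1 z.1 + P.mul y.1 z.1
      rw [map_add, LinearMap.add_apply])
    zero_mul := fun x => Subtype.ext (by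
      change P.mul 0 x.1 = 0
      rw [map_zero, LinearMap.zero_apply])
    mul_zero := fun x => Subtype.ext (map_zero (P.mul x.1))
    mul_assoc := fun x y z => Subtype.ext (P.mul_assoc_tot x.2 y.2 z.2)
    one_mul := fun x => Subtype.ext (P.one_mul_tot x.2)
    mul_one := fun x => Subtype.ext (P.mul_one_tot x.2) }

theorem val_mul (x y : P.Carrier) : P.val (x * y) = P.mul (P.val x) (P.val y) := rfl

instance : Algebra K P.Carrier :=
  Algebra.ofModule
    (fun t x y => ext (by
      rw [val_mul, map_smul, map_smul, map_smul, LinearMap.smul_apply, val_mul]))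
    (fun t x y => ext (by rw [val_mul, map_smul, map_smul, map_smul, val_mul]))

/-- The homogeneous components. -/
def gr (k : ℕ) : Submodule K P.Carrier := (P.W k).comap P.val

instance : SetLike.GradedMonoid P.gr where
  one_mem := P.one_mem
  mul_mem _ _ _ _ hx hy := P.mul_mem hx hy

theorem gr_isInternal : DirectSum.IsInternal P.gr := by
  classical
  refine (DirectSum.isInternal_submodule_iff_iSupIndep_and_iSup_eq_top _).2 ⟨?_, ?_⟩
  · rw [iSupIndep_def]
    intro k
    rw [Submodule.disjoint_def]
    intro x hx hx'
    have h1 : ⨆ j, ⨆ (_ : j ≠ k), P.gr j ≤ LinearMap.ker (P.pr k ∘ₗ P.val) :=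
      iSup₂_le fun j hj y hy => P.pr_ne hy hj
    have h2 : P.pr k (P.val x) = 0 := h1 hx'
    exact ext (by rw [← P.pr_self hx, h2, map_zero])
  · rw [eq_top_iff]
    rintro x -
    obtain ⟨N, hN⟩ := P.exists_sum (P.val x)
    let f : ℕ → P.Carrier := fun k => ⟨P.pr k (P.val x), mem_tot (x.2 k)⟩
    have hf : x = ∑ k ∈ Finset.range N, f k := ext (hN.trans (map_sum P.val f _).symm)
    rw [hf]
    exact Submodule.sum_mem _ fun k _ => Submodule.mem_iSup_of_mem k (x.2 k)

instance : GradedAlgebra P.gr :=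
  { (inferInstance : SetLike.GradedMonoid P.gr), P.gr_isInternal.chooseDecomposition with }

/-- The DGCA defined by homogeneous data. -/
def toDGCA : DGCA K where
  carrier := P.Carrier
  gr := P.gr
  mul_comm' hx hy := ext (by rw [val_mul, map_smul, val_mul]; exact P.mul_comm hx hy)
  d := (P.d ∘ₗ P.val).codRestrict P.tot fun x => P.d_mem_tot x.2
  d_mem hx := P.d_mem hx
  d_d x := by
    refine ext ?_
    change P.d (P.d x.1) = 0
    exact tot_induction (p := fun x _ => P.d (P.d x) = 0) (fun k x hx => P.d_d hx) (by simp)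
      (fun x y _ _ hx hy => by rw [map_add, map_add, hx, hy, add_zero]) x.2
  leibniz {k x} hx y := by
    refine ext ?_
    rw [map_add, map_smul, val_mul, val_mul]
    change P.d (P.mul x.1 y.1) = P.mul (P.d x.1) y.1 + (-1 : K) ^ k • P.mul x.1 (P.d y.1)
    exact tot_induction (p := fun y _ => P.d (P.mul x.1 y) = P.mul (P.d x.1) y
        + (-1 : K) ^ k • P.mul x.1 (P.d y)) (fun j y hy => P.leibniz hx hy) (by simp)
      (fun y y' _ _ h h' => by simp only [map_add, h, h', smul_add]; abel) y.2

end PreDGCA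

theorem GCA.exists_sum_proj {K : Type u} [Field K] (B : GCA K) (x : B.carrier) :
    ∃ N₀, ∀ N, N₀ ≤ N → x = ∑ k ∈ Finset.range N, GradedAlgebra.proj B.gr k x := by
  induction x using hom_induction B.gr with
  | h0 => exact ⟨0, fun N _ => by simp⟩
  | h2 x y hx hy =>
    obtain ⟨N₁, h₁⟩ := hx
    obtain ⟨N₂, h₂⟩ := hy
    refine ⟨max N₁ N₂, fun N hN => ?_⟩
    simp only [map_add, Finset.sum_add_distrib]
    rw [← h₁ N (by omega), ← h₂ N (by omega)]
  | h1 i x hx =>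
    refine ⟨i + 1, fun N hN => ?_⟩
    rw [Finset.sum_eq_single_of_mem i (Finset.mem_range.2 (by omega))]
    · exact (DirectSum.decompose_of_mem_same _ hx).symm
    · intro j _ hj
      exact DirectSum.decompose_of_mem_ne _ hx hj.symm

namespace PoincareDGCA

open HodgeHomotopy

/-! ### The DGCA of paths between two Poincaré DGCAs -/

/-- Two `(r-1)`-connected Poincaré DGCAs of degree `n ≤ 4r - 1` with Hodge homotopies, an
isomorphism `φ` of their cohomology algebras, and a Harrison cochain `κ` with coboundary `μ₃' - φ μ₃`. It is
normalized so that only its components in degrees `r` and `2r` are non-zero. -/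
structure Gluing (K : Type u) [Field K] (n r : ℕ) where
  A : PoincareDGCA K n
  A' : PoincareDGCA K n
  h : A.HodgeHomotopy
  h' : A'.HodgeHomotopy
  two_le : 2 ≤ r
  le : n ≤ 4 * r - 1
  connected : A.IsConnected r
  connected' : A'.IsConnected r
  φ : GCA.Iso A.H A'.H
  κ : A'.H.Coch2
  κ_mem : κ ∈ A'.H.CHarr2
  κ_eq_zero : ∀ {i a}, a ∈ A'.H.gr i → i ≠ r → i ≠ 2 * r → ∀ b, κ a b = 0
  d2_κ : ∀ {i j k a b c}, a ∈ A'.H.gr i → b ∈ A'.H.gr j → c ∈ A'.H.gr k → r ≤ i → r ≤ j → r ≤ k →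
    A'.H.d2 κ a b c = h'.mu3 a b c - φ.map3 h.mu3 a b c

namespace Gluing

variable {K : Type u} [Field K] {n r : ℕ} (G : Gluing K n r)

/-- The ambient space: the triple `(x, x', ν)` stands for a path `x_t + ν dt` with endpoints `x`
and `x'`. -/
abbrev Amb : Type u := G.A.carrier × G.A'.carrier × G.A'.H.carrier

/-- The class in `H(A')` of the midpoint of a path. -/
def bar : G.Amb →ₗ[K] G.A'.H.carrier :=
  (2 : K)⁻¹ • (G.φ.toAlgEquiv.toLinearMap ∘ₗ G.h.harmCls ∘ₗ LinearMap.fst K _ _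
    + G.h'.harmCls ∘ₗ LinearMap.fst K _ _ ∘ₗ LinearMap.snd K _ _)

theorem bar_apply (s : G.Amb) : G.bar s
    = (2 : K)⁻¹ • (G.φ.toAlgEquiv (G.h.harmCls s.1) + G.h'.harmCls s.2.1) := rfl

/-- The difference of the classes in `H(A')` of the endpoints of a path. -/
def diff : G.Amb →ₗ[K] G.A'.H.carrier :=
  G.h'.harmCls ∘ₗ LinearMap.fst K _ _ ∘ₗ LinearMap.snd K _ _
    - G.φ.toAlgEquiv.toLinearMap ∘ₗ G.h.harmCls ∘ₗ LinearMap.fst K _ _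

theorem diff_apply (s : G.Amb) : G.diff s
    = G.h'.harmCls s.2.1 - G.φ.toAlgEquiv (G.h.harmCls s.1) := rfl

/-- The component in direction `dt` of the product of two paths. The last two terms are the product
with the midpoint; the first three restore the Leibniz rule and associativity, which fail because
`a ↦ [π a]` is multiplicative only up to homotopy. -/
def corr : G.Amb →ₗ[K] G.Amb →ₗ[K] G.A'.H.carrier :=
  LinearMap.mk₂ K (fun s t => G.κ (G.bar s) (G.bar t) + G.h'.quad s.2.1 t.2.1
      - G.φ.toAlgEquiv (G.h.quad s.1 t.1) + s.2.2 * G.bar t + sgn G.A'.H.gr (G.bar s) * t.2.2)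
    (by
      intros
      simp only [map_add, LinearMap.add_apply, Prod.fst_add, Prod.snd_add, add_mul]; abel)
    (by
      intros
      simp only [map_smul, LinearMap.smul_apply, Prod.smul_fst, Prod.smul_snd, smul_mul_assoc]
      module)
    (by
      intros
      simp only [map_add, Prod.fst_add, Prod.snd_add, mul_add]; abel)
    (by
      intros
      simp only [map_smul, Prod.smul_fst, Prod.smul_snd, mul_smul_comm]
      module)

theorem corr_apply (s t : G.Amb) : G.corr s t = G.κ (G.bar s) (G.bar t)
      + G.h'.quad s.2.1 t.2.1 - G.φ.toAlgEquiv (G.h.quad s.1 t.1) + s.2.2 * G.bar t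
      + sgn G.A'.H.gr (G.bar s) * t.2.2 := rfl

/-- The product of paths. -/
def mul : G.Amb →ₗ[K] G.Amb →ₗ[K] G.Amb :=
  LinearMap.mk₂ K (fun s t => (s.1 * t.1, s.2.1 * t.2.1, G.corr s t))
    (by intros; simp [add_mul]) (by intros; simp)
    (by intros; simp [mul_add]) (by intros; simp)

theorem mul_apply (s t : G.Amb) : G.mul s t = (s.1 * t.1, s.2.1 * t.2.1, G.corr s t) := rfl

/-- The differential of a path. -/
def d : G.Amb →ₗ[K] G.Amb :=
  LinearMap.prod (G.A.d ∘ₗ LinearMap.fst K _ _)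
    (LinearMap.prod (G.A'.d ∘ₗ LinearMap.fst K _ _ ∘ₗ LinearMap.snd K _ _) G.diff)

theorem d_apply (s : G.Amb) : G.d s = (G.A.d s.1, G.A'.d s.2.1, G.diff s) := rfl

/-- The paths of degree `k`: the endpoints are reduced, they represent the same class in degrees
`k < 2r - 1`, and there are no components in direction `dt` in degrees `k < 2r`. -/
def W (k : ℕ) : Submodule K G.Amb where
  carrier := {s | G.h.IsReduced r k s.1 ∧ G.h'.IsReduced r k s.2.1 ∧ s.2.2 ∈ pred G.A'.H.gr k ∧
    (k < 2 * r → s.2.2 = 0) ∧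
    (k + 1 < 2 * r → G.φ.toAlgEquiv (G.h.harmCls s.1) = G.h'.harmCls s.2.1)}
  zero_mem' := ⟨IsReduced.zero k, IsReduced.zero k, zero_mem _, fun _ => rfl,
    fun _ => by simp⟩
  add_mem' {s t} hs ht := by
    obtain ⟨s1, s2, s3, s4, s5⟩ := hs
    obtain ⟨t1, t2, t3, t4, t5⟩ := ht
    exact ⟨s1.add t1, s2.add t2, add_mem s3 t3,
      fun hk => by rw [Prod.snd_add, Prod.snd_add, s4 hk, t4 hk, add_zero],
      fun hk => by simp only [Prod.fst_add, Prod.snd_add, map_add, s5 hk, t5 hk]⟩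
  smul_mem' c s hs := by
    obtain ⟨s1, s2, s3, s4, s5⟩ := hs
    exact ⟨s1.smul c, s2.smul c, Submodule.smul_mem _ _ s3,
      fun hk => by rw [Prod.smul_snd, Prod.smul_snd, s4 hk, smul_zero],
      fun hk => by simp only [Prod.smul_fst, Prod.smul_snd, map_smul, s5 hk]⟩

variable {G}

section Degree

variable {i j k : ℕ} {s t u : G.Amb}

theorem bar_mem (hs : s ∈ G.W i) : G.bar s ∈ G.A'.H.gr i :=
  Submodule.smul_mem _ _ (add_mem (G.φ.map_mem (G.h.harmCls_mem hs.1.mem))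
    (G.h'.harmCls_mem hs.2.1.mem))

theorem diff_mem (hs : s ∈ G.W i) : G.diff s ∈ G.A'.H.gr i :=
  sub_mem (G.h'.harmCls_mem hs.2.1.mem) (G.φ.map_mem (G.h.harmCls_mem hs.1.mem))

theorem half_add_self [CharZero K] {V : Type u} [AddCommGroup V] [Module K V] (v : V) :
    (2 : K)⁻¹ • (v + v) = v := by
  rw [← two_smul K, smul_smul, inv_mul_cancel₀ two_ne_zero, one_smul]

theorem bar_eq [CharZero K] (hs : s ∈ G.W i) (hi : i + 1 < 2 * r) :
    G.bar s = G.h'.harmCls s.2.1 ∧ G.bar s = G.φ.toAlgEquiv (G.h.harmCls s.1) := by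
  rw [bar_apply, hs.2.2.2.2 hi, half_add_self]
  exact ⟨rfl, rfl⟩

theorem bar_d (s : G.Amb) : G.bar (G.d s) = 0 := by
  rw [bar_apply, d_apply]
  simp [harmCls_d]

/-- The unit: the constant path at `1`. -/
def one (G : Gluing K n r) : G.Amb := (1, 1, 0)

theorem bar_one [CharZero K] : G.bar (one G) = 1 := by
  rw [bar_apply, one, G.h.harmCls_one, G.h'.harmCls_one, map_one, half_add_self]

theorem one_mem : one G ∈ G.W 0 := by
  refine ⟨⟨SetLike.one_mem_graded _, fun _ => G.h.dm_one, fun _ => G.A.d_one⟩,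
    ⟨SetLike.one_mem_graded _, fun _ => G.h'.dm_one, fun _ => G.A'.d_one⟩, zero_mem _,
    fun _ => rfl, fun _ => ?_⟩
  change G.φ.toAlgEquiv (G.h.harmCls 1) = G.h'.harmCls 1
  rw [G.h.harmCls_one, G.h'.harmCls_one, map_one]

theorem eq_smul_one (hs : s ∈ G.W 0) : ∃ c : K, s = c • one G := by
  have hr := G.two_le
  obtain ⟨h1, h2, h3, h4, h5⟩ := hs
  obtain ⟨c, hc⟩ := h1.eq_smul_one G.connected hr
  obtain ⟨c', hc'⟩ := h2.eq_smul_one G.connected' hr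
  have h5 := h5 (by omega)
  rw [hc, hc', map_smul, map_smul, map_smul, G.h.harmCls_one, G.h'.harmCls_one, map_one,
    ← sub_eq_zero, ← sub_smul] at h5
  have h6 := (smul_eq_zero.1 h5).resolve_right (coh_one_ne_zero G.connected')
  refine ⟨c, Prod.ext (by rw [hc]; rfl) (Prod.ext ?_ ?_)⟩
  · rw [hc', ← sub_eq_zero.1 h6]; rfl
  · rw [h4 (by omega)]; exact (smul_zero c).symm

theorem eq_zero_of_mem (h1 : 1 ≤ i) (h2 : i < r) (hs : s ∈ G.W i) : s = 0 :=
  Prod.ext (hs.1.eq_zero G.connected h1 h2) (Prod.ext (hs.2.1.eq_zero G.connected' h1 h2)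
    (hs.2.2.2.1 (by omega)))

theorem one_mul [CharZero K] (s : G.Amb) : G.mul (one G) s = s := by
  have h1 : G.κ 1 (G.bar s) = 0 := G.κ_eq_zero (SetLike.one_mem_graded _)
    (by have := G.two_le; omega) (by have := G.two_le; omega) _
  have h2 : sgn G.A'.H.gr 1 = 1 := by
    rw [sgn_of_mem _ (SetLike.one_mem_graded G.A'.H.gr)]; simp
  rw [mul_apply, corr_apply, bar_one, h1, h2]
  simp [one, quad_one_left]

theorem corr_comm (hs : s ∈ G.W i) (ht : t ∈ G.W j) :
    G.corr s t = (-1 : K) ^ (i * j) • G.corr t s := by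
  have h1 := sub_eq_zero.1 (G.κ_mem.2 i j _ (bar_mem hs) _ (bar_mem ht))
  rw [corr_apply, corr_apply, h1, G.h'.quad_comm hs.2.1.mem ht.2.1.mem,
    G.h.quad_comm hs.1.mem ht.1.mem, sgn_of_mem _ (bar_mem hs), sgn_of_mem _ (bar_mem ht),
    GCA.comm_pred (bar_mem ht) hs.2.2.1, GCA.comm_pred (bar_mem hs) ht.2.2.1]
  simp only [map_smul, smul_mul_assoc]
  rcases GCA.neg_one_pow_cases (K := K) i with ⟨hi, hi'⟩ | ⟨hi, hi'⟩ <;>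
  rcases GCA.neg_one_pow_cases (K := K) j with ⟨hj, hj'⟩ | ⟨hj, hj'⟩ <;>
  simp [hi, hj, pow_add, pow_mul] <;> abel

theorem mul_comm (hs : s ∈ G.W i) (ht : t ∈ G.W j) :
    G.mul s t = (-1 : K) ^ (i * j) • G.mul t s := by
  rw [mul_apply, mul_apply, corr_comm hs ht, G.A.mul_comm' hs.1.mem ht.1.mem,
    G.A'.mul_comm' hs.2.1.mem ht.2.1.mem]
  rfl

theorem corr_mem (hs : s ∈ G.W i) (ht : t ∈ G.W j) :
    G.corr s t ∈ pred G.A'.H.gr (i + j) := by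
  rw [corr_apply, sgn_of_mem _ (bar_mem hs), smul_mul_assoc]
  exact add_mem (add_mem (sub_mem (add_mem (G.κ_mem.1 _ _ _ (bar_mem hs) _ (bar_mem ht))
    (G.h'.quad_mem hs.2.1.mem ht.2.1.mem)) (G.φ.map_pred (G.h.quad_mem hs.1.mem ht.1.mem)))
    (mem_pred_mul _ hs.2.2.1 (bar_mem ht)))
    (Submodule.smul_mem _ _ (mul_mem_pred _ (bar_mem hs) ht.2.2.1))

theorem mul_mem [CharZero K] (hs : s ∈ G.W i) (ht : t ∈ G.W j) : G.mul s t ∈ G.W (i + j) := by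
  have hr := G.two_le
  rcases Nat.eq_zero_or_pos i with rfl | hi
  · obtain ⟨c, rfl⟩ := eq_smul_one hs
    rw [map_smul, LinearMap.smul_apply, one_mul _, zero_add]
    exact Submodule.smul_mem _ _ ht
  rcases Nat.eq_zero_or_pos j with rfl | hj
  · obtain ⟨c, rfl⟩ := eq_smul_one ht
    rw [map_smul, mul_comm hs one_mem, one_mul _, add_zero]
    exact Submodule.smul_mem _ _ (Submodule.smul_mem _ _ hs)
  by_cases hi' : i < r
  · rw [eq_zero_of_mem hi hi' hs]; simp
  by_cases hj' : j < r
  · rw [eq_zero_of_mem hj hj' ht]; simp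
  exact ⟨isReduced_of_le (by omega) (SetLike.mul_mem_graded hs.1.mem ht.1.mem),
    isReduced_of_le (by omega) (SetLike.mul_mem_graded hs.2.1.mem ht.2.1.mem), corr_mem hs ht,
    fun _ => by omega, fun _ => by omega⟩

theorem d_mem (hs : s ∈ G.W i) : G.d s ∈ G.W (i + 1) := by
  obtain ⟨h1, h2, h3, h4, h5⟩ := hs
  rw [d_apply]
  refine ⟨⟨G.A.d_mem h1.mem, fun hi => ?_, fun _ => G.A.d_d _⟩,
    ⟨G.A'.d_mem h2.mem, fun hi => ?_, fun _ => G.A'.d_d _⟩, diff_mem ⟨h1, h2, h3, h4, h5⟩,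
    fun hi => ?_, fun _ => ?_⟩
  · change G.h.dm (G.A.d s.1) = 0
    rw [h1.d_eq_zero hi, map_zero]
  · change G.h'.dm (G.A'.d s.2.1) = 0
    rw [h2.d_eq_zero hi, map_zero]
  · change G.diff s = 0
    rw [diff_apply, h5 hi, sub_self]
  · change G.φ.toAlgEquiv (G.h.harmCls (G.A.d s.1)) = G.h'.harmCls (G.A'.d s.2.1)
    rw [harmCls_d, harmCls_d, map_zero]

theorem d_d (s : G.Amb) : G.d (G.d s) = 0 := by
  refine Prod.ext (G.A.d_d _) (Prod.ext (G.A'.d_d _) ?_)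
  change G.h'.harmCls (G.A'.d s.2.1) - G.φ.toAlgEquiv (G.h.harmCls (G.A.d s.1)) = 0
  rw [harmCls_d, harmCls_d, map_zero, sub_zero]

theorem leibniz [CharZero K] (hs : s ∈ G.W i) (ht : t ∈ G.W j) :
    G.d (G.mul s t) = G.mul (G.d s) t + (-1 : K) ^ i • G.mul s (G.d t) := by
  have e := harmCls_mul_sub_of_isReduced G.two_le G.le G.connected hs.1 ht.1
  have e' := harmCls_mul_sub_of_isReduced G.two_le G.le G.connected' hs.2.1 ht.2.1
  rw [sgn_of_mem _ hs.1.mem, map_smul, LinearMap.smul_apply] at e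
  rw [sgn_of_mem _ hs.2.1.mem, map_smul, LinearMap.smul_apply] at e'
  have e2 := congrArg G.φ.toAlgEquiv e
  rw [map_sub, map_mul G.φ.toAlgEquiv, map_add, map_smul] at e2
  refine Prod.ext (G.A.leibniz hs.1.mem _) (Prod.ext (G.A'.leibniz hs.2.1.mem _) ?_)
  change G.diff (G.mul s t) = G.corr (G.d s) t + (-1 : K) ^ i • G.corr s (G.d t)
  have hsq : ∀ v : G.A'.H.carrier, (-1 : K) ^ i • (-1 : K) ^ i • v = v := fun v => by
    rw [smul_smul, ← mul_pow]; simp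
  have avg : G.h'.harmCls s.2.1 * G.h'.harmCls t.2.1
      - G.φ.toAlgEquiv (G.h.harmCls s.1) * G.φ.toAlgEquiv (G.h.harmCls t.1)
      = G.diff s * G.bar t + G.bar s * G.diff t := by
    rw [diff_apply, diff_apply, bar_apply, bar_apply]
    simp only [smul_mul_assoc, mul_smul_comm, mul_sub, sub_mul, mul_add, add_mul, smul_sub,
      smul_add]
    module
  rw [corr_apply, corr_apply, bar_d, bar_d, diff_apply, mul_apply, sgn_of_mem _ (bar_mem hs)]
  simp only [map_zero, LinearMap.zero_apply, mul_zero, zero_mul, add_zero, zero_add, smul_add,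
    smul_sub, d_apply, smul_mul_assoc, hsq]
  rw [eq_add_of_sub_eq e', eq_add_of_sub_eq e2, eq_add_of_sub_eq avg]
  abel

end Degree

end Gluing
end PoincareDGCA

namespace PoincareDGCA

open HodgeHomotopy

namespace Gluing

variable {K : Type u} [Field K] {n r : ℕ} {G : Gluing K n r}

theorem mul_eq_zero_of_lt {i m : ℕ} {x y : G.A'.H.carrier} (hx : x ∈ G.A'.H.gr i)
    (hy : y ∈ pred G.A'.H.gr m) (hm : 0 < m) (h : n + 1 < i + m) : x * y = 0 := by
  have := mul_mem_pred _ hx hy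
  rwa [pred_of_pos _ (by omega), G.A'.coh_eq_bot_of_lt (by omega), Submodule.mem_bot] at this

theorem mul_eq_zero_of_lt' {i m : ℕ} {x y : G.A'.H.carrier} (hx : x ∈ pred G.A'.H.gr i)
    (hy : y ∈ G.A'.H.gr m) (hm : 0 < i) (h : n + 1 < i + m) : x * y = 0 := by
  have := mem_pred_mul _ hx hy
  rwa [pred_of_pos _ (by omega), G.A'.coh_eq_bot_of_lt (by omega), Submodule.mem_bot] at this

theorem κ_right {i : ℕ} {a b : G.A'.H.carrier} (hb : b ∈ G.A'.H.gr i) (h1 : i ≠ r)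
    (h2 : i ≠ 2 * r) : G.κ a b = 0 := by
  induction a using hom_induction G.A'.H.gr with
  | h0 => simp
  | h2 x y hx hy => rw [map_add, LinearMap.add_apply, hx, hy, add_zero]
  | h1 j a ha =>
    rw [sub_eq_zero.1 (G.κ_mem.2 j i a ha b hb), G.κ_eq_zero hb h1 h2, smul_zero]

section Assoc

variable [CharZero K] {i j k : ℕ} {s t u : G.Amb}

/-- Classes of degree `≥ 3r - 1` are multiplied in the same way by the two endpoints and by the
midpoint of a path of positive degree. -/
theorem sgn_bar_mul (hs : s ∈ G.W i) {m : ℕ} {v : G.A'.H.carrier}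
    (hv : v ∈ pred G.A'.H.gr m) (hv0 : m < 3 * r → v = 0) :
    sgn G.A'.H.gr (G.bar s) * v = sgn G.A'.H.gr (G.h'.harmCls s.2.1) * v ∧
    sgn G.A'.H.gr (G.bar s) * v = sgn G.A'.H.gr (G.φ.toAlgEquiv (G.h.harmCls s.1)) * v := by
  have hr := G.two_le
  have hn := G.le
  by_cases hi : i + 1 < 2 * r
  · rw [← (bar_eq hs hi).1, ← (bar_eq hs hi).2]; exact ⟨rfl, rfl⟩
  by_cases hm : m < 3 * r
  · rw [hv0 hm]; simp
  have key : ∀ x ∈ G.A'.H.gr i, sgn G.A'.H.gr x * v = 0 := fun x hx => by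
    rw [sgn_of_mem _ hx, smul_mul_assoc, mul_eq_zero_of_lt hx hv (by omega) (by omega), smul_zero]
  rw [key _ (bar_mem hs), key _ (G.h'.harmCls_mem hs.2.1.mem),
    key _ (G.φ.map_mem (G.h.harmCls_mem hs.1.mem))]
  exact ⟨rfl, rfl⟩

theorem mul_bar (hs : s ∈ G.W i) {m : ℕ} {v : G.A'.H.carrier}
    (hv : v ∈ pred G.A'.H.gr m) (hv0 : m < 3 * r → v = 0) :
    v * G.bar s = v * G.h'.harmCls s.2.1 ∧
    v * G.bar s = v * G.φ.toAlgEquiv (G.h.harmCls s.1) := by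
  have hr := G.two_le
  have hn := G.le
  by_cases hi : i + 1 < 2 * r
  · rw [← (bar_eq hs hi).1, ← (bar_eq hs hi).2]; exact ⟨rfl, rfl⟩
  by_cases hm : m < 3 * r
  · rw [hv0 hm]; simp
  have key : ∀ x ∈ G.A'.H.gr i, v * x = 0 := fun x hx =>
    mul_eq_zero_of_lt' hv hx (by omega) (by omega)
  rw [key _ (bar_mem hs), key _ (G.h'.harmCls_mem hs.2.1.mem),
    key _ (G.φ.map_mem (G.h.harmCls_mem hs.1.mem))]
  exact ⟨rfl, rfl⟩

/-- Paths of degree `r` are closed, so that passing to classes is multiplicative on them. -/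
theorem bar_mul (hs : s ∈ G.W r) (ht : t ∈ G.W r) : G.bar (G.mul s t) = G.bar s * G.bar t := by
  have hr := G.two_le
  have e1 := (bar_eq hs (by omega)).1.symm.trans (bar_eq hs (by omega)).2
  have e2 := (bar_eq ht (by omega)).1.symm.trans (bar_eq ht (by omega)).2
  rw [(bar_eq hs (by omega)).1, (bar_eq ht (by omega)).1, bar_apply, mul_apply]
  dsimp only
  rw [G.h.harmCls_mul_cocycle (hs.1.d_eq_zero (by omega)) (ht.1.d_eq_zero (by omega)),
    G.h'.harmCls_mul_cocycle (hs.2.1.d_eq_zero (by omega)) (ht.2.1.d_eq_zero (by omega)),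
    map_mul G.φ.toAlgEquiv, ← e1, ← e2, half_add_self]

theorem κ_bar_mul (hs : s ∈ G.W i) (ht : t ∈ G.W j) (hi : r ≤ i) (hj : r ≤ j)
    (v : G.A'.H.carrier) :
    G.κ (G.bar (G.mul s t)) v = G.κ (G.bar s * G.bar t) v ∧
    G.κ v (G.bar (G.mul s t)) = G.κ v (G.bar s * G.bar t) := by
  have hr := G.two_le
  have h1 := bar_mem (mul_mem hs ht)
  have h2 := SetLike.mul_mem_graded (bar_mem hs) (bar_mem ht)
  by_cases h : i + j = 2 * r
  · obtain rfl : i = r := by omega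
    obtain rfl : j = i := by omega
    rw [bar_mul hs ht]; exact ⟨rfl, rfl⟩
  · rw [G.κ_eq_zero h1 (by omega) h, G.κ_eq_zero h2 (by omega) h, κ_right h1 (by omega) h,
      κ_right h2 (by omega) h]
    exact ⟨rfl, rfl⟩

/-- The operations `μ₃` only see the degree `r`, where a path has a well defined class. -/
theorem d2_κ_bar (hs : s ∈ G.W i) (ht : t ∈ G.W j) (hu : u ∈ G.W k) (hi : r ≤ i) (hj : r ≤ j)
    (hk : r ≤ k) : G.A'.H.d2 G.κ (G.bar s) (G.bar t) (G.bar u)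
      = G.h'.mu3 (G.h'.harmCls s.2.1) (G.h'.harmCls t.2.1) (G.h'.harmCls u.2.1)
        - G.φ.toAlgEquiv (G.h.mu3 (G.h.harmCls s.1) (G.h.harmCls t.1) (G.h.harmCls u.1)) := by
  have hr := G.two_le
  rw [G.d2_κ (bar_mem hs) (bar_mem ht) (bar_mem hu) hi hj hk, GCA.Iso.map3_apply]
  by_cases h : 3 * r < i + j + k
  · rw [mu3_eq_zero hr G.le G.connected' (bar_mem hs) (bar_mem ht) (bar_mem hu) hi hj hk (Or.inl h),
      mu3_eq_zero hr G.le G.connected (G.φ.symm_mem (bar_mem hs)) (G.φ.symm_mem (bar_mem ht))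
        (G.φ.symm_mem (bar_mem hu)) hi hj hk (Or.inl h),
      mu3_eq_zero hr G.le G.connected' (G.h'.harmCls_mem hs.2.1.mem) (G.h'.harmCls_mem ht.2.1.mem)
        (G.h'.harmCls_mem hu.2.1.mem) hi hj hk (Or.inl h),
      mu3_eq_zero hr G.le G.connected (G.h.harmCls_mem hs.1.mem) (G.h.harmCls_mem ht.1.mem)
        (G.h.harmCls_mem hu.1.mem) hi hj hk (Or.inl h)]
  · have hs' := bar_eq hs (by omega)
    have ht' := bar_eq ht (by omega)
    have hu' := bar_eq hu (by omega)
    rw [← hs'.1, ← ht'.1, ← hu'.1]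
    rw [hs'.2, ht'.2, hu'.2]
    simp only [AlgEquiv.symm_apply_apply]

/-- The correction term is a Hochschild cocycle: the coboundary of `κ` cancels the coboundaries of
the quadratic components of `A → H(A)` and `A' → H(A')`. -/
theorem corr_assoc (hs : s ∈ G.W i) (ht : t ∈ G.W j) (hu : u ∈ G.W k) (hi : r ≤ i) (hj : r ≤ j)
    (hk : r ≤ k) : G.corr (G.mul s t) u = G.corr s (G.mul t u) := by
  have hr := G.two_le
  have hn := G.le
  have hX := bar_mem hs
  have hY := bar_mem ht
  have hZ := bar_mem hu
  have e1 := quad_cocycle hr hn G.connected hs.1 ht.1 hu.1 hi hj hk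
  have e2 := quad_cocycle hr hn G.connected' hs.2.1 ht.2.1 hu.2.1 hi hj hk
  have e3 := d2_κ_bar hs ht hu hi hj hk
  have e1' := congrArg G.φ.toAlgEquiv e1
  simp only [map_sub, map_add, map_neg, map_mul G.φ.toAlgEquiv, GCA.Iso.map_sgn] at e1'
  have q1 := (sgn_bar_mul hs (G.φ.map_pred (G.h.quad_mem ht.1.mem hu.1.mem))
    (fun hm => by rw [quad_eq_zero_of_lt hr G.connected ht.1 hu.1 hm, map_zero])).2
  have q2 := (sgn_bar_mul hs (G.h'.quad_mem ht.2.1.mem hu.2.1.mem)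
    (fun hm => quad_eq_zero_of_lt hr G.connected' ht.2.1 hu.2.1 hm)).1
  have q3 := (mul_bar hu (G.φ.map_pred (G.h.quad_mem hs.1.mem ht.1.mem))
    (fun hm => by rw [quad_eq_zero_of_lt hr G.connected hs.1 ht.1 hm, map_zero])).2
  have q4 := (mul_bar hu (G.h'.quad_mem hs.2.1.mem ht.2.1.mem)
    (fun hm => quad_eq_zero_of_lt hr G.connected' hs.2.1 ht.2.1 hm)).1
  rw [← q1, ← q3] at e1'
  rw [← q2, ← q4] at e2
  have k1 := (κ_bar_mul hs ht hi hj (G.bar u)).1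
  have k2 := (κ_bar_mul ht hu hj hk (G.bar s)).2
  have n1 : s.2.2 * G.bar (G.mul t u) = s.2.2 * (G.bar t * G.bar u) := by
    by_cases hi2 : i < 2 * r
    · rw [hs.2.2.2.1 hi2]; simp
    by_cases hjk : j + k = 2 * r
    · obtain rfl : j = r := by omega
      obtain rfl : k = j := by omega
      rw [bar_mul ht hu]
    · rw [mul_eq_zero_of_lt' hs.2.2.1 (bar_mem (mul_mem ht hu)) (by omega) (by omega),
        mul_eq_zero_of_lt' hs.2.2.1 (SetLike.mul_mem_graded hY hZ) (by omega) (by omega)]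
  have n2 : sgn G.A'.H.gr (G.bar (G.mul s t)) * u.2.2
      = sgn G.A'.H.gr (G.bar s * G.bar t) * u.2.2 := by
    by_cases hk2 : k < 2 * r
    · rw [hu.2.2.2.1 hk2]; simp
    by_cases hij : i + j = 2 * r
    · obtain rfl : i = r := by omega
      obtain rfl : j = i := by omega
      rw [bar_mul hs ht]
    · have m1 := bar_mem (mul_mem hs ht)
      have m2 := SetLike.mul_mem_graded hX hY
      rw [sgn_of_mem _ m1, sgn_of_mem _ m2, smul_mul_assoc, smul_mul_assoc,
        mul_eq_zero_of_lt m1 hu.2.2.1 (by omega) (by omega),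
        mul_eq_zero_of_lt m2 hu.2.2.1 (by omega) (by omega)]
  rw [GCA.d2_apply] at e3
  rw [corr_apply, corr_apply, k1, k2, n1, n2, sgn_mul]
  simp only [mul_apply, corr_apply]
  rw [← sub_eq_zero] at e1' e2 e3 ⊢
  have total := congrArg₂ (· - ·) (congrArg₂ (· - ·) e1' e2) e3
  simp only [sub_zero] at total
  rw [← total]
  simp only [mul_add, add_mul, mul_sub, sub_mul, mul_assoc]
  abel

theorem mul_assoc (hs : s ∈ G.W i) (ht : t ∈ G.W j) (hu : u ∈ G.W k) :
    G.mul (G.mul s t) u = G.mul s (G.mul t u) := by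
  have mul_one : ∀ {i : ℕ} {s : G.Amb}, s ∈ G.W i → G.mul s (one G) = s := fun hs => by
    rw [mul_comm hs one_mem, one_mul _]; simp
  rcases Nat.eq_zero_or_pos i with rfl | hi
  · obtain ⟨c, rfl⟩ := eq_smul_one hs
    simp only [map_smul, LinearMap.smul_apply, one_mul _]
  rcases Nat.eq_zero_or_pos j with rfl | hj
  · obtain ⟨c, rfl⟩ := eq_smul_one ht
    simp only [map_smul, LinearMap.smul_apply, mul_one hs, one_mul _]
  rcases Nat.eq_zero_or_pos k with rfl | hk
  · obtain ⟨c, rfl⟩ := eq_smul_one hu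
    simp only [map_smul, mul_one ht, mul_one (mul_mem hs ht)]
  by_cases hi' : i < r
  · rw [eq_zero_of_mem hi hi' hs]; simp
  by_cases hj' : j < r
  · rw [eq_zero_of_mem hj hj' ht]; simp
  by_cases hk' : k < r
  · rw [eq_zero_of_mem hk hk' hu]; simp
  exact Prod.ext (_root_.mul_assoc _ _ _) (Prod.ext (_root_.mul_assoc _ _ _)
    (corr_assoc hs ht hu (by omega) (by omega) (by omega)))

end Assoc

end Gluing
end PoincareDGCA

namespace PoincareDGCA

open HodgeHomotopy

namespace Gluing

variable {K : Type u} [Field K] {n r : ℕ} (G : Gluing K n r)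

/-! ### The path object is quasi-isomorphic to both endpoints -/

/-- The component of degree `k` of a path; the component in direction `dt` has its degree raised by
one. -/
def pr (k : ℕ) : G.Amb →ₗ[K] G.Amb :=
  (G.A.proj k).prodMap ((G.A'.proj k).prodMap (G.A'.H.predProj k))

theorem pr_apply (k : ℕ) (s : G.Amb) :
    G.pr k s = (G.A.proj k s.1, G.A'.proj k s.2.1, G.A'.H.predProj k s.2.2) := rfl

theorem exists_sum_pr (s : G.Amb) : ∃ N, s = ∑ k ∈ Finset.range N, G.pr k s := by
  obtain ⟨N₁, h₁⟩ := G.A.exists_sum_proj s.1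
  obtain ⟨N₂, h₂⟩ := G.A'.exists_sum_proj s.2.1
  obtain ⟨N₃, h₃⟩ := G.A'.H.exists_sum_proj s.2.2
  refine ⟨max N₁ (max N₂ N₃) + 1, ?_⟩
  simp only [pr_apply]
  refine Prod.ext ?_ (Prod.ext ?_ ?_)
  · rw [Prod.fst_sum]
    exact h₁ _ (by omega)
  · rw [Prod.snd_sum, Prod.fst_sum]
    exact h₂ _ (by omega)
  · rw [Prod.snd_sum, Prod.snd_sum, Finset.sum_range_succ']
    exact (h₃ (max N₁ (max N₂ N₃)) (by omega)).trans (add_zero _).symm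

variable [CharZero K]

/-- The homogeneous data defining the DGCA of paths. -/
def path : PreDGCA K where
  T := G.Amb
  pr := G.pr
  exists_sum := G.exists_sum_pr
  W := G.W
  pr_self hs := by
    rw [pr_apply, G.A.proj_of_mem hs.1.mem, G.A'.proj_of_mem hs.2.1.mem,
      G.A'.H.predProj_of_mem hs.2.2.1]
  pr_ne hs h := by
    rw [pr_apply, G.A.proj_of_mem_ne hs.1.mem h, G.A'.proj_of_mem_ne hs.2.1.mem h,
      G.A'.H.predProj_of_mem_ne hs.2.2.1 h]
    rfl
  mul := G.mul
  one := one G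
  d := G.d
  mul_mem := mul_mem
  one_mem := one_mem
  d_mem := d_mem
  mul_assoc := mul_assoc
  one_mul _ := one_mul _
  mul_comm := mul_comm
  d_d _ := d_d _
  leibniz := leibniz

/-- The space of all paths. -/
def tot : Submodule K G.Amb := G.path.tot

/-- The triple underlying a path. -/
def val : G.path.toDGCA.carrier →ₗ[K] G.Amb := G.path.val

/-- The starting point of a path. -/
def source : DGCA.Hom G.path.toDGCA G.A.toDGCA where
  toAlgHom := AlgHom.ofLinearMap (LinearMap.fst K _ _ ∘ₗ G.val) rfl (fun _ _ => rfl)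
  map_gr hs := hs.1.mem
  map_d _ := rfl

/-- The end point of a path. -/
def target : DGCA.Hom G.path.toDGCA G.A'.toDGCA where
  toAlgHom := AlgHom.ofLinearMap (LinearMap.fst K _ _ ∘ₗ LinearMap.snd K _ _ ∘ₗ G.val) rfl
    (fun _ _ => rfl)
  map_gr hs := hs.2.1.mem
  map_d _ := rfl

variable {G}

theorem mem_tot {k : ℕ} {s : G.Amb} (hs : s ∈ G.W k) : s ∈ G.tot := PreDGCA.mem_tot (P := G.path) hs

theorem val_d (s : G.path.toDGCA.carrier) : G.val (G.path.toDGCA.d s) = G.d (G.val s) := rfl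

theorem val_mem (s : G.path.toDGCA.carrier) : G.val s ∈ G.tot := s.2

theorem val_injective : Function.Injective G.val := Subtype.val_injective

theorem exists_val_eq {s : G.Amb} (hs : s ∈ G.tot) : ∃ t, G.val t = s := ⟨⟨s, hs⟩, rfl⟩

/-- A homotopy contracting the paths whose endpoints have trivial classes. -/
theorem contract_mem {s : G.Amb} (hs : s ∈ G.tot) :
    ((G.h.dm s.1, G.h'.dm s.2.1 + G.h'.rep s.2.2, 0) : G.Amb) ∈ G.tot := by
  let f : G.Amb →ₗ[K] G.Amb := LinearMap.prod (G.h.dm ∘ₗ LinearMap.fst K _ _)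
    (LinearMap.prod (G.h'.dm ∘ₗ LinearMap.fst K _ _ ∘ₗ LinearMap.snd K _ _
      + G.h'.rep ∘ₗ LinearMap.snd K _ _ ∘ₗ LinearMap.snd K _ _) 0)
  have hf : ∀ s, f s = (G.h.dm s.1, G.h'.dm s.2.1 + G.h'.rep s.2.2, 0) := fun _ => rfl
  have hW : ∀ k, ∀ s ∈ G.W k, f s ∈ G.tot := fun k s hs => by
    by_cases hk : k < 2 * r
    · rw [hf, hs.1.dm_eq_zero hk, hs.2.1.dm_eq_zero hk, hs.2.2.2.1 hk, map_zero, add_zero]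
      exact zero_mem _
    · obtain ⟨j, rfl⟩ : ∃ j, k = j + 1 := ⟨k - 1, by have := G.two_le; omega⟩
      refine mem_tot (k := j) ?_
      rw [hf]
      refine ⟨⟨G.h.dm_mem hs.1.mem, fun _ => G.h.dm_dm _, fun _ => by omega⟩,
        ⟨add_mem (G.h'.dm_mem hs.2.1.mem) (G.h'.rep_mem hs.2.2.1), fun _ => ?_, fun _ => by omega⟩,
        zero_mem _, fun _ => rfl, fun _ => by omega⟩
      change G.h'.dm (G.h'.dm s.2.1 + G.h'.rep s.2.2) = 0
      rw [map_add, G.h'.dm_dm, G.h'.dm_rep, add_zero]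
  exact PreDGCA.tot_induction (P := G.path) (p := fun s _ => f s ∈ G.tot)
    (fun k s hs => hW k s hs)
    ((map_zero f).symm ▸ zero_mem G.tot)
    (fun (s t : G.Amb) _ _ h h' => (map_add f s t).symm ▸ add_mem h h') hs

/-- A closed path is exact if its end point has the trivial class. -/
theorem exists_d_eq {s : G.path.toDGCA.carrier} (hs : G.path.toDGCA.d s = 0)
    (h : G.h'.harmCls (G.val s).2.1 = 0) : ∃ t, G.path.toDGCA.d t = s := by
  have hs' : G.d (G.val s) = 0 := congrArg G.val hs
  have h1 : G.A.d (G.val s).1 = 0 := congrArg (fun t : G.Amb => t.1) hs'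
  have h2 : G.A'.d (G.val s).2.1 = 0 := congrArg (fun t : G.Amb => t.2.1) hs'
  have h3 : G.diff (G.val s) = 0 := congrArg (fun t : G.Amb => t.2.2) hs'
  rw [diff_apply, h, zero_sub, neg_eq_zero, EmbeddingLike.map_eq_zero_iff] at h3
  have e1 : G.A.d (G.h.dm (G.val s).1) = (G.val s).1 := by
    have e := G.h.rep_harmCls (G.val s).1
    rw [h3, map_zero, harm_apply, h1, map_zero, sub_zero] at e
    exact (sub_eq_zero.1 e.symm).symm
  have e2 : G.A'.d (G.h'.dm (G.val s).2.1) = (G.val s).2.1 := by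
    have e := G.h'.rep_harmCls (G.val s).2.1
    rw [h, map_zero, harm_apply, h2, map_zero, sub_zero] at e
    exact (sub_eq_zero.1 e.symm).symm
  obtain ⟨t, ht⟩ := exists_val_eq (contract_mem (val_mem s))
  refine ⟨t, val_injective ?_⟩
  rw [val_d, ht]
  refine Prod.ext e1 (Prod.ext ?_ ?_)
  · change G.A'.d (G.h'.dm (G.val s).2.1 + G.h'.rep (G.val s).2.2) = _
    rw [map_add, e2, G.h'.d_rep, add_zero]
  · change G.h'.harmCls (G.h'.dm (G.val s).2.1 + G.h'.rep (G.val s).2.2)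
      - G.φ.toAlgEquiv (G.h.harmCls (G.h.dm (G.val s).1)) = _
    rw [map_add, harmCls_dm, harmCls_dm, harmCls_rep, map_zero, zero_add, sub_zero]

/-- Every class is represented by a closed path with harmonic endpoints. -/
theorem exists_cocycle (u : G.A.H.carrier) : ∃ z : G.path.toDGCA.cocycles,
    G.val z.1 = (G.h.rep u, G.h'.rep (G.φ.toAlgEquiv u), 0) := by
  have hmem : ((G.h.rep u, G.h'.rep (G.φ.toAlgEquiv u), 0) : G.Amb) ∈ G.tot := by
    induction u using hom_induction G.A.H.gr with
    | h0 => simp only [map_zero]; exact zero_mem G.tot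
    | h2 u v hu hv =>
      have e := add_mem hu hv
      rwa [Prod.mk_add_mk, Prod.mk_add_mk, add_zero, ← map_add, ← map_add, ← map_add] at e
    | h1 k u hu =>
      refine mem_tot (k := k)
        ⟨⟨G.h.rep_mem hu, fun _ => G.h.dm_rep _, fun _ => G.h.d_rep _⟩,
          ⟨G.h'.rep_mem (G.φ.map_mem hu), fun _ => G.h'.dm_rep _, fun _ => G.h'.d_rep _⟩,
          zero_mem _, fun _ => rfl, fun _ => ?_⟩
      change G.φ.toAlgEquiv (G.h.harmCls (G.h.rep u))
        = G.h'.harmCls (G.h'.rep (G.φ.toAlgEquiv u))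
      rw [harmCls_rep, harmCls_rep]
  obtain ⟨s, hs⟩ := exists_val_eq hmem
  have hd : G.path.toDGCA.d s = 0 := by
    refine val_injective ?_
    rw [val_d, hs, map_zero]
    exact Prod.ext (G.h.d_rep _) (Prod.ext (G.h'.d_rep _) (by
      rw [d_apply, diff_apply, harmCls_rep, harmCls_rep, sub_self]; rfl))
  exact ⟨⟨s, hd⟩, hs⟩

theorem source_isQuasiIso : G.source.IsQuasiIso := by
  refine ⟨(injective_iff_map_eq_zero _).2 fun x hx => ?_, fun u => ?_⟩
  · obtain ⟨z, rfl⟩ := G.path.toDGCA.cls_surjective x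
    rw [DGCA.Hom.mapH_cls, DGCA.cls_eq_zero] at hx
    obtain ⟨y, hy⟩ := hx
    have hy' : G.A.d y = (G.val z.1).1 := hy
    have h3 : G.diff (G.val z.1) = 0 :=
      congrArg (fun t : G.Amb => t.2.2) (congrArg G.val z.2)
    rw [diff_apply, ← hy', harmCls_d, map_zero, sub_zero] at h3
    exact (DGCA.cls_eq_zero _).2 (exists_d_eq z.2 h3)
  · obtain ⟨z, hz⟩ := G.exists_cocycle u
    refine ⟨G.path.toDGCA.cls z, ?_⟩
    rw [DGCA.Hom.mapH_cls, ← G.h.harmCls_cocycle]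
    change G.h.harmCls (G.val z.1).1 = u
    rw [hz, harmCls_rep]

theorem target_isQuasiIso : G.target.IsQuasiIso := by
  refine ⟨(injective_iff_map_eq_zero _).2 fun x hx => ?_, fun u => ?_⟩
  · obtain ⟨z, rfl⟩ := G.path.toDGCA.cls_surjective x
    rw [DGCA.Hom.mapH_cls, DGCA.cls_eq_zero] at hx
    obtain ⟨y, hy⟩ := hx
    have hy' : G.A'.d y = (G.val z.1).2.1 := hy
    exact (DGCA.cls_eq_zero _).2 (exists_d_eq z.2 (by rw [← hy', harmCls_d]))
  · obtain ⟨z, hz⟩ := G.exists_cocycle (G.φ.toAlgEquiv.symm u)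
    refine ⟨G.path.toDGCA.cls z, ?_⟩
    rw [DGCA.Hom.mapH_cls, ← G.h'.harmCls_cocycle]
    change G.h'.harmCls (G.val z.1).2.1 = u
    rw [hz, harmCls_rep, AlgEquiv.apply_symm_apply]

theorem sameHomotopyClass (G : Gluing K n r) : G.A.SameHomotopyClass G.A'.toDGCA :=
  .trans _ G.path.toDGCA _ (.symm _ _ (.rel _ _ ⟨_, source_isQuasiIso⟩))
    (.rel _ _ ⟨_, target_isQuasiIso⟩)

end Gluing
end PoincareDGCA

/-! ### Cohomology algebras with equivalent Harrison classes -/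

theorem DGCA.IsConnected.of_iso {K : Type u} [Field K] {A B : DGCA K} {r : ℕ}
    (φ : GCA.Iso A.H B.H) (hA : A.IsConnected r) : B.IsConnected r := by
  refine ⟨?_, fun k h1 h2 => ?_⟩
  · rw [← φ.map_gr 0, ← hA.1]
    exact LinearEquiv.finrank_map_eq φ.toAlgEquiv.toLinearEquiv _
  · rw [← φ.map_gr k, hA.2 k h1 h2, Submodule.map_bot]

namespace PoincareDGCA
namespace HodgeHomotopy

variable {K : Type u} [Field K]

/-- A Harrison cochain with coboundary `μ₃' - φ μ₃` can be replaced by its components in the degrees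
`r` and `2r`, as long as the coboundary is only evaluated in degrees `≥ r`. -/
theorem exists_cochain {n r : ℕ} (hr : 2 ≤ r) (hn : n ≤ 4 * r - 1) {A A' : PoincareDGCA K n}
    (hA : A.IsConnected r) (hA' : A'.IsConnected r) (h : A.HodgeHomotopy) (h' : A'.HodgeHomotopy)
    (φ : GCA.Iso A.H A'.H) {κ : A'.H.Coch2} (hκ : κ ∈ A'.H.CHarr2)
    (hd : ∀ a b c, h'.mu3 a b c - φ.map3 h.mu3 a b c = A'.H.d2 κ a b c) :
    ∃ κ' ∈ A'.H.CHarr2,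
      (∀ i a, a ∈ A'.H.gr i → i ≠ r → i ≠ 2 * r → ∀ b, κ' a b = 0) ∧
      ∀ i j k a b c, a ∈ A'.H.gr i → b ∈ A'.H.gr j → c ∈ A'.H.gr k → r ≤ i → r ≤ j → r ≤ k →
        A'.H.d2 κ' a b c = h'.mu3 a b c - φ.map3 h.mu3 a b c := by
  have hμ : ∀ i j k a b c, a ∈ A'.H.gr i → b ∈ A'.H.gr j → c ∈ A'.H.gr k → r ≤ i → r ≤ j → r ≤ k →
      (3 * r < i + j + k ∨ n ≠ 4 * r - 1) → h'.mu3 a b c - φ.map3 h.mu3 a b c = 0 := by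
    intro i j k a b c ha hb hc hi hj hk hne
    rw [GCA.Iso.map3_apply, mu3_eq_zero hr hn hA' ha hb hc hi hj hk hne,
      mu3_eq_zero hr hn hA (φ.symm_mem ha) (φ.symm_mem hb) (φ.symm_mem hc) hi hj hk hne,
      map_zero, sub_zero]
  by_cases hn4 : n ≠ 4 * r - 1
  · refine ⟨0, zero_mem _, fun _ _ _ _ _ _ => rfl, fun i j k a b c ha hb hc hi hj hk => ?_⟩
    rw [hμ i j k a b c ha hb hc hi hj hk (Or.inr hn4)]
    simp
  rw [not_not] at hn4
  let τ : A'.H.carrier →ₗ[K] A'.H.carrier :=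
    GradedAlgebra.proj A'.H.gr r + GradedAlgebra.proj A'.H.gr (2 * r)
  have τ1 : ∀ {i a}, a ∈ A'.H.gr i → i = r ∨ i = 2 * r → τ a = a := by
    rintro i a ha (rfl | rfl)
    · exact (congrArg₂ (· + ·) (DirectSum.decompose_of_mem_same _ ha)
        (DirectSum.decompose_of_mem_ne _ ha (by omega))).trans (add_zero a)
    · exact (congrArg₂ (· + ·) (DirectSum.decompose_of_mem_ne _ ha (by omega))
        (DirectSum.decompose_of_mem_same _ ha)).trans (zero_add a)
  have τ0 : ∀ {i a}, a ∈ A'.H.gr i → ¬(i = r ∨ i = 2 * r) → τ a = 0 := fun ha hi =>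
    (congrArg₂ (· + ·) (DirectSum.decompose_of_mem_ne _ ha (by omega))
      (DirectSum.decompose_of_mem_ne _ ha (by omega))).trans (add_zero 0)
  let κ' : A'.H.Coch2 := κ.compl₁₂ τ τ
  have κ'_apply : ∀ a b, κ' a b = κ (τ a) (τ b) := fun _ _ => rfl
  have zl : ∀ {i a}, a ∈ A'.H.gr i → ¬(i = r ∨ i = 2 * r) → ∀ b, κ' a b = 0 := fun ha hi b => by
    rw [κ'_apply, τ0 ha hi, map_zero, LinearMap.zero_apply]
  have zr : ∀ {i b}, b ∈ A'.H.gr i → ¬(i = r ∨ i = 2 * r) → ∀ a, κ' a b = 0 := fun hb hi a => by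
    rw [κ'_apply, τ0 hb hi, map_zero]
  have κ'_mem : ∀ {i j a b}, a ∈ A'.H.gr i → b ∈ A'.H.gr j → κ' a b ∈ pred A'.H.gr (i + j) := by
    intro i j a b ha hb
    by_cases hi : i = r ∨ i = 2 * r
    · by_cases hj : j = r ∨ j = 2 * r
      · rw [κ'_apply, τ1 ha hi, τ1 hb hj]; exact hκ.1 i j a ha b hb
      · rw [zr hb hj]; exact zero_mem _
    · rw [zl ha hi]; exact zero_mem _
  refine ⟨κ', ⟨fun i j a ha b hb => κ'_mem ha hb, fun i j a ha b hb => ?_⟩,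
    fun i a ha h1 h2 => zl ha (by omega), fun i j k a b c ha hb hc hi hj hk => ?_⟩
  · by_cases hi : i = r ∨ i = 2 * r
    · by_cases hj : j = r ∨ j = 2 * r
      · rw [κ'_apply, κ'_apply, τ1 ha hi, τ1 hb hj]; exact hκ.2 i j a ha b hb
      · rw [zr hb hj, zl hb hj, smul_zero, sub_zero]
    · rw [zl ha hi, zr ha hi, smul_zero, sub_zero]
  · have hab := SetLike.mul_mem_graded ha hb
    have hbc := SetLike.mul_mem_graded hb hc
    -- if all degrees involved are `r`, `2r`, or carry no cohomology, then `κ'` agrees with `κ`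
    have agree : (i = r ∨ i = 2 * r) → (j = r ∨ j = 2 * r) → (k = r ∨ k = 2 * r) →
        i + j ≤ 3 * r → j + k ≤ 3 * r →
        A'.H.d2 κ' a b c = h'.mu3 a b c - φ.map3 h.mu3 a b c := by
      intro h1 h2 h3 h4 h5
      have τp : ∀ {m x}, x ∈ A'.H.gr m → m = 2 * r ∨ m = 3 * r → τ x = x := by
        rintro m x hx (hm | hm)
        · exact τ1 hx (Or.inr hm)
        · rw [coh_eq_bot_of_le hA' hn (by omega) (by omega), Submodule.mem_bot] at hx
          rw [hx, map_zero]
      rw [hd, GCA.d2_apply, GCA.d2_apply]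
      simp only [κ'_apply]
      rw [τ1 ha h1, τ1 hb h2, τ1 hc h3, τp hab (by omega), τp hbc (by omega)]
    by_cases h3 : i + j + k = 3 * r
    · exact agree (by omega) (by omega) (by omega) (by omega) (by omega)
    by_cases h4 : i + j + k = 4 * r
    · by_cases h2 : i = 2 * r ∨ j = 2 * r ∨ k = 2 * r
      · exact agree (by omega) (by omega) (by omega) (by omega) (by omega)
      · -- no two of the degrees occurring in a term of the coboundary lie in `{r, 2r}`
        rw [hμ i j k a b c ha hb hc hi hj hk (Or.inl (by omega)), GCA.d2_apply]
        have e1 : κ' b c = 0 := by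
          by_cases hj' : j = r ∨ j = 2 * r
          · exact zr hc (by omega) b
          · exact zl hb hj' c
        have e2 : κ' a b = 0 := by
          by_cases hj' : j = r ∨ j = 2 * r
          · exact zl ha (by omega) b
          · exact zr hb hj' a
        have e3 : κ' (a * b) c = 0 := by
          by_cases hk' : k = r ∨ k = 2 * r
          · exact zl hab (by omega) c
          · exact zr hc hk' _
        have e4 : κ' a (b * c) = 0 := by
          by_cases hi' : i = r ∨ i = 2 * r
          · exact zr hbc (by omega) a
          · exact zl ha hi' _
        rw [e1, e2, e3, e4]
        simp
    · -- the values have a degree in which the cohomology vanishes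
      rw [hμ i j k a b c ha hb hc hi hj hk (Or.inl (by omega))]
      have hbot : pred A'.H.gr (i + j + k) = ⊥ := by
        rw [pred_of_pos _ (by omega)]
        exact coh_eq_bot_of_le hA' hn (by omega) (by omega)
      rw [← Submodule.mem_bot K, ← hbot, GCA.d2_apply, sgn_of_mem _ ha, smul_mul_assoc]
      refine sub_mem (add_mem (sub_mem (Submodule.smul_mem _ _ ?_) (κ'_mem hab hc)) ?_)
        (mem_pred_mul _ (κ'_mem ha hb) hc)
      · rw [add_assoc]; exact mul_mem_pred _ ha (κ'_mem hb hc)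
      · rw [add_assoc]; exact κ'_mem ha hbc

/-- The Harrison class determines the homotopy type: the algebra of paths connects `A` and `A'`. -/
theorem sameHomotopyClass_of_mapHHarr3_eq [CharZero K] {n n' r : ℕ} (hr : 2 ≤ r)
    (hn : n ≤ 4 * r - 1) {A : PoincareDGCA K n} {A' : PoincareDGCA K n'}
    (hA : A.IsConnected r) (hA' : A'.IsConnected r) (h : A.HodgeHomotopy) (h' : A'.HodgeHomotopy)
    (φ : GCA.Iso A.H A'.H) (e : φ.mapHHarr3 h.harrisonClass = h'.harrisonClass) :
    A.SameHomotopyClass A'.toDGCA := by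
  obtain rfl := dimension_eq_of_iso hA hA' φ
  obtain ⟨κ, hκ, hd⟩ := (mapHHarr3_eq_iff h h' φ).1 e
  obtain ⟨κ', h1, h2, h3⟩ := exists_cochain hr hn hA hA' h h' φ hκ hd
  exact Gluing.sameHomotopyClass
    { A := A, A' := A', h := h, h' := h', two_le := hr, le := hn, connected := hA,
      connected' := hA', φ := φ, κ := κ', κ_mem := h1, κ_eq_zero := h2 _ _,
      d2_κ := h3 _ _ _ _ _ _ }

end HodgeHomotopy

/-! ### Formality -/

variable {K : Type u} [Field K] {n : ℕ} (A : PoincareDGCA K n)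

/-- The cohomology algebra of a Poincaré DGCA, as a Poincaré DGCA with zero differential. -/
def cohomology : PoincareDGCA K n where
  toDGCA := A.H.toDGCA
  bounded _ hk := A.coh_eq_bot_of_lt hk
  finite_coh :=
    have := A.finite_coh
    Module.Finite.equiv A.H.isoCoh.toAlgEquiv.toLinearEquiv
  integral := A.integral ∘ₗ A.H.isoCoh.toAlgEquiv.symm.toLinearMap
  integral_of_ne k hk _ hx := A.integral_of_ne k hk _ (A.H.isoCoh.symm_mem hx)
  nondegenerate x hx := by
    rw [← EmbeddingLike.map_eq_zero_iff (f := A.H.isoCoh.toAlgEquiv.symm)]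
    refine A.nondegenerate _ fun y => ?_
    have e := hx (A.H.isoCoh.toAlgEquiv y)
    change A.integral (A.H.isoCoh.toAlgEquiv.symm (x * A.H.isoCoh.toAlgEquiv y)) = 0 at e
    rwa [map_mul, AlgEquiv.symm_apply_apply] at e

/-- Every element of a DGCA with zero differential is harmonic for the Hodge homotopy `d⁻ = 0`. -/
def cohomologyHomotopy : A.cohomology.HodgeHomotopy where
  dm := 0
  dm_mem _ := zero_mem _
  dm_dm _ := rfl
  dm_d_dm _ := rfl
  d_dm_d _ := rfl
  pairing_dm_dm _ _ := by simp [pairing]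
  pairing_harm_dm _ _ := by simp [pairing]

theorem cohomologyHomotopy_harrisonClass : A.cohomologyHomotopy.harrisonClass = 0 := by
  refine A.cohomologyHomotopy.harrisonClass_eq_zero_iff.2 ⟨0, zero_mem _, fun a b c => ?_⟩
  rw [HodgeHomotopy.mu3_apply, HodgeHomotopy.m3hat_apply]
  simp [cohomologyHomotopy]

variable {A} in
theorem HodgeHomotopy.isFormal_of_harrisonClass_eq_zero [CharZero K] {r : ℕ} (hr : 2 ≤ r)
    (hn : n ≤ 4 * r - 1) (hA : A.IsConnected r) (h : A.HodgeHomotopy)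
    (e : h.harrisonClass = 0) : A.IsFormal :=
  sameHomotopyClass_of_mapHHarr3_eq hr hn hA (A' := A.cohomology) (hA.of_iso A.H.isoCoh) h
    A.cohomologyHomotopy A.H.isoCoh (by rw [e, map_zero, cohomologyHomotopy_harrisonClass])

end PoincareDGCA
end HarrisonDGCA

end

theorem mainTheorem3 {K : Type u} [Field K] [CharZero K] (r : ℕ) (hr : 2 ≤ r)
    (n n' : ℕ) (hn : n ≤ 4 * r - 1) (hn' : n' ≤ 4 * r - 1)
    (A : HarrisonDGCA.PoincareDGCA K n) (A' : HarrisonDGCA.PoincareDGCA K n')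
    (hA : A.IsConnected r) (hA' : A'.IsConnected r)
    (h : A.HodgeHomotopy) (h' : A'.HodgeHomotopy) :
    (∀ k : A.HodgeHomotopy, k.harrisonClass = h.harrisonClass) ∧
    (A.SameHomotopyClass A'.toDGCA ↔
      ∃ φ : HarrisonDGCA.GCA.Iso A.H A'.H, φ.mapHHarr3 h.harrisonClass = h'.harrisonClass) ∧
    (A.IsFormal ↔ h.harrisonClass = 0) := by
  refine ⟨fun k => h.harrisonClass_eq k, ⟨h.exists_iso_of_sameHomotopyClass h', ?_⟩,
    h.harrisonClass_eq_zero_of_isFormal, h.isFormal_of_harrisonClass_eq_zero hr hn hA⟩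
  rintro ⟨φ, hφ⟩
  exact HarrisonDGCA.PoincareDGCA.HodgeHomotopy.sameHomotopyClass_of_mapHHarr3_eq hr hn hA hA'
    h h' φ hφ
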